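/- Let $(V,g)$ be a smooth Hausdorff $D$-dimensional semi-Riemannian manifold without boundary ($g$ of any signature) with Levi-Civita connection $\nabla$, let $S$ be a smooth $d$-dimensional manifold (Hausdorff, $\sigma$-compact, possibly with boundary), and let $\Phi:S\to V$ be a smooth embedding such that $\gamma=\Phi^*g$ is nondegenerate at every point. For $v\in T_{\Phi(p)}V$ write $v=v^T+v^\perp$ for the decomposition into parts tangent and normal ($g$-orthogonal) to $S$. Let $K(x,y)=-(\nabla_x y)^\perp$ ($x,y$ tangent to $S$) be the shape tensor and $H=\operatorname{tr}_\gamma K$ the mean curvature vector. Let $\operatorname{div}$ be the divergence operator of $(S,\gamma)$, and let $\eta_S$ be the volume element of $\gamma$, $|\eta_S(v_1,\dots,v_d)|=\sqrt{|\det\gamma(v_i,v_j)|}$; volumes and integrals over $S$ are taken with respect to the corresponding density. Let $\xi$ be a $C^1$ vector field on an open neighbourhood $U$ of $\Phi(S)$, with local flow $\varphi_\tau$ on $U$, and put $\Phi_\tau=\varphi_\tau\circ\Phi$. 1. At every point of $S$, $$\tfrac12\operatorname{tr}_\gamma\big[\Phi^*(\pounds_\xi g)\big]=\operatorname{div}(\xi^T)+g(\xi,H).$$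 2. If $\eta_{S_\tau}$ denotes the volume element of $\Phi_\tau^*g$, then at every point of $S$ (evaluated on any $d$ tangent vectors) $$\frac{d}{d\tau}\Big|_{\tau=0}\eta_{S_\tau}=\tfrac12\operatorname{tr}_\gamma\big[\Phi^*(\pounds_\xi g)\big]\,\eta_S .$$ 3. For every compact $C\subseteq S$ (in particular $C=S$ if $S$ is compact) the function $\operatorname{div}(\xi^T)+g(\xi,H)$ is integrable over $C$, the function $\tau\mapsto V_\tau(C)=\int_C\eta_{S_\tau}$ is differentiable at $\tau=0$, and $$\frac{d}{d\tau}\Big|_{\tau=0}V_\tau(C)=\int_C\big(\operatorname{div}(\xi^T)+g(\xi,H)\big)\,\eta_S .$$ 4. Suppose that $S$ has extremal volume among the submanifolds with the same boundary (no condition on the boundary if $\partial S=\emptyset$): for every $\xi$ as above that vanishes along $\partial S$ and for which $\xi\circ\Phi$ has compact support in $S$, and for every local flow of $\xi$, the function $\tau\mapsto V_\tau(C)$ has a critical point or a local extremum at $\tau=0$ for some compact $C\subseteq S$ that contains the support of $\xi\circ\Phi$ (one may take $C=S$ if $S$ is compact). Then $H=0$ on all of $S$. -/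

import Mathlib

open Set MeasureTheory Topology
open scoped Manifold ContDiff

noncomputable section

namespace SemiRiem

/-! ### Linear algebra with a (possibly indefinite) scalar product on `ℝᵐ` -/

section LinearAlgebra

variable {m : ℕ}

/-- The `i`-th vector of the standard basis of `ℝᵐ`. -/
def stdVec (i : Fin m) : EuclideanSpace ℝ (Fin m) := EuclideanSpace.single i 1

/-- The `i`-th coordinate of a vector of `ℝᵐ`. -/
def coord (v : EuclideanSpace ℝ (Fin m)) (i : Fin m) : ℝ := v i

/-- The matrix `(G(eᵢ, eⱼ))` of a bilinear form in the standard basis. -/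
def gram (G : EuclideanSpace ℝ (Fin m) →L[ℝ] EuclideanSpace ℝ (Fin m) →L[ℝ] ℝ) :
    Matrix (Fin m) (Fin m) ℝ :=
  Matrix.of fun i j => G (stdVec i) (stdVec j)

/-- Raising an index: for nondegenerate symmetric `G`, the vector `w` with `G(w, z) = ℓ(z)` for
all `z`, that is `w = ∑ Gⁱʲ ℓ(eⱼ) eᵢ`, for a linear functional `ℓ`. -/
def sharp (G : EuclideanSpace ℝ (Fin m) →L[ℝ] EuclideanSpace ℝ (Fin m) →L[ℝ] ℝ)
    (l : EuclideanSpace ℝ (Fin m) → ℝ) : EuclideanSpace ℝ (Fin m) :=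
  ∑ i, ∑ j, ((gram G)⁻¹ i j * l (stdVec j)) • stdVec i

/-- The trace with respect to `G` of a (scalar- or vector-valued) bilinear map `B`:
`tr_G B = ∑ Gⁱʲ B(eᵢ, eⱼ)`. -/
def metricTrace {W : Type*} [AddCommGroup W] [Module ℝ W]
    (G : EuclideanSpace ℝ (Fin m) →L[ℝ] EuclideanSpace ℝ (Fin m) →L[ℝ] ℝ)
    (B : EuclideanSpace ℝ (Fin m) → EuclideanSpace ℝ (Fin m) → W) : W :=
  ∑ i, ∑ j, (gram G)⁻¹ i j • B (stdVec i) (stdVec j)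

/-- The pullback `(v, w) ↦ B(A v, A w)` of a bilinear form `B` under a linear map `A`. -/
def pullbackForm {n : ℕ}
    (B : EuclideanSpace ℝ (Fin n) →L[ℝ] EuclideanSpace ℝ (Fin n) →L[ℝ] ℝ)
    (A : EuclideanSpace ℝ (Fin m) →L[ℝ] EuclideanSpace ℝ (Fin n)) :
    EuclideanSpace ℝ (Fin m) →L[ℝ] EuclideanSpace ℝ (Fin m) →L[ℝ] ℝ :=
  B.bilinearComp A A

end LinearAlgebra

/-! ### Metrics, connections, Lie derivatives -/

section Manifold

variable {m : ℕ} {H : Type*} [TopologicalSpace H]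
  (I : ModelWithCorners ℝ (EuclideanSpace ℝ (Fin m)) H)
  (M : Type*) [TopologicalSpace M] [ChartedSpace H M]

/-- Fields of bilinear forms on the tangent spaces of `M`. -/
abbrev BilinField : Type _ :=
  (p : M) → (TangentSpace I p →L[ℝ] TangentSpace I p →L[ℝ] ℝ)

/-- A smooth semi-Riemannian metric (of arbitrary signature): a smooth field of nondegenerate
symmetric bilinear forms on the tangent spaces. -/
structure SemiRiemannianMetric [IsManifold I ∞ M] where
  /-- the scalar product on each tangent space -/
  inner : BilinField I M
  symm (p : M) (v w : TangentSpace I p) : inner p v w = inner p w v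
  nondegenerate (p : M) (v : TangentSpace I p) (hv : ∀ w, inner p v w = 0) : v = 0
  contMDiff :
    ContMDiff I (I.prod 𝓘(ℝ, EuclideanSpace ℝ (Fin m) →L[ℝ] EuclideanSpace ℝ (Fin m) →L[ℝ] ℝ)) ∞
      (fun p ↦ Bundle.TotalSpace.mk'
        (EuclideanSpace ℝ (Fin m) →L[ℝ] EuclideanSpace ℝ (Fin m) →L[ℝ] ℝ)
        (E := fun p : M ↦ TangentSpace I p →L[ℝ] TangentSpace I p →L[ℝ] ℝ) p (inner p))

variable {M}

variable [IsManifold I ∞ M]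

/-- The vector field near `p` with constant coefficients in the preferred chart at `p` (a constant
combination of the coordinate fields of that chart) whose coefficients are those of `v`. Its value
at `p` is `v`. -/
def coordExt (p : M) (v : EuclideanSpace ℝ (Fin m)) (q : M) : TangentSpace I q :=
  (trivializationAt (EuclideanSpace ℝ (Fin m)) (TangentSpace I : M → Type _) p).symm q v

/-- The derivative at `p`, in the direction `v`, of a real function on `M`. -/
def dirDeriv (f : M → ℝ) (p : M) (v : TangentSpace I p) : ℝ :=
  mfderiv I 𝓘(ℝ, ℝ) f p v

/-- The derivative at `p`, in the direction `v`, of a map from `M` to `ℝⁿ`. -/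
def dirDerivVec {n : ℕ} (f : M → EuclideanSpace ℝ (Fin n)) (p : M) (v : TangentSpace I p) :
    EuclideanSpace ℝ (Fin n) :=
  mfderiv I 𝓘(ℝ, EuclideanSpace ℝ (Fin n)) f p v

/-- The Christoffel symbols `Γ_p(v, w) = Γᵏᵢⱼ vⁱ wʲ ∂ₖ` at `p` of the Levi-Civita connection of `γ`,
in the preferred chart at `p`:
`γ(Γ(v, w), z) = (∂_v γ(w, z) + ∂_w γ(v, z) - ∂_z γ(v, w)) / 2`. -/
def christoffel (γ : BilinField I M) (p : M) (v w : TangentSpace I p) :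
    EuclideanSpace ℝ (Fin m) :=
  sharp (γ p) fun z =>
    (dirDeriv I (fun q => γ q (coordExt I p w q) (coordExt I p z q)) p v
      + dirDeriv I (fun q => γ q (coordExt I p v q) (coordExt I p z q)) p w
      - dirDeriv I (fun q => γ q (coordExt I p v q) (coordExt I p w q)) p z) / 2

/-- The Lie derivative of a field of bilinear forms,
`(£_ξ g)(x, y) = ξ(g(X, Y)) - g([ξ, X], Y) - g(X, [ξ, Y])` for vector fields `X`, `Y`
that extend `x`, `y`. -/
def lieDerivative (ξ : (p : M) → TangentSpace I p) (g : BilinField I M) (p : M)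
    (x y : TangentSpace I p) : ℝ :=
  dirDeriv I (fun q => g q (coordExt I p x q) (coordExt I p y q)) p (ξ p)
    - g p (VectorField.mlieBracket I ξ (coordExt I p x) p) y
    - g p x (VectorField.mlieBracket I ξ (coordExt I p y) p)

/-- The covariant derivative at `p`, in the direction `v`, of the vector field `Y` on `M`, for the
Levi-Civita connection of `γ`: `∇_v Y = (∂_v Yᵏ + Γᵏᵢⱼ vⁱ Yʲ) ∂ₖ` in the preferred chart at `p`. -/
def covDeriv (γ : BilinField I M) (Y : (p : M) → TangentSpace I p) (p : M)
    (v : TangentSpace I p) : TangentSpace I p :=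
  dirDerivVec I (fun q =>
      (trivializationAt (EuclideanSpace ℝ (Fin m)) (TangentSpace I : M → Type _) p ⟨q, Y q⟩).2) p v
    + christoffel I γ p v (Y p)

/-- The divergence `div X`, the trace of `v ↦ ∇_v X`. -/
def divergence (γ : BilinField I M) (X : (p : M) → TangentSpace I p) (p : M) : ℝ :=
  ∑ i, coord (covDeriv I γ X p (stdVec i)) i

end Manifold

/-! ### The volume element and the volume measure -/

section Volume

variable {d : ℕ} {H : Type*} [TopologicalSpace H]
  (I : ModelWithCorners ℝ (EuclideanSpace ℝ (Fin d)) H)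
  {S : Type*} [TopologicalSpace S] [ChartedSpace H S] [IsManifold I ∞ S]

/-- The canonical volume element of `γ` on `d`-tuples of tangent vectors,
`|η(v₁, …, v_d)| = √|det γ(vᵢ, vⱼ)|`. -/
def volumeElement (γ : BilinField I S) (p : S) (v : Fin d → TangentSpace I p) : ℝ :=
  Real.sqrt |(Matrix.of fun i j => γ p (v i) (v j)).det|

/-- A fixed smooth partition of unity of `S` subordinate to the chart domains. -/
def chartPartition (S : Type*) [TopologicalSpace S] [ChartedSpace H S] [IsManifold I ∞ S]
    [T2Space S] [SigmaCompactSpace S] : SmoothPartitionOfUnity S I S univ :=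
  (SmoothPartitionOfUnity.exists_isSubordinate_chartAt_source I S).choose

/-- The volume measure of `γ` on `S`: in a chart `x` it is `√|det γ(∂ᵢ, ∂ⱼ)| dx¹ ⋯ dx^d`, and these
local expressions are glued with a partition of unity `(ρ_c)` subordinate to the charts. -/
def volumeMeasure [T2Space S] [SigmaCompactSpace S] [MeasurableSpace S]
    (γ : BilinField I S) : Measure S :=
  Measure.sum fun c : S =>
    (((volume : Measure (EuclideanSpace ℝ (Fin d))).restrict (extChartAt I c).target).map
      (extChartAt I c).symm).withDensity
      fun p => ENNReal.ofReal
        (chartPartition I S c p * volumeElement I γ p fun i => coordExt I c (stdVec i) p)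

end Volume

/-! ### Submanifolds -/

section Submanifold

variable {d D : ℕ} {H : Type*} [TopologicalSpace H]
  (I : ModelWithCorners ℝ (EuclideanSpace ℝ (Fin d)) H)
  {S : Type*} [TopologicalSpace S] [ChartedSpace H S] [IsManifold I ∞ S]
  {G : Type*} [TopologicalSpace G]
  (J : ModelWithCorners ℝ (EuclideanSpace ℝ (Fin D)) G)
  {V : Type*} [TopologicalSpace V] [ChartedSpace G V] [IsManifold J ∞ V]

/-- The pullback `Φ^* B`, `(v, w) ↦ B(dΦ v, dΦ w)`. -/
def pullback (Φ : S → V) (B : BilinField J V) : BilinField I S :=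
  fun p => pullbackForm (B (Φ p)) (mfderiv I J Φ p)

/-- The first fundamental form `Φ^* g` is nondegenerate everywhere. -/
def IsNondegenerate (g : BilinField J V) (Φ : S → V) : Prop :=
  ∀ (p : S) (v : TangentSpace I p), (∀ w, pullback I J Φ g p v w = 0) → v = 0

/-- The tangential part of `v ∈ T_{Φ(p)}V`, as an element of `T_pS`: the vector `u` with
`γ(u, w) = g(v, dΦ w)` for all `w ∈ T_pS`. -/
def tangentPart (g : BilinField J V) (Φ : S → V) (p : S) (v : TangentSpace J (Φ p)) :
    TangentSpace I p :=
  sharp (pullback I J Φ g p) fun w => g (Φ p) v (mfderiv I J Φ p w)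

/-- The normal part `v^⊥ = v - dΦ(v^T)` of `v ∈ T_{Φ(p)}V`. -/
def normalPart (g : BilinField J V) (Φ : S → V) (p : S) (v : TangentSpace J (Φ p)) :
    TangentSpace J (Φ p) :=
  v - mfderiv I J Φ p (tangentPart I J g Φ p v)

/-- The covariant derivative at `p`, in the direction `v ∈ T_pS`, of a vector field `Y` along `Φ`
(with values in `TV`), for the Levi-Civita connection `∇` of `g`. -/
def covDerivAlong (g : BilinField J V) (Φ : S → V) (Y : (p : S) → TangentSpace J (Φ p)) (p : S)
    (v : TangentSpace I p) : TangentSpace J (Φ p) :=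
  dirDerivVec I (fun q =>
      (trivializationAt (EuclideanSpace ℝ (Fin D)) (TangentSpace J : V → Type _) (Φ p)
        ⟨Φ q, Y q⟩).2) p v
    + christoffel J g (Φ p) (mfderiv I J Φ p v) (Y p)

/-- The shape tensor `K(x, y) = -(∇_x y)^⊥`, where `y` is extended to a vector field on `S`. -/
def shapeTensor (g : BilinField J V) (Φ : S → V) (p : S) (x y : TangentSpace I p) :
    TangentSpace J (Φ p) :=
  -normalPart I J g Φ p
    (covDerivAlong I J g Φ (fun q => mfderiv I J Φ q (coordExt I p y q)) p x)

/-- The mean curvature vector `H = tr_γ K`. -/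
def meanCurvature (g : BilinField J V) (Φ : S → V) (p : S) : TangentSpace J (Φ p) :=
  metricTrace (pullback I J Φ g p) (shapeTensor I J g Φ p)

/-- The function `½ tr_γ [Φ^*(£_ξ g)]` on `S`. -/
def halfTraceLie (g : BilinField J V) (Φ : S → V) (ξ : (x : V) → TangentSpace J x) (p : S) : ℝ :=
  (1 / 2) * metricTrace (pullback I J Φ g p) fun x y =>
    lieDerivative J ξ g (Φ p) (mfderiv I J Φ p x) (mfderiv I J Φ p y)

/-- The function `div(ξ^T) + g(ξ, H)` on `S`; here `div` is the divergence of `(S, Φ^* g)`. -/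
def divPlusMean (g : BilinField J V) (Φ : S → V) (ξ : (x : V) → TangentSpace J x) (p : S) : ℝ :=
  divergence I (pullback I J Φ g) (fun q => tangentPart I J g Φ q (ξ (Φ q))) p
    + g (Φ p) (ξ (Φ p)) (meanCurvature I J g Φ p)

/-- `φ` is a local flow, with domain `W ⊆ ℝ × U`, of the vector field `ξ` on `U`: `W` is open and
contains `{0} × U`, for each `q` the set of times `τ` with `(τ, q) ∈ W` is an interval, and on it
`τ ↦ φ τ q` is the integral curve of `ξ` in `U` that starts at `q`. Values of `φ` outside `W` are
irrelevant. -/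
structure IsLocalFlow (ξ : (x : V) → TangentSpace J x) (U : Set V) (W : Set (ℝ × V))
    (φ : ℝ → V → V) : Prop where
  isOpen : IsOpen W
  subset : ∀ τ q, (τ, q) ∈ W → q ∈ U
  zero_mem : ∀ q ∈ U, ((0 : ℝ), q) ∈ W
  interval : ∀ q, {τ : ℝ | (τ, q) ∈ W}.OrdConnected
  mapsTo : ∀ τ q, (τ, q) ∈ W → φ τ q ∈ U
  init : ∀ q ∈ U, φ 0 q = q
  integralCurve : ∀ q, IsMIntegralCurveOn (I := J) (fun τ => φ τ q) ξ {τ : ℝ | (τ, q) ∈ W}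

/-- The `d`-volume of the part over `K ⊆ S` of the submanifold `Φ`. -/
def volumeOver [T2Space S] [SigmaCompactSpace S] [MeasurableSpace S]
    (g : BilinField J V) (K : Set S) (Φ : S → V) : ℝ :=
  (volumeMeasure I (pullback I J Φ g)).real K

/-- `Φ` has extremal `d`-volume among the submanifolds with the same boundary: for every `C¹` vector
field `ξ` near `Φ(S)` that vanishes on the boundary of `S` and outside a compact part of `S`, and
for its flow `φ_τ`, the volume of (a compact part of `S` that contains everything that moves under)
`Φ_τ = φ_τ ∘ Φ` has at `τ = 0` a critical point or a local extremum.
When `S` has no boundary the condition on the boundary is empty, and when `S` is compact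
the condition on the support is empty and all of `S` may be taken as the compact part. -/
def HasExtremalVolume [T2Space S] [SigmaCompactSpace S] [MeasurableSpace S]
    (g : BilinField J V) (Φ : S → V) : Prop :=
  ∀ (U : Set V) (ξ : (x : V) → TangentSpace J x) (W : Set (ℝ × V)) (φ : ℝ → V → V),
    IsOpen U → range Φ ⊆ U →
    ContMDiffOn J J.tangent 1 (fun x => (⟨x, ξ x⟩ : TangentBundle J V)) U →
    IsLocalFlow J ξ U W φ →
    (∀ p ∈ I.boundary S, ξ (Φ p) = 0) →
    IsCompact (closure {p | ξ (Φ p) ≠ 0}) →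
    ∃ K : Set S, IsCompact K ∧ closure {p | ξ (Φ p) ≠ 0} ⊆ K ∧
      (HasDerivAt (fun τ => volumeOver I J g K (φ τ ∘ Φ)) 0 0 ∨
        IsLocalExtr (fun τ => volumeOver I J g K (φ τ ∘ Φ)) 0)

end Submanifold

end SemiRiem

end

noncomputable section

namespace SemiRiem

section Flow

open Metric

variable {E : Type*} [NormedAddCommGroup E] [NormedSpace ℝ E] [CompleteSpace E]

theorem exists_hasDerivWithinAt_linear {A : ℝ → E →L[ℝ] E} {M T : ℝ} (hM : 0 ≤ M) (hT : 0 ≤ T)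
    (hMT : 2 * M * T ≤ 1) (hA : ContinuousOn A (Icc 0 T)) (hAM : ∀ t ∈ Icc 0 T, ‖A t‖ ≤ M) :
    ∃ Ψ : ℝ → E →L[ℝ] E, Ψ 0 = 1 ∧
      ∀ t ∈ Icc 0 T, HasDerivWithinAt Ψ (A t ∘L Ψ t) (Icc 0 T) t := by
  have h0 : (0 : ℝ) ∈ Icc 0 T := ⟨le_rfl, hT⟩
  have one_le : ‖(1 : E →L[ℝ] E)‖ ≤ 1 := ContinuousLinearMap.norm_id_le
  have H : IsPicardLindelof (fun t (Ψ : E →L[ℝ] E) => A t ∘L Ψ) (tmin := 0) (tmax := T) ⟨0, h0⟩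
      (1 : E →L[ℝ] E) 1 0 ⟨2 * M, by positivity⟩ ⟨M, hM⟩ := by
    refine ⟨fun t ht => ?_, fun x _ => ?_, fun t ht x hx => ?_, ?_⟩
    · refine LipschitzOnWith.of_dist_le_mul fun x _ y _ => ?_
      rw [dist_eq_norm, dist_eq_norm, ← ContinuousLinearMap.comp_sub]
      exact (ContinuousLinearMap.opNorm_comp_le _ _).trans
        (mul_le_mul_of_nonneg_right (hAM t ht) (norm_nonneg _))
    · exact hA.clm_comp continuousOn_const
    · have hx2 : ‖x‖ ≤ 2 := by
        have := norm_le_norm_add_norm_sub' x 1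
        rw [mem_closedBall, dist_eq_norm] at hx
        simp only [NNReal.coe_one] at hx
        linarith
      calc ‖A t ∘L x‖ ≤ ‖A t‖ * ‖x‖ := ContinuousLinearMap.opNorm_comp_le _ _
        _ ≤ M * 2 := mul_le_mul (hAM t ht) hx2 (norm_nonneg _) hM
        _ = 2 * M := by ring
    · simp only [sub_zero, sub_self, NNReal.coe_one, NNReal.coe_zero, max_eq_left hT]
      exact hMT
  exact H.exists_eq_forall_mem_Icc_hasDerivWithinAt₀

theorem hasFDerivAt_flow_right {f : E → E} {s : Set E} (hs : IsOpen s) (hsc : Convex ℝ s)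
    (hf : ContDiffOn ℝ 1 f s) {M T : ℝ} (hM : 0 < M) (hT : 0 < T) (hMT : 2 * M * T ≤ 1)
    (hfM : ∀ w ∈ s, ‖fderiv ℝ f w‖ ≤ M) {θ : ℝ → E → E} {z : E}
    (hθ : ∀ᶠ z' in 𝓝 z, θ 0 z' = z' ∧ ∀ t ∈ Icc 0 T, θ t z' ∈ s ∧
      HasDerivWithinAt (fun t => θ t z') (f (θ t z')) (Icc 0 T) t) :
    ∃ Ψ : ℝ → E →L[ℝ] E, Ψ 0 = 1 ∧
      HasDerivWithinAt Ψ (fderiv ℝ f z) (Icc 0 T) 0 ∧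
      ∀ t ∈ Icc 0 T, ‖Ψ t - 1‖ ≤ 2 * M * t ∧ HasFDerivAt (θ t) (Ψ t) z := by
  have h0T : (0 : ℝ) ∈ Icc 0 T := ⟨le_rfl, hT.le⟩
  obtain ⟨hz0, hz⟩ := hθ.self_of_nhds
  have hxc : ContinuousOn (fun t => θ t z) (Icc 0 T) := fun t ht => (hz t ht).2.continuousWithinAt
  have hfd : ContinuousOn (fderiv ℝ f) s := hf.continuousOn_fderiv_of_isOpen hs le_rfl
  have hdf : ∀ w ∈ s, HasFDerivAt f (fderiv ℝ f w) w := fun w hw =>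
    ((hf.contDiffAt (hs.mem_nhds hw)).differentiableAt one_ne_zero).hasFDerivAt
  obtain ⟨Ψ, hΨ0, hΨ⟩ := exists_hasDerivWithinAt_linear (A := fun t => fderiv ℝ f (θ t z)) hM.le
    hT.le hMT (hfd.comp hxc fun t ht => (hz t ht).1) fun t ht => hfM _ (hz t ht).1
  have toIci : ∀ {F : Type _} [NormedAddCommGroup F] [NormedSpace ℝ F] {g : ℝ → F} {g' : F}
      {t : ℝ}, t ∈ Ico 0 T → HasDerivWithinAt g g' (Icc 0 T) t →
      HasDerivWithinAt g g' (Ici t) t := by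
    intro F _ _ g g' t ht h
    exact h.mono_of_mem_nhdsWithin
      (Filter.mem_of_superset (Icc_mem_nhdsGE ht.2) (Icc_subset_Icc_left ht.1))
  have hexp : Real.exp (M * T) ≤ 2 := by
    calc Real.exp (M * T) ≤ Real.exp (Real.log 2) := by
          apply Real.exp_le_exp.2
          have := Real.log_two_gt_d9
          linarith
      _ = 2 := Real.exp_log two_pos
  have hΨ2 : ∀ t ∈ Icc 0 T, ‖Ψ t‖ ≤ 2 := by
    intro t ht
    have := norm_le_gronwallBound_of_norm_deriv_right_le (f := Ψ) (δ := 1) (K := M) (ε := 0)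
      (a := 0) (b := T) (f' := fun t => fderiv ℝ f (θ t z) ∘L Ψ t)
      (fun t ht => (hΨ t ht).continuousWithinAt)
      (fun t ht => toIci ht (hΨ t (Ico_subset_Icc_self ht)))
      (by rw [hΨ0]; exact ContinuousLinearMap.norm_id_le)
      (fun t ht => by
        rw [add_zero]
        exact (ContinuousLinearMap.opNorm_comp_le _ _).trans (mul_le_mul_of_nonneg_right
          (hfM _ (hz t (Ico_subset_Icc_self ht)).1) (norm_nonneg _))) t ht
    rw [gronwallBound_ε0, sub_zero, one_mul] at this
    refine this.trans (le_trans ?_ hexp)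
    exact Real.exp_le_exp.2 (mul_le_mul_of_nonneg_left ht.2 hM.le)
  refine ⟨Ψ, hΨ0, ?_, fun t ht => ⟨?_, ?_⟩⟩
  · have := hΨ 0 h0T
    rwa [hz0, hΨ0, ContinuousLinearMap.one_def, ContinuousLinearMap.comp_id] at this
  · have := norm_image_sub_le_of_norm_deriv_le_segment_01' (f := fun r => Ψ (r * t))
      (f' := fun r => t • (fderiv ℝ f (θ (r * t) z) ∘L Ψ (r * t))) (C := 2 * M * t) ?_ ?_
    · simpa [hΨ0] using this
    · intro r hr
      have hrt : r * t ∈ Icc 0 T :=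
        ⟨mul_nonneg hr.1 ht.1, (mul_le_of_le_one_left ht.1 hr.2).trans ht.2⟩
      have h1 : HasDerivWithinAt (fun r : ℝ => r * t) t (Icc 0 1) r := by
        simpa using (hasDerivWithinAt_id r (Icc 0 1)).mul_const t
      refine HasDerivWithinAt.scomp r (hΨ _ hrt) h1 ?_
      exact fun r hr =>
        ⟨mul_nonneg hr.1 ht.1, (mul_le_of_le_one_left ht.1 hr.2).trans ht.2⟩
    · intro r hr
      have hrt : r * t ∈ Icc 0 T :=
        ⟨mul_nonneg hr.1 ht.1, (mul_le_of_le_one_left ht.1 hr.2.le).trans ht.2⟩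
      rw [norm_smul, Real.norm_of_nonneg ht.1]
      calc t * ‖fderiv ℝ f (θ (r * t) z) ∘L Ψ (r * t)‖ ≤ t * (M * 2) :=
            mul_le_mul_of_nonneg_left ((ContinuousLinearMap.opNorm_comp_le _ _).trans
              (mul_le_mul (hfM _ (hz _ hrt).1) (hΨ2 _ hrt) (norm_nonneg _) hM.le)) ht.1
        _ = 2 * M * t := by ring
  · rw [hasFDerivAt_iff_isLittleO, Asymptotics.isLittleO_iff]
    intro c hc
    set C := gronwallBound 0 M 1 T with hC
    have hCpos : 0 ≤ C := by
      rw [hC, gronwallBound_of_K_ne_0 hM.ne']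
      have : 1 ≤ Real.exp (M * T) := Real.one_le_exp (by positivity)
      have : 0 ≤ 1 / M * (Real.exp (M * T) - 1) := mul_nonneg (by positivity) (by linarith)
      simpa using this
    obtain ⟨ε, hε, hεC⟩ : ∃ ε > 0, 2 * ε * C ≤ c :=
      ⟨c / (2 * (C + 1)), by positivity, by
        rw [show 2 * (c / (2 * (C + 1))) * C = c * (C / (C + 1)) by field_simp]
        exact mul_le_of_le_one_right hc.le ((div_le_one (by positivity)).2 (by linarith))⟩
    have hK : IsCompact ((fun t => θ t z) '' Icc 0 T) := isCompact_Icc.image_of_continuousOn hxc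
    have hu := hK.uniformContinuousAt_of_continuousAt (fderiv ℝ f) (by
      rintro _ ⟨t, ht, rfl⟩
      exact hfd.continuousAt (hs.mem_nhds (hz t ht).1)) (Metric.dist_mem_uniformity hε)
    obtain ⟨ρ, hρ, hu⟩ := Metric.mem_uniformity_dist.1 hu
    filter_upwards [hθ, Metric.ball_mem_nhds z (half_pos hρ)] with z' ⟨hz'0, hz'⟩ hzz'
    have hlip : LipschitzOnWith ⟨M, hM.le⟩ f s := by
      refine LipschitzOnWith.of_dist_le_mul fun x hx y hy => ?_
      rw [dist_eq_norm, dist_eq_norm]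
      exact hsc.norm_image_sub_le_of_norm_fderiv_le
        (fun w hw => (hdf w hw).differentiableAt) hfM hy hx
    have hgrow : ∀ t ∈ Icc 0 T, dist (θ t z') (θ t z) ≤ 2 * dist z' z := by
      intro t ht
      have := dist_le_of_trajectories_ODE_of_mem (v := fun _ => f) (s := fun _ => s)
        (f := fun t => θ t z') (g := fun t => θ t z) (K := ⟨M, hM.le⟩) (a := 0) (b := T)
        (δ := dist z' z) (fun _ _ => hlip) (fun t ht => (hz' t ht).2.continuousWithinAt)
        (fun t ht => toIci ht (hz' t (Ico_subset_Icc_self ht)).2)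
        (fun t ht => (hz' t (Ico_subset_Icc_self ht)).1) hxc
        (fun t ht => toIci ht (hz t (Ico_subset_Icc_self ht)).2)
        (fun t ht => (hz t (Ico_subset_Icc_self ht)).1) (by simp [hz0, hz'0]) t ht
      refine this.trans ?_
      rw [mul_comm, sub_zero]
      refine mul_le_mul_of_nonneg_right (le_trans ?_ hexp) dist_nonneg
      exact Real.exp_le_exp.2 (mul_le_mul_of_nonneg_left ht.2 hM.le)
    have key := norm_le_gronwallBound_of_norm_deriv_right_le
      (f := fun t => θ t z' - θ t z - Ψ t (z' - z)) (δ := 0) (K := M)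
      (ε := 2 * ε * ‖z' - z‖) (a := 0) (b := T)
      (f' := fun t => f (θ t z') - f (θ t z) - fderiv ℝ f (θ t z) (Ψ t (z' - z)))
      (fun t ht => (((hz' t ht).2.continuousWithinAt.sub (hz t ht).2.continuousWithinAt).sub
        ((hΨ t ht).continuousWithinAt.clm_apply continuousWithinAt_const)))
      (fun t ht => by
        have ht' := Ico_subset_Icc_self ht
        have h3 := (toIci ht (hΨ t ht')).clm_apply
          (hasDerivWithinAt_const t (Ici t) (z' - z))
        simp only [map_zero, add_zero] at h3
        exact ((toIci ht (hz' t ht').2).sub (toIci ht (hz t ht').2)).sub h3)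
      (by simp [hz0, hz'0, hΨ0])
      (fun t ht => by
        have ht' := Ico_subset_Icc_self ht
        have hd := hgrow t ht'
        have hlt : dist (θ t z') (θ t z) < ρ := by
          rw [mem_ball] at hzz'
          linarith
        have h1 : ‖f (θ t z') - f (θ t z) - fderiv ℝ f (θ t z) (θ t z' - θ t z)‖
            ≤ ε * ‖θ t z' - θ t z‖ := by
          refine (hsc.inter (convex_ball (θ t z) ρ)).norm_image_sub_le_of_norm_hasFDerivWithin_le'
            (f' := fderiv ℝ f) (fun w hw => (hdf w hw.1).hasFDerivWithinAt) ?_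
            ⟨(hz t ht').1, mem_ball_self hρ⟩ ⟨(hz' t ht').1, hlt⟩
          intro w hw
          have := @hu (θ t z) w (by rw [dist_comm]; exact hw.2) (mem_image_of_mem _ ht')
          rw [← dist_eq_norm, dist_comm]
          exact le_of_lt this
        have h2 : f (θ t z') - f (θ t z) - fderiv ℝ f (θ t z) (Ψ t (z' - z)) =
            (f (θ t z') - f (θ t z) - fderiv ℝ f (θ t z) (θ t z' - θ t z)) +
            fderiv ℝ f (θ t z) (θ t z' - θ t z - Ψ t (z' - z)) := by
          simp only [map_sub]; abel
        rw [h2]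
        refine (norm_add_le _ _).trans ?_
        rw [add_comm]
        refine add_le_add (((fderiv ℝ f (θ t z)).le_opNorm _).trans
          (mul_le_mul_of_nonneg_right (hfM _ (hz t ht').1) (norm_nonneg _))) (h1.trans ?_)
        rw [dist_eq_norm, dist_eq_norm] at hd
        calc ε * ‖θ t z' - θ t z‖ ≤ ε * (2 * ‖z' - z‖) := mul_le_mul_of_nonneg_left hd hε.le
          _ = 2 * ε * ‖z' - z‖ := by ring) t ht
    refine key.trans ?_
    have hmono : gronwallBound 0 M (2 * ε * ‖z' - z‖) (t - 0) ≤ 2 * ε * ‖z' - z‖ * C := by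
      refine (gronwallBound_mono le_rfl (by positivity) hM.le
        (show t - 0 ≤ T by linarith [ht.2])).trans (le_of_eq ?_)
      rw [hC, gronwallBound_of_K_ne_0 hM.ne', gronwallBound_of_K_ne_0 hM.ne']
      ring
    refine hmono.trans ?_
    calc 2 * ε * ‖z' - z‖ * C = (2 * ε * C) * ‖z' - z‖ := by ring
      _ ≤ c * ‖z' - z‖ := mul_le_mul_of_nonneg_right hεC (norm_nonneg _)

end Flow

section Flow

open Metric

variable {E : Type*} [NormedAddCommGroup E] [NormedSpace ℝ E]

/-- `θ` is a flow of `f` near `z₀`: it is defined for small times near `z₀` and stays near `z₀`. -/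
def IsFlowNear (f : E → E) (θ : ℝ → E → E) (z₀ : E) : Prop :=
  ∀ ε > 0, ∃ δ > 0, ∀ z ∈ ball z₀ δ, θ 0 z = z ∧ ∀ t ∈ Ioo (-δ) δ,
    θ t z ∈ ball z₀ ε ∧ HasDerivAt (fun t => θ t z) (f (θ t z)) t

variable [CompleteSpace E]

theorem IsFlowNear.exists_bounds {f : E → E} {θ : ℝ → E → E} {z₀ : E} (h : IsFlowNear f θ z₀)
    (hf : ContDiffAt ℝ 1 f z₀) :
    ∃ δ > 0, ∃ C ≥ 0, ∀ z ∈ ball z₀ δ, θ 0 z = z ∧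
      HasDerivAt (fun t => θ t z) (f z) 0 ∧
      HasDerivAt (fun t => fderiv ℝ (θ t) z) (fderiv ℝ f z) 0 ∧
      ∀ t, |t| < δ → ‖θ t z - z‖ ≤ C * |t| ∧ ‖fderiv ℝ (θ t) z - 1‖ ≤ C * |t| ∧
        DifferentiableAt ℝ (θ t) z := by
  obtain ⟨M, hM, ε, hε, hfε, hfM, hDM⟩ : ∃ M > 0, ∃ ε > 0, ContDiffOn ℝ 1 f (ball z₀ ε) ∧
      (∀ w ∈ ball z₀ ε, ‖f w‖ ≤ M) ∧ ∀ w ∈ ball z₀ ε, ‖fderiv ℝ f w‖ ≤ M := by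
    have h1 : ∀ᶠ w in 𝓝 z₀, ContDiffAt ℝ 1 f w := hf.eventually (by simp)
    have h2 : ∀ᶠ w in 𝓝 z₀, ‖f w‖ < ‖f z₀‖ + 1 :=
      hf.continuousAt.norm.eventually_lt continuousAt_const (by simp)
    have h3 : ∀ᶠ w in 𝓝 z₀, ‖fderiv ℝ f w‖ < ‖fderiv ℝ f z₀‖ + 1 :=
      (hf.continuousAt_fderiv one_ne_zero).norm.eventually_lt continuousAt_const (by simp)
    obtain ⟨ε, hε, H⟩ := Metric.eventually_nhds_iff_ball.1 (h1.and (h2.and h3))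
    have n1 := norm_nonneg (f z₀)
    have n2 := norm_nonneg (fderiv ℝ f z₀)
    exact ⟨‖f z₀‖ + ‖fderiv ℝ f z₀‖ + 1, by positivity, ε, hε,
      fun w hw => (H w hw).1.contDiffWithinAt, fun w hw => by linarith [(H w hw).2.1],
      fun w hw => by linarith [(H w hw).2.2]⟩
  obtain ⟨δ, hδ, hθ⟩ := h ε hε
  obtain ⟨T, hT, hTδ, hMT⟩ : ∃ T > 0, T < δ ∧ 2 * M * T ≤ 1 := by
    refine ⟨min (δ / 2) (1 / (2 * M)), by positivity, (min_le_left _ _).trans_lt (by linarith), ?_⟩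
    calc 2 * M * min (δ / 2) (1 / (2 * M)) ≤ 2 * M * (1 / (2 * M)) :=
          mul_le_mul_of_nonneg_left (min_le_right _ _) (by positivity)
      _ = 1 := by field_simp
  refine ⟨T, hT, 2 * M, by positivity, fun z hz => ?_⟩
  have hzδ : z ∈ ball z₀ δ := ball_subset_ball hTδ.le hz
  have hnear : ∀ᶠ z' in 𝓝 z, z' ∈ ball z₀ δ := isOpen_ball.mem_nhds hzδ
  obtain ⟨Ψ, hΨ0, hΨd, hΨ⟩ := hasFDerivAt_flow_right isOpen_ball (convex_ball z₀ ε) hfε hM hT hMT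
    hDM (θ := θ) (z := z) (hnear.mono fun z' hz' => ⟨(hθ z' hz').1, fun t ht =>
      have := (hθ z' hz').2 t ⟨by linarith [ht.1], by linarith [ht.2]⟩
      ⟨this.1, this.2.hasDerivWithinAt⟩⟩)
  obtain ⟨Ψ', hΨ'0, hΨ'd, hΨ'⟩ := hasFDerivAt_flow_right (f := fun w => - f w)
    (θ := fun t => θ (-t)) (z := z) isOpen_ball (convex_ball z₀ ε) hfε.neg hM hT hMT
    (fun w hw => by rw [fderiv_fun_neg, norm_neg]; exact hDM w hw)
    (hnear.mono fun z' hz' => ⟨by simpa using (hθ z' hz').1, fun t ht => by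
      have := (hθ z' hz').2 (-t) ⟨by linarith [ht.2], by linarith [ht.1]⟩
      refine ⟨this.1, ?_⟩
      have h2 := (this.2.scomp t (hasDerivAt_neg t)).hasDerivWithinAt (s := Icc 0 T)
      simpa [Function.comp_def] using h2⟩)
  have hfd : ∀ t ∈ Icc 0 T, fderiv ℝ (θ t) z = Ψ t := fun t ht => (hΨ t ht).2.fderiv
  have hfd' : ∀ t ∈ Icc (-T) 0, fderiv ℝ (θ t) z = Ψ' (-t) := fun t ht => by
    have := (hΨ' (-t) ⟨by linarith [ht.2], by linarith [ht.1]⟩).2.fderiv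
    simpa using this
  have hθd := (hθ z hzδ).2 0 ⟨by linarith, by linarith⟩
  refine ⟨(hθ z hzδ).1, ?_, ?_, fun t ht => ⟨?_, ?_, ?_⟩⟩
  · simpa [(hθ z hzδ).1] using hθd.2
  · have hr : HasDerivWithinAt (fun t => fderiv ℝ (θ t) z) (fderiv ℝ f z) (Icc 0 T) 0 :=
      hΨd.congr hfd (hfd 0 ⟨le_rfl, hT.le⟩)
    have hl : HasDerivWithinAt (fun t => fderiv ℝ (θ t) z) (fderiv ℝ f z) (Icc (-T) 0) 0 := by
      have h1 : HasDerivWithinAt (fun t : ℝ => -t) (-1) (Icc (-T) 0) 0 :=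
        (hasDerivAt_neg 0).hasDerivWithinAt
      rw [fderiv_fun_neg] at hΨ'd
      have hm : MapsTo (fun t : ℝ => -t) (Icc (-T) 0) (Icc 0 T) := fun t ht =>
        ⟨by linarith [ht.2], by linarith [ht.1]⟩
      have h2 := HasDerivWithinAt.scomp (0 : ℝ) (h := fun t : ℝ => -t) (g₁ := Ψ')
        (by simpa using hΨ'd) h1 hm
      simp only [smul_neg, neg_smul, one_smul, neg_neg] at h2
      exact h2.congr (fun t ht => hfd' t ht) (hfd' 0 ⟨by linarith, le_rfl⟩)
    have := hl.union hr
    rw [Icc_union_Icc_eq_Icc (by linarith) hT.le] at this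
    exact this.hasDerivAt (Icc_mem_nhds (by linarith) hT)
  · have := (convex_Ioo (-T) T).norm_image_sub_le_of_norm_hasDerivWithin_le
      (f := fun t => θ t z) (f' := fun t => f (θ t z)) (C := M) (x := 0) (y := t)
      (fun s hs => ((hθ z hzδ).2 s ⟨by linarith [hs.1], by linarith [hs.2]⟩).2.hasDerivWithinAt)
      (fun s hs => hfM _ ((hθ z hzδ).2 s ⟨by linarith [hs.1], by linarith [hs.2]⟩).1)
      ⟨by linarith, hT⟩ (abs_lt.1 ht)
    simp only [(hθ z hzδ).1, sub_zero, Real.norm_eq_abs] at this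
    nlinarith [abs_nonneg t]
  · rcases le_total 0 t with h0 | h0
    · have ht' : t ∈ Icc 0 T := ⟨h0, (le_abs_self t).trans ht.le⟩
      rw [hfd t ht', abs_of_nonneg h0]
      exact (hΨ t ht').1
    · have ht' : t ∈ Icc (-T) 0 := ⟨(abs_lt.1 ht).1.le, h0⟩
      rw [hfd' t ht', abs_of_nonpos h0]
      exact (hΨ' (-t) ⟨by linarith, by linarith [ht'.1]⟩).1
  · rcases le_total 0 t with h0 | h0
    · exact (hΨ t ⟨h0, (le_abs_self t).trans ht.le⟩).2.differentiableAt
    · have := (hΨ' (-t) ⟨by linarith, by linarith [(abs_lt.1 ht).1]⟩).2.differentiableAt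
      simpa using this

end Flow

section Determinant

variable {d D : ℕ}

local notation "𝔼" n:max => EuclideanSpace ℝ (Fin n)

/-- The density `√|det b(A eᵢ, A eⱼ)|` of the pullback of `b` under `A`. -/
def pullbackDensity (b : 𝔼 D →L[ℝ] 𝔼 D →L[ℝ] ℝ) (A : 𝔼 d →L[ℝ] 𝔼 D) : ℝ :=
  Real.sqrt |(gram (pullbackForm b A)).det|

theorem hasDerivAt_det {n : Type*} [Fintype n] [DecidableEq n] {Γ : ℝ → Matrix n n ℝ}
    {L : Matrix n n ℝ} {t : ℝ} (h : ∀ i j, HasDerivAt (fun s => Γ s i j) (L i j) t) :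
    HasDerivAt (fun s => (Γ s).det) ((Γ t).adjugate * L).trace t := by
  have h1 : ∀ σ : Equiv.Perm n, HasDerivAt (fun s => ∏ i, Γ s (σ i) i)
      (∑ i, (∏ j ∈ Finset.univ.erase i, Γ t (σ j) j) • L (σ i) i) t := fun σ =>
    HasDerivAt.fun_finsetProd fun i _ => h (σ i) i
  have h2 : HasDerivAt (fun s => ∑ σ : Equiv.Perm n, ((Equiv.Perm.sign σ : ℤ) : ℝ) *
      ∏ i, Γ s (σ i) i) (∑ σ : Equiv.Perm n, ((Equiv.Perm.sign σ : ℤ) : ℝ) *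
      ∑ i, (∏ j ∈ Finset.univ.erase i, Γ t (σ j) j) • L (σ i) i) t :=
    HasDerivAt.fun_sum fun σ _ => (h1 σ).const_mul _
  simp only [← Matrix.det_apply'] at h2
  convert h2 using 1
  have h3 : ((Γ t).adjugate * L).trace = ∑ i, ((Γ t).updateCol i (fun k => L k i)).det := by
    simp only [Matrix.trace, Matrix.diag]
    refine Finset.sum_congr rfl fun i _ => ?_
    rw [← Matrix.cramer_apply, Matrix.cramer_eq_adjugate_mulVec]
    rfl
  rw [h3]
  simp only [Matrix.det_apply', Finset.mul_sum]
  rw [Finset.sum_comm]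
  refine Finset.sum_congr rfl fun σ _ => Finset.sum_congr rfl fun i _ => ?_
  rw [← Finset.mul_prod_erase _ _ (Finset.mem_univ i), Matrix.updateCol_self, smul_eq_mul,
    mul_comm (L _ _)]
  congr 2
  exact Finset.prod_congr rfl fun j hj => Matrix.updateCol_ne (Finset.ne_of_mem_erase hj)

theorem hasDerivAt_sqrt_abs {f : ℝ → ℝ} {f' t : ℝ} (h : HasDerivAt f f' t) (h0 : f t ≠ 0) :
    HasDerivAt (fun s => √|f s|) (1 / 2 * (f' / f t) * √|f t|) t := by
  have h1 := ((hasDerivAt_abs h0).comp t h).sqrt (abs_ne_zero.2 h0)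
  simp only [Function.comp_apply] at h1
  convert h1 using 1
  have hpos : 0 < √|f t| := Real.sqrt_pos.2 (abs_pos.2 h0)
  have hsq : √|f t| * √|f t| = |f t| := Real.mul_self_sqrt (abs_nonneg _)
  have hs : (SignType.sign (f t) : ℝ) * f t = |f t| := sign_mul_self _
  rw [eq_div_iff (by positivity)]
  have : 1 / 2 * (f' / f t) * √|f t| * (2 * √|f t|) = (f' / f t) * (√|f t| * √|f t|) := by ring
  rw [this, hsq, ← hs]
  field_simp

theorem gram_isSymm {b : 𝔼 d →L[ℝ] 𝔼 d →L[ℝ] ℝ} (hb : ∀ v w, b v w = b w v) : (gram b).IsSymm := by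
  ext i j
  simp [gram, hb (stdVec i)]

theorem hasDerivAt_sqrt_abs_det_gram {β : ℝ → 𝔼 d →L[ℝ] 𝔼 d →L[ℝ] ℝ} {β' : 𝔼 d → 𝔼 d → ℝ}
    (h : ∀ v w, HasDerivAt (fun t => β t v w) (β' v w) 0) (hsymm : ∀ v w, β 0 v w = β 0 w v) (h0 : (gram (β 0)).det ≠ 0) :
    HasDerivAt (fun t => √|(gram (β t)).det|)
      (1 / 2 * metricTrace (β 0) β' * √|(gram (β 0)).det|) 0 := by
  have hent : ∀ i j, HasDerivAt (fun t => gram (β t) i j) (Matrix.of (fun i j =>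
      β' (stdVec i) (stdVec j)) i j) 0 := fun i j => h _ _
  convert hasDerivAt_sqrt_abs (hasDerivAt_det hent) h0 using 3
  have hsy := gram_isSymm hsymm
  simp only [metricTrace, Matrix.trace, Matrix.diag, Matrix.mul_apply, Finset.sum_div]
  rw [Finset.sum_comm]
  refine Finset.sum_congr rfl fun i _ => Finset.sum_congr rfl fun j _ => ?_
  rw [← hsy.adjugate.apply i j, Matrix.inv_def, Ring.inverse_eq_inv', Matrix.smul_apply]
  simp only [gram, Matrix.of_apply, smul_eq_mul]
  field_simp

theorem contDiff_pullbackForm_apply (v w : 𝔼 d) : ContDiff ℝ ∞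
    (fun q : (𝔼 D →L[ℝ] 𝔼 D →L[ℝ] ℝ) × (𝔼 d →L[ℝ] 𝔼 D) => pullbackForm q.1 q.2 v w) := by
  change ContDiff ℝ ∞ fun q : (𝔼 D →L[ℝ] 𝔼 D →L[ℝ] ℝ) × (𝔼 d →L[ℝ] 𝔼 D) => q.1 (q.2 v) (q.2 w)
  fun_prop

theorem contDiff_det_gram_pullbackForm : ContDiff ℝ ∞
    (fun q : (𝔼 D →L[ℝ] 𝔼 D →L[ℝ] ℝ) × (𝔼 d →L[ℝ] 𝔼 D) => (gram (pullbackForm q.1 q.2)).det) := by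
  simp only [Matrix.det_apply']
  refine ContDiff.sum fun σ _ => contDiff_const.mul (contDiff_prod fun i _ => ?_)
  exact contDiff_pullbackForm_apply _ _

theorem exists_lipschitzOnWith_pullbackDensity {b : 𝔼 D →L[ℝ] 𝔼 D →L[ℝ] ℝ} {A : 𝔼 d →L[ℝ] 𝔼 D}
    (h : (gram (pullbackForm b A)).det ≠ 0) :
    ∃ K, ∃ s ∈ 𝓝 (b, A), LipschitzOnWith K
      (fun q : (𝔼 D →L[ℝ] 𝔼 D →L[ℝ] ℝ) × (𝔼 d →L[ℝ] 𝔼 D) => pullbackDensity q.1 q.2) s := by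
  have h0 : ContDiff ℝ 1 (fun q : (𝔼 D →L[ℝ] 𝔼 D →L[ℝ] ℝ) × (𝔼 d →L[ℝ] 𝔼 D) =>
      (gram (pullbackForm q.1 q.2)).det) := contDiff_det_gram_pullbackForm.of_le (by simp)
  have h1 : ContDiffAt ℝ 1 (fun x : ℝ => √|x|) (gram (pullbackForm b A)).det :=
    (contDiffAt_abs h).sqrt (abs_ne_zero.2 h)
  have h2 := ContDiffAt.comp (b, A) h1 h0.contDiffAt
  exact h2.exists_lipschitzOnWith

end Determinant

section LinearAlgebra

variable {d D : ℕ}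

local notation "𝔼" n:max => EuclideanSpace ℝ (Fin n)

theorem sum_coord_smul_stdVec (v : 𝔼 d) : ∑ i, v i • stdVec i = v := by
  ext j
  simp [stdVec, Finset.sum_apply, Pi.single_apply]

theorem coord_stdVec (i j : Fin d) : (stdVec i : 𝔼 d) j = if j = i then 1 else 0 := by
  simp [stdVec, Pi.single_apply]

/-- A symmetric nondegenerate bilinear form. -/
structure IsScalarProduct (b : 𝔼 d →L[ℝ] 𝔼 d →L[ℝ] ℝ) : Prop where
  symm : ∀ v w, b v w = b w v
  nondegenerate : ∀ v, (∀ w, b v w = 0) → v = 0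

variable {b : 𝔼 d →L[ℝ] 𝔼 d →L[ℝ] ℝ}

theorem apply_eq_sum_gram (b : 𝔼 d →L[ℝ] 𝔼 d →L[ℝ] ℝ) (v w : 𝔼 d) :
    b v w = ∑ i, ∑ j, v i * gram b i j * w j := by
  conv_lhs => rw [← sum_coord_smul_stdVec v, ← sum_coord_smul_stdVec w]
  simp only [map_sum, map_smul, FunLike.coe_sum, Finset.sum_apply,
    FunLike.coe_smul, Pi.smul_apply, smul_eq_mul, gram, Matrix.of_apply,
    Finset.mul_sum]
  rw [Finset.sum_comm]
  refine Finset.sum_congr rfl fun i _ => Finset.sum_congr rfl fun j _ => ?_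
  ring

theorem IsScalarProduct.det_ne_zero (hb : IsScalarProduct b) : (gram b).det ≠ 0 := by
  intro h
  obtain ⟨v, hv0, hv⟩ := Matrix.exists_vecMul_eq_zero_iff.2 h
  refine hv0 ?_
  have h1 := hb.nondegenerate (WithLp.toLp 2 v) fun w => by
    rw [apply_eq_sum_gram, Finset.sum_comm]
    refine Finset.sum_eq_zero fun j _ => ?_
    rw [← Finset.sum_mul]
    have := congrFun hv j
    simp only [Matrix.vecMul, dotProduct, Pi.zero_apply] at this
    change (∑ i, v i * gram b i j) * w j = 0
    rw [this, zero_mul]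
  ext i
  exact congrFun (congrArg WithLp.ofLp h1) i

theorem IsScalarProduct.gram_inv_symm (hb : IsScalarProduct b) (i j : Fin d) :
    (gram b)⁻¹ i j = (gram b)⁻¹ j i :=
  (gram_isSymm hb.symm).inv.apply j i

theorem IsScalarProduct.inv_mul (hb : IsScalarProduct b) (i k : Fin d) :
    ∑ j, (gram b)⁻¹ i j * gram b j k = if i = k then 1 else 0 := by
  have := congrFun (congrFun (Matrix.nonsing_inv_mul (gram b)
    (isUnit_iff_ne_zero.2 hb.det_ne_zero)) i) k
  simpa [Matrix.mul_apply, Matrix.one_apply] using this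

theorem IsScalarProduct.apply_sharp (hb : IsScalarProduct b) (l : 𝔼 d →ₗ[ℝ] ℝ) (z : 𝔼 d) :
    b (sharp b l) z = l z := by
  have h1 : ∀ k, b (sharp b l) (stdVec k) = l (stdVec k) := fun k => by
    simp only [sharp, map_sum, map_smul, FunLike.coe_sum, Finset.sum_apply,
      FunLike.coe_smul, Pi.smul_apply, smul_eq_mul]
    rw [Finset.sum_comm]
    have : ∀ j, ∑ i, (gram b)⁻¹ i j * l (stdVec j) * b (stdVec i) (stdVec k) =
        l (stdVec j) * if j = k then 1 else 0 := fun j => by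
      rw [← hb.inv_mul, Finset.mul_sum]
      refine Finset.sum_congr rfl fun i _ => ?_
      rw [hb.gram_inv_symm i j]
      simp only [gram, Matrix.of_apply]
      ring
    simp [this]
  rw [← sum_coord_smul_stdVec z]
  simp [map_sum, h1]

theorem IsScalarProduct.ext_left (hb : IsScalarProduct b) {v w : 𝔼 d} (h : ∀ z, b v z = b w z) :
    v = w :=
  sub_eq_zero.1 (hb.nondegenerate _ fun z => by simp [h z])

theorem IsScalarProduct.metricTrace_swap (hb : IsScalarProduct b) (P : 𝔼 d → 𝔼 d → ℝ) :
    metricTrace b (fun x y => P y x) = metricTrace b P := by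
  simp only [metricTrace]
  rw [Finset.sum_comm]
  refine Finset.sum_congr rfl fun i _ => Finset.sum_congr rfl fun j _ => ?_
  rw [hb.gram_inv_symm]

theorem IsScalarProduct.sum_coord_eq_metricTrace (hb : IsScalarProduct b) (A : Fin d → 𝔼 d)
    (P : 𝔼 d → 𝔼 d → ℝ) (hP : ∀ i y, P (stdVec i) y = b (A i) y) :
    ∑ i, coord (A i) i = metricTrace b P := by
  simp only [metricTrace, hP, smul_eq_mul]
  refine Finset.sum_congr rfl fun i _ => ?_
  have h1 : ∀ j, b (A i) (stdVec j) = ∑ k, A i k * gram b k j := fun j => by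
    conv_lhs => rw [← sum_coord_smul_stdVec (A i)]
    simp [gram]
  simp only [h1, Finset.mul_sum]
  rw [Finset.sum_comm]
  have : ∀ k, ∑ j, (gram b)⁻¹ i j * (A i k * gram b k j) = A i k * if i = k then 1 else 0 :=
    fun k => by
      rw [← hb.inv_mul, Finset.mul_sum]
      refine Finset.sum_congr rfl fun j _ => ?_
      rw [(gram_isSymm hb.symm).apply j k]
      ring
  simp [this, coord]

theorem metricTrace_add (b : 𝔼 d →L[ℝ] 𝔼 d →L[ℝ] ℝ) (P Q : 𝔼 d → 𝔼 d → ℝ) :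
    metricTrace b (fun x y => P x y + Q x y) = metricTrace b P + metricTrace b Q := by
  simp [metricTrace, mul_add, Finset.sum_add_distrib]

theorem apply_metricTrace (l : 𝔼 D →L[ℝ] ℝ) (b : 𝔼 d →L[ℝ] 𝔼 d →L[ℝ] ℝ) (P : 𝔼 d → 𝔼 d → 𝔼 D) :
    l (metricTrace b P) = metricTrace b (fun x y => l (P x y)) := by
  simp [metricTrace, map_sum]

/-- The Christoffel symbols of a metric with value `b` and derivative `b'` at a point. -/
def christoffelForm (b : 𝔼 d →L[ℝ] 𝔼 d →L[ℝ] ℝ) (b' : 𝔼 d →L[ℝ] 𝔼 d →L[ℝ] 𝔼 d →L[ℝ] ℝ) (v w : 𝔼 d) : 𝔼 d :=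
  sharp b fun z => (b' v w z + b' w v z - b' z v w) / 2

theorem IsScalarProduct.apply_christoffelForm (hb : IsScalarProduct b)
    (b' : 𝔼 d →L[ℝ] 𝔼 d →L[ℝ] 𝔼 d →L[ℝ] ℝ) (v w z : 𝔼 d) :
    b (christoffelForm b b' v w) z = (b' v w z + b' w v z - b' z v w) / 2 := by
  let l : 𝔼 d →ₗ[ℝ] ℝ :=
    { toFun := fun z => (b' v w z + b' w v z - b' z v w) / 2
      map_add' := fun x y => by simp; ring
      map_smul' := fun c x => by simp; ring }
  exact hb.apply_sharp l z

/-- The first variation identity at a point, in coordinates: `b`, `b'`, `X`, `X'` are the values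
and derivatives of the ambient metric and of a vector field, `A`, `A'` the first two derivatives of
the embedding, `c`, `c'` those of the induced metric and `T`, `T'` those of the tangential part. -/
theorem first_variation_identity {b : 𝔼 D →L[ℝ] 𝔼 D →L[ℝ] ℝ} (hb : IsScalarProduct b)
    {b' : 𝔼 D →L[ℝ] 𝔼 D →L[ℝ] 𝔼 D →L[ℝ] ℝ} (hb' : ∀ z v w, b' z v w = b' z w v)
    {A : 𝔼 d →L[ℝ] 𝔼 D} {A' : 𝔼 d →L[ℝ] 𝔼 d →L[ℝ] 𝔼 D} (hA' : ∀ v w, A' v w = A' w v)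
    (hc : IsScalarProduct (pullbackForm b A))
    {c' : 𝔼 d →L[ℝ] 𝔼 d →L[ℝ] 𝔼 d →L[ℝ] ℝ}
    (hc' : ∀ x v w, c' x v w = b' (A x) (A v) (A w) + b (A' x v) (A w) + b (A v) (A' x w))
    {X : 𝔼 D} {X' : 𝔼 D →L[ℝ] 𝔼 D} {T : 𝔼 d} {T' : 𝔼 d →L[ℝ] 𝔼 d}
    (hT : ∀ w, pullbackForm b A T w = b X (A w))
    (hT' : ∀ x w, c' x T w + pullbackForm b A (T' x) w =
      b' (A x) X (A w) + b (X' (A x)) (A w) + b X (A' x w)) :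
    1 / 2 * metricTrace (pullbackForm b A) (fun x y =>
        b' X (A x) (A y) + b (X' (A x)) (A y) + b (A x) (X' (A y))) =
      ∑ i, coord (T' (stdVec i) + christoffelForm (pullbackForm b A) c' (stdVec i) T) i +
      b X (metricTrace (pullbackForm b A) fun x y =>
        -((A' x y + christoffelForm b b' (A x) (A y)) -
          A (sharp (pullbackForm b A) fun w =>
            b (A' x y + christoffelForm b b' (A x) (A y)) (A w)))) := by
  set c := pullbackForm b A with hcdef
  have hcA : ∀ v w, c v w = b (A v) (A w) := fun v w => rfl
  set Q : 𝔼 d → 𝔼 d → ℝ := fun x y => b (X' (A x)) (A y) +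
    (b' (A x) X (A y) + b' X (A x) (A y) - b' (A y) (A x) X) / 2 with hQ
  have hL : 1 / 2 * metricTrace c (fun x y =>
      b' X (A x) (A y) + b (X' (A x)) (A y) + b (A x) (X' (A y))) = metricTrace c Q := by
    have h1 : (fun x y => b' X (A x) (A y) + b (X' (A x)) (A y) + b (A x) (X' (A y))) =
        fun x y => Q x y + (fun x y => Q y x) x y := by
      funext x y
      simp only [hQ]
      rw [hb.symm (A x) (X' (A y)), hb' (A x) X (A y), hb' (A y) X (A x), hb' X (A y) (A x)]
      ring
    rw [h1, metricTrace_add, hc.metricTrace_swap]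
    ring
  rw [hL, apply_metricTrace, hc.sum_coord_eq_metricTrace _
    (fun x y => c (T' x + christoffelForm c c' x T) y) (fun _ _ => rfl), ← metricTrace_add]
  congr 1
  funext x y
  have hS : ∀ S : 𝔼 D, b X (A (sharp c fun w => b S (A w))) = b S (A T) := fun S => by
    rw [← hT, hc.symm]
    exact hc.apply_sharp ((b S).toLinearMap ∘ₗ A.toLinearMap) T
  rw [map_neg, map_sub, hS]
  simp only [map_add, ContinuousLinearMap.add_apply, hQ,
    hc.apply_christoffelForm, hb.apply_christoffelForm]
  rw [hb.symm X (christoffelForm b b' (A x) (A y)), hb.apply_christoffelForm]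
  have e1 := hT' x y
  have e2 := hc' x T y
  have e3 := hc' T x y
  have e4 := hc' y x T
  rw [hA' T x, hA' T y] at e3
  rw [hA' y x] at e4
  have t1 := hb' (A x) X (A y)
  have t2 := hb' (A y) (A x) X
  have t3 := hb' (A x) (A T) (A y)
  have t4 := hb' (A y) (A x) (A T)
  have t5 := hb.symm (A T) (A' x y)
  linarith

end LinearAlgebra

end SemiRiem

end

noncomputable section

namespace SemiRiem

local notation "𝔼" n:max => EuclideanSpace ℝ (Fin n)

section Chart

variable {m : ℕ} {H : Type*} [TopologicalSpace H] (I : ModelWithCorners ℝ (𝔼 m) H)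
  {M : Type*} [TopologicalSpace M] [ChartedSpace H M] [IsManifold I ∞ M]

/-- The components of tangent vectors at `q` in the preferred chart at `p`. -/
def toChart (p q : M) : 𝔼 m →L[ℝ] 𝔼 m :=
  (trivializationAt (𝔼 m) (TangentSpace I : M → Type _) p).continuousLinearMapAt ℝ q

/-- The tangent vector at `q` with given components in the preferred chart at `p`. -/
def fromChart (p q : M) : 𝔼 m →L[ℝ] 𝔼 m :=
  (trivializationAt (𝔼 m) (TangentSpace I : M → Type _) p).symmL ℝ q

variable {I} {p q : M}

theorem mem_baseSet_of_mem_source (hq : q ∈ (extChartAt I p).source) :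
    q ∈ (trivializationAt (𝔼 m) (TangentSpace I : M → Type _) p).baseSet := by
  rwa [extChartAt_source] at hq

theorem coordExt_eq_fromChart (hq : q ∈ (extChartAt I p).source) (v : 𝔼 m) :
    coordExt I p v q = fromChart I p q v :=
  ((trivializationAt (𝔼 m) (TangentSpace I : M → Type _) p).symmL_apply
    (mem_baseSet_of_mem_source hq) v).symm

theorem trivializationAt_snd_eq_toChart (hq : q ∈ (extChartAt I p).source)
    (v : TangentSpace I q) :
    (trivializationAt (𝔼 m) (TangentSpace I : M → Type _) p ⟨q, v⟩).2 = toChart I p q v :=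
  (congrFun ((trivializationAt (𝔼 m) (TangentSpace I : M → Type _) p).coe_linearMapAt_of_mem
    (R := ℝ) (mem_baseSet_of_mem_source hq)) v).symm

theorem toChart_fromChart (hq : q ∈ (extChartAt I p).source) (v : 𝔼 m) :
    toChart I p q (fromChart I p q v) = v :=
  (trivializationAt (𝔼 m) (TangentSpace I : M → Type _) p).continuousLinearMapAt_symmL
    (mem_baseSet_of_mem_source hq) v

theorem fromChart_toChart (hq : q ∈ (extChartAt I p).source) (v : 𝔼 m) :
    fromChart I p q (toChart I p q v) = v :=
  (trivializationAt (𝔼 m) (TangentSpace I : M → Type _) p).symmL_continuousLinearMapAt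
    (mem_baseSet_of_mem_source hq) v

theorem toChart_eq_mfderiv (hq : q ∈ (extChartAt I p).source) :
    toChart I p q = mfderiv I 𝓘(ℝ, 𝔼 m) (extChartAt I p) q :=
  TangentBundle.continuousLinearMapAt_trivializationAt (by rwa [extChartAt_source] at hq)

theorem fromChart_eq_mfderivWithin (hq : q ∈ (extChartAt I p).source) :
    fromChart I p q =
      mfderivWithin 𝓘(ℝ, 𝔼 m) I (extChartAt I p).symm (range I) (extChartAt I p q) :=
  TangentBundle.symmL_trivializationAt (by rwa [extChartAt_source] at hq)

theorem toChart_self (v : 𝔼 m) : toChart I p p v = v := by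
  rw [toChart_eq_mfderiv (mem_extChartAt_source p), mfderiv_extChartAt_self]
  rfl

theorem fromChart_self (v : 𝔼 m) : fromChart I p p v = v := by
  conv_lhs => rw [← toChart_self (I := I) (p := p) v]
  exact fromChart_toChart (mem_extChartAt_source p) v

theorem contMDiffOn_coordExt (p : M) (v : 𝔼 m) :
    ContMDiffOn I (I.prod 𝓘(ℝ, 𝔼 m)) ∞
      (fun q => Bundle.TotalSpace.mk' (𝔼 m) (E := (TangentSpace I : M → Type _)) q
        (coordExt I p v q)) (extChartAt I p).source := by
  have h := (trivializationAt (𝔼 m) (TangentSpace I : M → Type _) p).contMDiffOn_section_iff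
    (IB := I) (n := ∞) (s := fun q => coordExt I p v q) (isOpen_extChartAt_source (I := I) p)
    (fun q hq => mem_baseSet_of_mem_source hq)
  refine h.2 ((contMDiffOn_const (c := v)).congr fun q hq => ?_)
  rw [trivializationAt_snd_eq_toChart hq, coordExt_eq_fromChart hq, toChart_fromChart hq]

/-- A function that is given near `p` by a differentiable function in the preferred chart. -/
theorem hasMFDerivAt_of_eventuallyEq {F : Type*} [NormedAddCommGroup F] [NormedSpace ℝ F]
    {h : M → F} {k : 𝔼 m → F} {k' : 𝔼 m →L[ℝ] F}
    (hk : HasFDerivWithinAt k k' (range I) (extChartAt I p p))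
    (hh : h =ᶠ[𝓝 p] k ∘ extChartAt I p) : HasMFDerivAt I 𝓘(ℝ, F) h p k' := by
  have h1 : HasFDerivWithinAt (writtenInExtChartAt I 𝓘(ℝ, F) p h) k' (range I)
      (extChartAt I p p) := by
    refine hk.congr_of_eventuallyEq ?_ ?_
    · have h2 : ∀ᶠ u in 𝓝[range I] (extChartAt I p p),
          h ((extChartAt I p).symm u) = k (extChartAt I p ((extChartAt I p).symm u)) := by
        have h3 := (continuousAt_extChartAt_symm (I := I) p).tendsto
        rw [extChartAt_to_inv] at h3
        exact (h3.eventually hh).filter_mono nhdsWithin_le_nhds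
      filter_upwards [h2, extChartAt_target_mem_nhdsWithin (I := I) p] with u hu hut
      simp only [writtenInExtChartAt, extChartAt_model_space_eq_id, Function.comp_apply,
        PartialEquiv.refl_coe, id]
      rw [hu, (extChartAt I p).right_inv hut]
    · simp only [writtenInExtChartAt, extChartAt_model_space_eq_id, Function.comp_apply,
        PartialEquiv.refl_coe, id]
      rw [extChartAt_to_inv]
      exact hh.self_of_nhds
  refine ⟨?_, h1⟩
  have h2 : ContinuousAt (k ∘ extChartAt I p) p := by
    have h3 : ContinuousWithinAt k (range I) (extChartAt I p p) := hk.continuousWithinAt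
    have h4 : Filter.Tendsto (extChartAt I p) (𝓝 p) (𝓝[range I] (extChartAt I p p)) :=
      tendsto_nhdsWithin_iff.2 ⟨continuousAt_extChartAt p, by
        filter_upwards [extChartAt_source_mem_nhds (I := I) p] with q hq
        exact extChartAt_target_subset_range p ((extChartAt I p).map_source hq)⟩
    exact h3.tendsto.comp h4
  exact h2.congr hh.symm

theorem dirDeriv_eq_of_eventuallyEq {h : M → ℝ} {k : 𝔼 m → ℝ} {k' : 𝔼 m →L[ℝ] ℝ}
    (hk : HasFDerivWithinAt k k' (range I) (extChartAt I p p))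
    (hh : h =ᶠ[𝓝 p] k ∘ extChartAt I p) (v : 𝔼 m) : dirDeriv I h p v = k' v :=
  DFunLike.congr_fun (hasMFDerivAt_of_eventuallyEq hk hh).mfderiv v

theorem dirDerivVec_eq_of_eventuallyEq {n : ℕ} {h : M → 𝔼 n} {k : 𝔼 m → 𝔼 n}
    {k' : 𝔼 m →L[ℝ] 𝔼 n} (hk : HasFDerivWithinAt k k' (range I) (extChartAt I p p))
    (hh : h =ᶠ[𝓝 p] k ∘ extChartAt I p) (v : 𝔼 m) : dirDerivVec I h p v = k' v :=
  DFunLike.congr_fun (hasMFDerivAt_of_eventuallyEq hk hh).mfderiv v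

variable (I) in
/-- A field of bilinear forms in the preferred chart at `p`. -/
def formInChart (g : BilinField I M) (p : M) (z : 𝔼 m) : 𝔼 m →L[ℝ] 𝔼 m →L[ℝ] ℝ :=
  pullbackForm (g ((extChartAt I p).symm z)) (fromChart I p ((extChartAt I p).symm z))

theorem formInChart_apply_toChart (g : BilinField I M) (hq : q ∈ (extChartAt I p).source)
    (v w : 𝔼 m) :
    formInChart I g p (extChartAt I p q) (toChart I p q v) (toChart I p q w) = g q v w := by
  change g ((extChartAt I p).symm (extChartAt I p q)) (fromChart I p _ _) (fromChart I p _ _) = _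
  rw [(extChartAt I p).left_inv hq, fromChart_toChart hq, fromChart_toChart hq]

theorem formInChart_apply (g : BilinField I M) (hq : q ∈ (extChartAt I p).source)
    (v w : 𝔼 m) :
    formInChart I g p (extChartAt I p q) v w = g q (coordExt I p v q) (coordExt I p w q) := by
  rw [coordExt_eq_fromChart hq, coordExt_eq_fromChart hq, ← formInChart_apply_toChart g hq,
    toChart_fromChart hq, toChart_fromChart hq]

theorem isScalarProduct_pullbackForm {b : 𝔼 m →L[ℝ] 𝔼 m →L[ℝ] ℝ} (hb : IsScalarProduct b)
    {A B : 𝔼 m →L[ℝ] 𝔼 m} (hAB : ∀ v, A (B v) = v) (hBA : ∀ v, B (A v) = v) :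
    IsScalarProduct (pullbackForm b A) where
  symm v w := hb.symm _ _
  nondegenerate v hv := by
    have h1 : A v = 0 := hb.nondegenerate _ fun w => by
      have h2 : b (A v) (A (B w)) = 0 := hv (B w)
      rwa [hAB] at h2
    rw [← hBA v, h1, map_zero]

theorem SemiRiemannianMetric.isScalarProduct (g : SemiRiemannianMetric I M) (q : M) :
    IsScalarProduct (d := m) (g.inner q) :=
  ⟨g.symm q, g.nondegenerate q⟩

theorem SemiRiemannianMetric.isScalarProduct_formInChart (g : SemiRiemannianMetric I M)
    {z : 𝔼 m} (hz : z ∈ (extChartAt I p).target) :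
    IsScalarProduct (formInChart I g.inner p z) :=
  isScalarProduct_pullbackForm (g.isScalarProduct _)
    (fromChart_toChart ((extChartAt I p).map_target hz))
    (toChart_fromChart ((extChartAt I p).map_target hz))

theorem SemiRiemannianMetric.contDiffOn_formInChart (g : SemiRiemannianMetric I M) (p : M) :
    ContDiffOn ℝ ∞ (formInChart I g.inner p) (extChartAt I p).target := by
  refine contDiffOn_clm_apply.2 fun v => contDiffOn_clm_apply.2 fun w => ?_
  have h1 : ContMDiffOn I 𝓘(ℝ, ℝ) ∞
      (fun q => g.inner q (coordExt I p v q) (coordExt I p w q)) (extChartAt I p).source := by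
    intro q hq
    have h2 := ContMDiffWithinAt.clm_bundle_apply₂ (F₁ := 𝔼 m) (F₂ := 𝔼 m) (F₃ := ℝ)
      (b := fun q : M => q) (E₃ := Bundle.Trivial M ℝ)
      (g.contMDiff.contMDiffOn (s := (extChartAt I p).source) q hq)
      (contMDiffOn_coordExt p v q hq) (contMDiffOn_coordExt p w q hq)
    exact (Bundle.contMDiffWithinAt_totalSpace.1 h2).2
  have h3 := h1.comp (contMDiffOn_extChartAt_symm (I := I) (n := ∞) p)
    (fun z hz => (extChartAt I p).map_target hz)
  refine contMDiffOn_iff_contDiffOn.1 (h3.congr fun z hz => ?_)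
  have := formInChart_apply g.inner ((extChartAt I p).map_target hz) v w
  rw [(extChartAt I p).right_inv hz] at this
  exact this

end Chart

section Smoothness

variable {d D : ℕ} {E : Type*} [NormedAddCommGroup E] [NormedSpace ℝ E] {n : ℕ∞ω}
  {s : Set E} {x : E}

theorem contDiffWithinAt_det {ι : Type*} [Fintype ι] [DecidableEq ι] {Γ : E → Matrix ι ι ℝ}
    (h : ∀ i j, ContDiffWithinAt ℝ n (fun u => Γ u i j) s x) :
    ContDiffWithinAt ℝ n (fun u => (Γ u).det) s x := by
  simp only [Matrix.det_apply']
  exact ContDiffWithinAt.sum fun σ _ => contDiffWithinAt_const.mul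
    (contDiffWithinAt_prod fun i _ => h _ _)

theorem contDiffWithinAt_matrix_inv {ι : Type*} [Fintype ι] [DecidableEq ι] {Γ : E → Matrix ι ι ℝ}
    (h : ∀ i j, ContDiffWithinAt ℝ n (fun u => Γ u i j) s x) (h0 : (Γ x).det ≠ 0) (i j : ι) :
    ContDiffWithinAt ℝ n (fun u => (Γ u)⁻¹ i j) s x := by
  simp only [Matrix.inv_def, Ring.inverse_eq_inv', Matrix.smul_apply, smul_eq_mul,
    Matrix.adjugate_apply]
  refine ((contDiffWithinAt_det h).inv h0).mul (contDiffWithinAt_det fun k l => ?_)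
  by_cases hk : k = j
  · subst hk
    simpa using contDiffWithinAt_const
  · simpa [Matrix.updateRow_ne hk] using h k l

theorem contDiffWithinAt_gram {β : E → 𝔼 d →L[ℝ] 𝔼 d →L[ℝ] ℝ} (h : ContDiffWithinAt ℝ n β s x)
    (i j : Fin d) : ContDiffWithinAt ℝ n (fun u => gram (β u) i j) s x :=
  (h.clm_apply contDiffWithinAt_const).clm_apply contDiffWithinAt_const

theorem contDiffWithinAt_sharp {β : E → 𝔼 d →L[ℝ] 𝔼 d →L[ℝ] ℝ} {l : E → 𝔼 d → ℝ}
    (h : ContDiffWithinAt ℝ n β s x) (hl : ∀ v, ContDiffWithinAt ℝ n (fun u => l u v) s x)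
    (h0 : (SemiRiem.gram (β x)).det ≠ 0) :
    ContDiffWithinAt ℝ n (fun u => SemiRiem.sharp (β u) (l u)) s x := by
  refine ContDiffWithinAt.sum fun i _ => ContDiffWithinAt.sum fun j _ => ?_
  exact ((contDiffWithinAt_matrix_inv (fun i j => contDiffWithinAt_gram h i j) h0 i j).mul (hl _)).smul
    contDiffWithinAt_const

theorem contDiffWithinAt_flip {β : E → 𝔼 d →L[ℝ] 𝔼 D →L[ℝ] ℝ} (h : ContDiffWithinAt ℝ n β s x) :
    ContDiffWithinAt ℝ n (fun u => (β u).flip) s x := by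
  have hL : ContDiff ℝ n (fun b : 𝔼 d →L[ℝ] 𝔼 D →L[ℝ] ℝ => b.flip) :=
    ContinuousLinearMap.contDiff (𝕜 := ℝ) (E := 𝔼 d →L[ℝ] 𝔼 D →L[ℝ] ℝ)
      (F := 𝔼 D →L[ℝ] 𝔼 d →L[ℝ] ℝ) (ContinuousLinearMap.flipₗᵢ ℝ (𝔼 d) (𝔼 D)
        ℝ).toContinuousLinearEquiv.toContinuousLinearMap
  exact hL.contDiffAt.comp_contDiffWithinAt x h

theorem contDiffWithinAt_pullbackForm {b : E → 𝔼 D →L[ℝ] 𝔼 D →L[ℝ] ℝ} {A : E → 𝔼 d →L[ℝ] 𝔼 D}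
    (hb : ContDiffWithinAt ℝ n b s x) (hA : ContDiffWithinAt ℝ n A s x) :
    ContDiffWithinAt ℝ n (fun u => pullbackForm (b u) (A u)) s x := by
  have h1 : ContDiffWithinAt ℝ n (fun u => (b u).comp (A u)) s x := hb.clm_comp hA
  have h2 : ContDiffWithinAt ℝ n (fun u => ((b u).comp (A u)).flip.comp (A u)) s x :=
    (contDiffWithinAt_flip h1).clm_comp hA
  exact contDiffWithinAt_flip h2

end Smoothness

section Fields

variable {m : ℕ} {H : Type*} [TopologicalSpace H] {I : ModelWithCorners ℝ (𝔼 m) H}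
  {M : Type*} [TopologicalSpace M] [ChartedSpace H M] [IsManifold I ∞ M] {p q : M}

variable (I) in
/-- A vector field in the preferred chart at `p`. -/
def fieldInChart (X : (p : M) → TangentSpace I p) (p : M) (z : 𝔼 m) : 𝔼 m :=
  toChart I p ((extChartAt I p).symm z) (X ((extChartAt I p).symm z))

theorem fieldInChart_apply (X : (p : M) → TangentSpace I p) (hq : q ∈ (extChartAt I p).source) :
    fieldInChart I X p (extChartAt I p q) = toChart I p q (X q) := by
  rw [fieldInChart, (extChartAt I p).left_inv hq]

theorem fieldInChart_self (X : (p : M) → TangentSpace I p) :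
    fieldInChart I X p (extChartAt I p p) = X p := by
  rw [fieldInChart_apply X (mem_extChartAt_source p)]
  exact toChart_self _

theorem contDiffWithinAt_fieldInChart {X : (p : M) → TangentSpace I p} {n : ℕ∞}
    (hq : q ∈ (extChartAt I p).source)
    (hX : ContMDiffAt I I.tangent n (fun x => (⟨x, X x⟩ : TangentBundle I M)) q) :
    ContDiffWithinAt ℝ n (fieldInChart I X p) (range I) (extChartAt I p q) := by
  have h1 := ((trivializationAt (𝔼 m) (TangentSpace I : M → Type _) p).contMDiffAt_section_iff
    (IB := I) (n := n) (s := X) (mem_baseSet_of_mem_source hq)).1 hX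
  have hq' := (extChartAt I p).map_source hq
  have h2 := (contMDiffWithinAt_extChartAt_symm_range (I := I) (n := n) p hq')
  have h3 := ContMDiffAt.comp_contMDiffWithinAt_of_eq h1 h2
    ((extChartAt I p).left_inv hq)
  have h4 := contMDiffWithinAt_iff_contDiffWithinAt.1 h3
  refine h4.congr_of_eventuallyEq ?_ ?_
  · filter_upwards [extChartAt_target_mem_nhdsWithin_of_mem (I := I) hq'] with z hz
    exact (trivializationAt_snd_eq_toChart ((extChartAt I p).map_target hz) _).symm
  · exact (trivializationAt_snd_eq_toChart
      ((extChartAt I p).map_target ((extChartAt I p).map_source hq)) _).symm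

theorem eventuallyEq_formInChart (g : BilinField I M) (p : M) (v w : 𝔼 m) :
    (fun q => g q (coordExt I p v q) (coordExt I p w q)) =ᶠ[𝓝 p]
      (fun z => formInChart I g p z v w) ∘ extChartAt I p := by
  filter_upwards [extChartAt_source_mem_nhds (I := I) p] with q hq
  exact (formInChart_apply g hq v w).symm

theorem dirDeriv_formInChart {g : BilinField I M} {b' : 𝔼 m →L[ℝ] 𝔼 m →L[ℝ] 𝔼 m →L[ℝ] ℝ}
    (h : HasFDerivWithinAt (formInChart I g p) b' (range I) (extChartAt I p p)) (u v w : 𝔼 m) :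
    dirDeriv I (fun q => g q (coordExt I p v q) (coordExt I p w q)) p u = b' u v w := by
  have h1 := (h.clm_apply (hasFDerivWithinAt_const v _ _)).clm_apply
    (hasFDerivWithinAt_const w _ _)
  rw [dirDeriv_eq_of_eventuallyEq h1 (eventuallyEq_formInChart g p v w)]
  simp

theorem christoffel_eq {g : BilinField I M} {b' : 𝔼 m →L[ℝ] 𝔼 m →L[ℝ] 𝔼 m →L[ℝ] ℝ}
    (h : HasFDerivWithinAt (formInChart I g p) b' (range I) (extChartAt I p p)) (v w : 𝔼 m) :
    christoffel I g p v w = christoffelForm (d := m) (g p) b' v w := by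
  unfold christoffel christoffelForm
  congr 1
  funext z
  rw [dirDeriv_formInChart h, dirDeriv_formInChart h, dirDeriv_formInChart h]

theorem covDeriv_eq {g : BilinField I M} {b' : 𝔼 m →L[ℝ] 𝔼 m →L[ℝ] 𝔼 m →L[ℝ] ℝ}
    (h : HasFDerivWithinAt (formInChart I g p) b' (range I) (extChartAt I p p))
    {Y : (p : M) → TangentSpace I p} {T : 𝔼 m → 𝔼 m} {T' : 𝔼 m →L[ℝ] 𝔼 m}
    (hT : HasFDerivWithinAt T T' (range I) (extChartAt I p p))
    (hY : ∀ᶠ q in 𝓝 p, toChart I p q (Y q) = T (extChartAt I p q)) (v : 𝔼 m) :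
    covDeriv I g Y p v = T' v + christoffelForm (d := m) (g p) b' v (T (extChartAt I p p)) := by
  have hY0 : T (extChartAt I p p) = Y p := by
    rw [← hY.self_of_nhds]
    exact toChart_self _
  unfold covDeriv
  rw [hY0]
  refine congrArg₂ (· + ·) (dirDerivVec_eq_of_eventuallyEq hT ?_ v) (christoffel_eq h v (Y p))
  filter_upwards [hY, extChartAt_source_mem_nhds (I := I) p] with q hq hqs
  rw [trivializationAt_snd_eq_toChart hqs, hq]
  rfl

theorem mpullbackWithin_extChartAt_symm (X : (p : M) → TangentSpace I p) {z : 𝔼 m}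
    (hz : z ∈ (extChartAt I p).target) :
    VectorField.mpullbackWithin 𝓘(ℝ, 𝔼 m) I (extChartAt I p).symm X (range I) z =
      fieldInChart I X p z := by
  have hq := (extChartAt I p).map_target hz
  have h1 := fromChart_eq_mfderivWithin hq
  rw [(extChartAt I p).right_inv hz] at h1
  rw [VectorField.mpullbackWithin_apply, ← h1]
  have h2 : (fromChart I p ((extChartAt I p).symm z)).inverse =
      toChart I p ((extChartAt I p).symm z) := by
    refine ContinuousLinearMap.inverse_eq ?_ ?_
    · ext1 v; exact fromChart_toChart hq v
    · ext1 v; exact toChart_fromChart hq v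
  exact DFunLike.congr_fun h2 _

theorem lieBracketWithin_const {s : Set (𝔼 m)} {z v : 𝔼 m} {A B X : 𝔼 m → 𝔼 m}
    {X' : 𝔼 m →L[ℝ] 𝔼 m} (hu : UniqueDiffWithinAt ℝ s z) (hz : z ∈ s)
    (hX : HasFDerivWithinAt X X' s z) (hA : A =ᶠ[𝓝[s] z] X) (hB : B =ᶠ[𝓝[s] z] fun _ => v) :
    VectorField.lieBracketWithin ℝ A B s z = -X' v := by
  have f1 := (hX.congr_of_eventuallyEq hA (hA.self_of_nhdsWithin hz)).fderivWithin hu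
  have f2 := ((hasFDerivWithinAt_const v z s).congr_of_eventuallyEq hB
    (hB.self_of_nhdsWithin hz)).fderivWithin hu
  simp only [VectorField.lieBracketWithin_eq]
  rw [f1, f2, hB.self_of_nhdsWithin hz]
  simp

theorem mlieBracket_coordExt {X : (p : M) → TangentSpace I p} {X' : 𝔼 m →L[ℝ] 𝔼 m}
    (hX : HasFDerivWithinAt (fieldInChart I X p) X' (range I) (extChartAt I p p)) (v : 𝔼 m) :
    VectorField.mlieBracket I X (coordExt I p v) p = -X' v := by
  have hu : UniqueDiffWithinAt ℝ (range I) (extChartAt I p p) :=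
    I.uniqueDiffOn.uniqueDiffWithinAt (mem_range_self _)
  have ht := extChartAt_target_mem_nhdsWithin (I := I) p
  rw [VectorField.mlieBracket, VectorField.mlieBracketWithin_apply, mfderiv_extChartAt_self,
    preimage_univ, univ_inter]
  have e1 : VectorField.mpullbackWithin 𝓘(ℝ, 𝔼 m) I (extChartAt I p).symm X (range I)
      =ᶠ[𝓝[range I] extChartAt I p p] fieldInChart I X p := by
    filter_upwards [ht] with z hz using mpullbackWithin_extChartAt_symm X hz
  have e2 : VectorField.mpullbackWithin 𝓘(ℝ, 𝔼 m) I (extChartAt I p).symm (coordExt I p v) (range I)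
      =ᶠ[𝓝[range I] extChartAt I p p] fun _ => v := by
    filter_upwards [ht] with z hz
    have hq := (extChartAt I p).map_target hz
    rw [mpullbackWithin_extChartAt_symm _ hz, fieldInChart, coordExt_eq_fromChart hq,
      toChart_fromChart hq]
  have e4 := lieBracketWithin_const hu (mem_range_self _) hX e1 e2
  have h5 : (ContinuousLinearMap.id ℝ (𝔼 m)).inverse = ContinuousLinearMap.id ℝ (𝔼 m) :=
    ContinuousLinearMap.inverse_id
  refine Eq.trans ?_ (DFunLike.congr_fun h5 (-X' v))
  exact congrArg (ContinuousLinearMap.id ℝ (𝔼 m)).inverse e4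

theorem lieDerivative_eq {g : BilinField I M} {b' : 𝔼 m →L[ℝ] 𝔼 m →L[ℝ] 𝔼 m →L[ℝ] ℝ}
    (h : HasFDerivWithinAt (formInChart I g p) b' (range I) (extChartAt I p p))
    {X : (p : M) → TangentSpace I p} {X' : 𝔼 m →L[ℝ] 𝔼 m}
    (hX : HasFDerivWithinAt (fieldInChart I X p) X' (range I) (extChartAt I p p)) (v w : 𝔼 m) :
    lieDerivative I X g p v w = b' (X p) v w + g p (X' v) w + g p v (X' w) := by
  unfold lieDerivative
  rw [mlieBracket_coordExt hX, mlieBracket_coordExt hX]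
  have h1 : ∀ b : 𝔼 m →L[ℝ] 𝔼 m →L[ℝ] ℝ, ∀ r : ℝ,
      r - b (-X' v) w - b v (-X' w) = r + b (X' v) w + b v (X' w) := fun b r => by
    rw [map_neg, map_neg, neg_apply, sub_neg_eq_add, sub_neg_eq_add]
  refine (h1 (g p) _).trans ?_
  exact congrArg (· + g p (X' v) w + g p v (X' w)) (dirDeriv_formInChart h (X p) v w)

end Fields

section Coordinates

variable {d D : ℕ}

theorem two_le_infty : (2 : ℕ∞ω) ≤ ∞ := (mod_cast le_top : ((2 : ℕ∞) : ℕ∞ω) ≤ ∞)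

/-- The first variation identity in coordinates. -/
theorem first_variation_in_coordinates {R : Set (𝔼 d)} {u₀ : 𝔼 d} (hR : UniqueDiffOn ℝ R)
    (hu : u₀ ∈ R) (hcl : u₀ ∈ closure (interior R)) {F : 𝔼 d → 𝔼 D}
    (hFs : ContDiffWithinAt ℝ ∞ F R u₀) {Gf : 𝔼 D → 𝔼 D →L[ℝ] 𝔼 D →L[ℝ] ℝ}
    (hGs : ContDiffAt ℝ ∞ Gf (F u₀)) (hsymm : ∀ z v w, Gf z v w = Gf z w v)
    (hb : IsScalarProduct (Gf (F u₀))) {f : 𝔼 D → 𝔼 D} (hfs : ContDiffAt ℝ 1 f (F u₀))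
    {c : 𝔼 d → 𝔼 d →L[ℝ] 𝔼 d →L[ℝ] ℝ}
    (hc : ∀ᶠ u in 𝓝[R] u₀, c u = pullbackForm (Gf (F u)) (fderivWithin ℝ F R u))
    (hcs : ∀ᶠ u in 𝓝[R] u₀, IsScalarProduct (c u)) :
    ∃ (b' : 𝔼 D →L[ℝ] 𝔼 D →L[ℝ] 𝔼 D →L[ℝ] ℝ) (X' : 𝔼 D →L[ℝ] 𝔼 D)
      (A' : 𝔼 d →L[ℝ] 𝔼 d →L[ℝ] 𝔼 D) (c' : 𝔼 d →L[ℝ] 𝔼 d →L[ℝ] 𝔼 d →L[ℝ] ℝ)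
      (T' : 𝔼 d →L[ℝ] 𝔼 d),
      HasFDerivAt Gf b' (F u₀) ∧ HasFDerivAt f X' (F u₀) ∧
      (∀ v, HasFDerivWithinAt (fun u => fderivWithin ℝ F R u v) (A'.flip v) R u₀) ∧
      HasFDerivWithinAt c c' R u₀ ∧
      HasFDerivWithinAt (fun u => sharp (c u) fun w => Gf (F u) (f (F u)) (fderivWithin ℝ F R u w))
        T' R u₀ ∧
      1 / 2 * metricTrace (c u₀) (fun x y =>
          b' (f (F u₀)) (fderivWithin ℝ F R u₀ x) (fderivWithin ℝ F R u₀ y) +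
          Gf (F u₀) (X' (fderivWithin ℝ F R u₀ x)) (fderivWithin ℝ F R u₀ y) +
          Gf (F u₀) (fderivWithin ℝ F R u₀ x) (X' (fderivWithin ℝ F R u₀ y))) =
        ∑ i, coord (T' (stdVec i) + christoffelForm (c u₀) c' (stdVec i)
          (sharp (c u₀) fun w => Gf (F u₀) (f (F u₀)) (fderivWithin ℝ F R u₀ w))) i +
        Gf (F u₀) (f (F u₀)) (metricTrace (c u₀) fun x y =>
          -((A' x y + christoffelForm (Gf (F u₀)) b' (fderivWithin ℝ F R u₀ x)
              (fderivWithin ℝ F R u₀ y)) -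
            fderivWithin ℝ F R u₀ (sharp (c u₀) fun w =>
              Gf (F u₀) (A' x y + christoffelForm (Gf (F u₀)) b' (fderivWithin ℝ F R u₀ x)
                (fderivWithin ℝ F R u₀ y)) (fderivWithin ℝ F R u₀ w)))) := by
  have hud : UniqueDiffWithinAt ℝ R u₀ := hR u₀ hu
  have hAs : ContDiffWithinAt ℝ ∞ (fderivWithin ℝ F R) R u₀ :=
    hFs.fderivWithin_right hR (by simp) hu
  set A : 𝔼 d → 𝔼 d →L[ℝ] 𝔼 D := fderivWithin ℝ F R with hAdef
  have hFd : HasFDerivWithinAt F (A u₀) R u₀ :=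
    (hFs.differentiableWithinAt (by simp)).hasFDerivWithinAt
  have hA' : HasFDerivWithinAt A (fderivWithin ℝ A R u₀) R u₀ :=
    (hAs.differentiableWithinAt (by simp)).hasFDerivWithinAt
  have hAsymm : IsSymmSndFDerivWithinAt ℝ F R u₀ :=
    hFs.isSymmSndFDerivWithinAt (by simpa using two_le_infty) hR hcl hu
  set A' : 𝔼 d →L[ℝ] 𝔼 d →L[ℝ] 𝔼 D := fderivWithin ℝ A R u₀ with hA'def
  obtain ⟨b', hb'⟩ : ∃ b' : 𝔼 D →L[ℝ] 𝔼 D →L[ℝ] 𝔼 D →L[ℝ] ℝ,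
      HasFDerivAt Gf b' (F u₀) :=
    ⟨_, (hGs.differentiableAt (by simp)).hasFDerivAt⟩
  obtain ⟨X', hX'⟩ : ∃ X' : 𝔼 D →L[ℝ] 𝔼 D, HasFDerivAt f X' (F u₀) :=
    ⟨_, (hfs.differentiableAt (by simp)).hasFDerivAt⟩
  have hGF : HasFDerivWithinAt (fun u => Gf (F u)) (b'.comp (A u₀)) R u₀ := by
    have := HasFDerivAt.comp_hasFDerivWithinAt (G := 𝔼 D →L[ℝ] 𝔼 D →L[ℝ] ℝ) (g := Gf) (g' := b')
      (f := F) u₀ hb' hFd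
    exact this
  have hfF : HasFDerivWithinAt (fun u => f (F u)) (X'.comp (A u₀)) R u₀ :=
    hX'.comp_hasFDerivWithinAt u₀ hFd
  have hAv : ∀ v, HasFDerivWithinAt (fun u => A u v) (A'.flip v) R u₀ := fun v => by
    refine (hA'.clm_apply (hasFDerivWithinAt_const v u₀ R)).congr_fderiv ?_
    ext1 x
    simp
  have hc0 : c u₀ = pullbackForm (Gf (F u₀)) (A u₀) := hc.self_of_nhdsWithin hu
  have hsc : IsScalarProduct (c u₀) := hcs.self_of_nhdsWithin hu
  have hcd : ContDiffWithinAt ℝ 1 c R u₀ :=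
    ContDiffWithinAt.congr_of_eventuallyEq (contDiffWithinAt_pullbackForm
      ((hGs.of_le (by simp)).comp_contDiffWithinAt u₀ (hFs.of_le (by simp)))
      (hAs.of_le (by simp))) hc hc0
  obtain ⟨c', hc'⟩ : ∃ c' : 𝔼 d →L[ℝ] 𝔼 d →L[ℝ] 𝔼 d →L[ℝ] ℝ,
      HasFDerivWithinAt c c' R u₀ :=
    ⟨_, (hcd.differentiableWithinAt (by simp)).hasFDerivWithinAt⟩
  set T : 𝔼 d → 𝔼 d := fun u => sharp (c u) fun w => Gf (F u) (f (F u)) (A u w) with hTdef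
  have hTs : ContDiffWithinAt ℝ 1 T R u₀ := by
    refine contDiffWithinAt_sharp hcd (fun v => ?_) hsc.det_ne_zero
    exact (((hGs.of_le (by simp)).comp_contDiffWithinAt u₀ (hFs.of_le (by simp))).clm_apply
      (hfs.comp_contDiffWithinAt u₀ (hFs.of_le (by simp)))).clm_apply
      ((hAs.of_le (by simp)).clm_apply contDiffWithinAt_const)
  obtain ⟨T', hT'⟩ : ∃ T' : 𝔼 d →L[ℝ] 𝔼 d, HasFDerivWithinAt T T' R u₀ :=
    ⟨_, (hTs.differentiableWithinAt (by simp)).hasFDerivWithinAt⟩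
  have hTc : ∀ᶠ u in 𝓝[R] u₀, ∀ w, c u (T u) w = Gf (F u) (f (F u)) (A u w) := by
    filter_upwards [hcs] with u hu w
    exact hu.apply_sharp ((Gf (F u) (f (F u))).comp (A u)).toLinearMap w
  refine ⟨b', X', A', c', T', hb', hX', hAv, hc', hT', ?_⟩
  have key := first_variation_identity hb (b' := b') (A := A u₀) (A' := A') (c' := c')
    (X := f (F u₀)) (X' := X') (T := T u₀) (T' := T')
    (fun z v w => by
      have h1 : ∀ v w, HasFDerivAt (fun z => Gf z v w) ((b'.flip v).flip w) (F u₀) := fun v w => by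
        have := (hb'.clm_apply (hasFDerivAt_const v _)).clm_apply (hasFDerivAt_const w _)
        refine this.congr_fderiv ?_
        ext1 z
        simp
      have h2 : (fun z => Gf z v w) = fun z => Gf z w v := funext fun z => hsymm z v w
      have h3 := h1 v w
      rw [h2] at h3
      exact DFunLike.congr_fun (h3.unique (h1 w v)) z)
    (fun v w => hAsymm v w)
    (by rw [← hc0]; exact hsc)
    (fun x v w => by
      have h1 := ((hc'.clm_apply (hasFDerivWithinAt_const v _ _)).clm_apply
        (hasFDerivWithinAt_const w _ _))
      have h2 := (hGF.clm_apply (hAv v)).clm_apply (hAv w)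
      have h3 := h2.congr_of_eventuallyEq (f₁ := fun u => c u v w)
        (by filter_upwards [hc] with u hu; rw [hu]; rfl) (by rw [hc0]; rfl)
      have h4 := DFunLike.congr_fun (hud.eq h1 h3) x
      simp at h4
      rw [h4]
      ring)
    (fun w => by
      rw [← hc0]
      exact hTc.self_of_nhdsWithin hu w)
    (fun x w => by
      rw [← hc0]
      have h1 := ((hc'.clm_apply hT').clm_apply (hasFDerivWithinAt_const w _ _))
      have h2 := (hGF.clm_apply hfF).clm_apply (hAv w)
      have h3 := h2.congr_of_eventuallyEq (f₁ := fun u => c u (T u) w)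
        (by filter_upwards [hTc] with u hu using hu w)
        (hTc.self_of_nhdsWithin hu w)
      have h4 := DFunLike.congr_fun (hud.eq h1 h3) x
      simp at h4
      linarith)
  rw [← hc0] at key
  exact key

end Coordinates

section MapInChart

variable {d D : ℕ} {H : Type*} [TopologicalSpace H] {I : ModelWithCorners ℝ (𝔼 d) H}
  {S : Type*} [TopologicalSpace S] [ChartedSpace H S] [IsManifold I ∞ S]
  {V : Type*} [TopologicalSpace V] [ChartedSpace (𝔼 D) V] [IsManifold (𝓡 D) ∞ V]
  {Ψ : S → V} {p₀ p : S} {q₀ : V}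

variable (I) in
/-- A map between manifolds in the preferred charts at `p₀` and `q₀`. -/
def mapInChart (Ψ : S → V) (p₀ : S) (q₀ : V) : 𝔼 d → 𝔼 D :=
  extChartAt (𝓡 D) q₀ ∘ Ψ ∘ (extChartAt I p₀).symm

theorem mapInChart_apply (hp : p ∈ (extChartAt I p₀).source) :
    mapInChart I Ψ p₀ q₀ (extChartAt I p₀ p) = extChartAt (𝓡 D) q₀ (Ψ p) := by
  simp only [mapInChart, Function.comp_apply]
  rw [(extChartAt I p₀).left_inv hp]

theorem hasFDerivWithinAt_mapInChart (hp : p ∈ (extChartAt I p₀).source)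
    (hq : Ψ p ∈ (extChartAt (𝓡 D) q₀).source) (hΨ : MDifferentiableAt I (𝓡 D) Ψ p) :
    HasFDerivWithinAt (mapInChart (D := D) I Ψ p₀ q₀)
      ((toChart (𝓡 D) q₀ (Ψ p)).comp ((mfderiv I (𝓡 D) Ψ p : 𝔼 d →L[ℝ] 𝔼 D).comp
        (fromChart I p₀ p))) (range I) (extChartAt I p₀ p) := by
  have h1 : HasMFDerivAt (𝓡 D) 𝓘(ℝ, 𝔼 D) (extChartAt (𝓡 D) q₀) (Ψ p) (toChart (𝓡 D) q₀ (Ψ p)) := by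
    rw [toChart_eq_mfderiv hq]
    exact (mdifferentiableAt_extChartAt (by rwa [extChartAt_source] at hq)).hasMFDerivAt
  have h2 : HasMFDerivWithinAt 𝓘(ℝ, 𝔼 d) I (extChartAt I p₀).symm (range I) (extChartAt I p₀ p)
      (fromChart I p₀ p) := by
    rw [fromChart_eq_mfderivWithin hp]
    exact (mdifferentiableWithinAt_extChartAt_symm
      ((extChartAt I p₀).map_source hp)).hasMFDerivWithinAt
  have h3 := hΨ.hasMFDerivAt
  have h4 := h1.comp p h3
  have hs := (extChartAt I p₀).left_inv hp
  rw [← hs] at h4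
  have h5 := h4.comp_hasMFDerivWithinAt _ h2
  have h6 := h5.hasFDerivWithinAt
  rw [hs] at h6
  exact h6

theorem fderivWithin_mapInChart (hp : p ∈ (extChartAt I p₀).source)
    (hq : Ψ p ∈ (extChartAt (𝓡 D) q₀).source) (hΨ : MDifferentiableAt I (𝓡 D) Ψ p) (v : 𝔼 d) :
    fderivWithin ℝ (mapInChart (D := D) I Ψ p₀ q₀) (range I) (extChartAt I p₀ p) v =
      toChart (𝓡 D) q₀ (Ψ p) (mfderiv I (𝓡 D) Ψ p (fromChart I p₀ p v)) := by
  rw [(hasFDerivWithinAt_mapInChart hp hq hΨ).fderivWithin (I.uniqueDiffOn.uniqueDiffWithinAt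
    (extChartAt_target_subset_range p₀ ((extChartAt I p₀).map_source hp)))]
  rfl

theorem contDiffWithinAt_mapInChart {n : ℕ∞} (hp : p ∈ (extChartAt I p₀).source)
    (hq : Ψ p ∈ (extChartAt (𝓡 D) q₀).source) (hΨ : ContMDiffAt I (𝓡 D) n Ψ p) :
    ContDiffWithinAt ℝ n (mapInChart (D := D) I Ψ p₀ q₀) (range I) (extChartAt I p₀ p) := by
  rw [extChartAt_source] at hp hq
  exact ((contMDiffAt_iff_of_mem_source hp hq).1 hΨ).2

theorem contDiffWithinAt_fderivWithin_mapInChart (hp : p ∈ (extChartAt I p₀).source)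
    (hq : Ψ p ∈ (extChartAt (𝓡 D) q₀).source) (hΨ : ContMDiffAt I (𝓡 D) ∞ Ψ p) :
    ContDiffWithinAt ℝ ∞ (fderivWithin ℝ (mapInChart (D := D) I Ψ p₀ q₀) (range I)) (range I)
      (extChartAt I p₀ p) :=
  (contDiffWithinAt_mapInChart hp hq hΨ).fderivWithin_right I.uniqueDiffOn (by simp)
    (extChartAt_target_subset_range p₀ ((extChartAt I p₀).map_source hp))

theorem formInChart_pullback (B : BilinField (𝓡 D) V) (hp : p ∈ (extChartAt I p₀).source)
    (hq : Ψ p ∈ (extChartAt (𝓡 D) q₀).source) (hΨ : MDifferentiableAt I (𝓡 D) Ψ p) :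
    formInChart I (pullback I (𝓡 D) Ψ B) p₀ (extChartAt I p₀ p) =
      pullbackForm (formInChart (𝓡 D) B q₀ (mapInChart I Ψ p₀ q₀ (extChartAt I p₀ p)))
        (fderivWithin ℝ (mapInChart (D := D) I Ψ p₀ q₀) (range I) (extChartAt I p₀ p)) := by
  refine ContinuousLinearMap.ext fun v => ContinuousLinearMap.ext fun w => ?_
  have h1 : formInChart I (pullback I (𝓡 D) Ψ B) p₀ (extChartAt I p₀ p) v w =
      B (Ψ p) (mfderiv I (𝓡 D) Ψ p (fromChart I p₀ p v))
        (mfderiv I (𝓡 D) Ψ p (fromChart I p₀ p w)) := by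
    rw [formInChart_apply _ hp, coordExt_eq_fromChart hp, coordExt_eq_fromChart hp]
    rfl
  have h2 := formInChart_apply_toChart B hq (mfderiv I (𝓡 D) Ψ p (fromChart I p₀ p v))
    (mfderiv I (𝓡 D) Ψ p (fromChart I p₀ p w))
  have e1 := fderivWithin_mapInChart hp hq hΨ v
  have e2 := fderivWithin_mapInChart hp hq hΨ w
  refine h1.trans (h2.symm.trans ?_)
  have e3 : ∀ a b : 𝔼 D, formInChart (𝓡 D) B q₀ (extChartAt (𝓡 D) q₀ (Ψ p)) a b =
      formInChart (𝓡 D) B q₀ (mapInChart I Ψ p₀ q₀ (extChartAt I p₀ p)) a b := fun a b => by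
    rw [mapInChart_apply hp]
  exact (e3 _ _).trans (congrArg₂ (fun a b => formInChart (𝓡 D) B q₀
    (mapInChart I Ψ p₀ q₀ (extChartAt I p₀ p)) a b) e1 e2).symm

end MapInChart

section FirstVariation

variable {d D : ℕ} {H : Type*} [TopologicalSpace H] {I : ModelWithCorners ℝ (𝔼 d) H}
  {S : Type*} [TopologicalSpace S] [ChartedSpace H S] [IsManifold I ∞ S]
  {V : Type*} [TopologicalSpace V] [ChartedSpace (𝔼 D) V] [IsManifold (𝓡 D) ∞ V]
  {g : SemiRiemannianMetric (𝓡 D) V} {Φ : S → V}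

theorem formInChart_self (B : BilinField I S) (p : S) :
    formInChart I B p (extChartAt I p p) = B p := by
  ext v w
  have h := formInChart_apply_toChart B (mem_extChartAt_source (I := I) p) v w
  rw [toChart_self, toChart_self] at h
  exact h

theorem isScalarProduct_pullback (hnd : IsNondegenerate I (𝓡 D) g.inner Φ) (p : S) :
    IsScalarProduct (d := d) (pullback I (𝓡 D) Φ g.inner p) :=
  ⟨fun _ _ => g.symm _ _ _, hnd p⟩

theorem isScalarProduct_formInChart_pullback (hnd : IsNondegenerate I (𝓡 D) g.inner Φ) {p : S}
    {u : 𝔼 d} (hu : u ∈ (extChartAt I p).target) :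
    IsScalarProduct (formInChart I (pullback I (𝓡 D) Φ g.inner) p u) :=
  isScalarProduct_pullbackForm (isScalarProduct_pullback hnd _)
    (fromChart_toChart ((extChartAt I p).map_target hu))
    (toChart_fromChart ((extChartAt I p).map_target hu))

theorem apply_tangentPart (hnd : IsNondegenerate I (𝓡 D) g.inner Φ) (p : S)
    (v : TangentSpace (𝓡 D) (Φ p)) (w : TangentSpace I p) :
    pullback I (𝓡 D) Φ g.inner p (tangentPart I (𝓡 D) g.inner Φ p v) w =
      g.inner (Φ p) v (mfderiv I (𝓡 D) Φ p w) :=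
  (isScalarProduct_pullback hnd p).apply_sharp
    ((g.inner (Φ p) v).comp (mfderiv I (𝓡 D) Φ p) : 𝔼 d →L[ℝ] ℝ).toLinearMap w

theorem formInChart_symm (g : SemiRiemannianMetric (𝓡 D) V) (q : V) (z v w : 𝔼 D) :
    formInChart (𝓡 D) g.inner q z v w = formInChart (𝓡 D) g.inner q z w v :=
  g.symm _ _ _

theorem toChart_tangentPart (hnd : IsNondegenerate I (𝓡 D) g.inner Φ)
    {ξ : (x : V) → TangentSpace (𝓡 D) x} {p₀ p : S} {q₀ : V}
    (hp : p ∈ (extChartAt I p₀).source)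
    (hq : Φ p ∈ (extChartAt (𝓡 D) q₀).source) (hΦ : MDifferentiableAt I (𝓡 D) Φ p) :
    toChart I p₀ p (tangentPart I (𝓡 D) g.inner Φ p (ξ (Φ p))) =
      sharp (formInChart I (pullback I (𝓡 D) Φ g.inner) p₀ (extChartAt I p₀ p)) fun w =>
        formInChart (𝓡 D) g.inner q₀ (mapInChart I Φ p₀ q₀ (extChartAt I p₀ p))
          (fieldInChart (𝓡 D) ξ q₀ (mapInChart I Φ p₀ q₀ (extChartAt I p₀ p)))
          (fderivWithin ℝ (mapInChart (D := D) I Φ p₀ q₀) (range I) (extChartAt I p₀ p) w) := by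
  have hs := isScalarProduct_formInChart_pullback hnd ((extChartAt I p₀).map_source hp)
  refine hs.ext_left fun w => ?_
  rw [show (fun w => formInChart (𝓡 D) g.inner q₀ (mapInChart I Φ p₀ q₀ (extChartAt I p₀ p))
          (fieldInChart (𝓡 D) ξ q₀ (mapInChart I Φ p₀ q₀ (extChartAt I p₀ p)))
          (fderivWithin ℝ (mapInChart (D := D) I Φ p₀ q₀) (range I) (extChartAt I p₀ p) w)) =
      ((formInChart (𝓡 D) g.inner q₀ (mapInChart I Φ p₀ q₀ (extChartAt I p₀ p))
          (fieldInChart (𝓡 D) ξ q₀ (mapInChart I Φ p₀ q₀ (extChartAt I p₀ p)))).comp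
        (fderivWithin ℝ (mapInChart (D := D) I Φ p₀ q₀) (range I) (extChartAt I p₀ p))).toLinearMap from rfl,
    hs.apply_sharp]
  have h1 := formInChart_apply_toChart (pullback I (𝓡 D) Φ g.inner) hp
    (tangentPart I (𝓡 D) g.inner Φ p (ξ (Φ p))) (fromChart I p₀ p w)
  rw [toChart_fromChart hp] at h1
  refine h1.trans ((apply_tangentPart hnd p (ξ (Φ p)) (fromChart I p₀ p w)).trans ?_)
  have h2 := formInChart_apply_toChart g.inner hq (ξ (Φ p))
    (mfderiv I (𝓡 D) Φ p (fromChart I p₀ p w))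
  refine h2.symm.trans ?_
  have e1 := fderivWithin_mapInChart hp hq hΦ w
  have e2 := fieldInChart_apply ξ hq
  have e3 : ∀ b : 𝔼 D, formInChart (𝓡 D) g.inner q₀ (extChartAt (𝓡 D) q₀ (Φ p))
        (toChart (𝓡 D) q₀ (Φ p) (ξ (Φ p))) b =
      formInChart (𝓡 D) g.inner q₀ (mapInChart I Φ p₀ q₀ (extChartAt I p₀ p))
        (fieldInChart (𝓡 D) ξ q₀ (mapInChart I Φ p₀ q₀ (extChartAt I p₀ p))) b := fun b => by
    rw [mapInChart_apply hp, e2]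
  exact (e3 _).trans (congrArg (fun b => formInChart (𝓡 D) g.inner q₀
    (mapInChart I Φ p₀ q₀ (extChartAt I p₀ p))
    (fieldInChart (𝓡 D) ξ q₀ (mapInChart I Φ p₀ q₀ (extChartAt I p₀ p))) b) e1).symm

theorem halfTraceLie_eq_divPlusMean (hΦ : ContMDiff I (𝓡 D) ∞ Φ)
    (hnd : IsNondegenerate I (𝓡 D) g.inner Φ) {ξ : (x : V) → TangentSpace (𝓡 D) x} {p : S}
    (hξ : ContMDiffAt (𝓡 D) (𝓡 D).tangent 1 (fun x => (⟨x, ξ x⟩ : TangentBundle (𝓡 D) V)) (Φ p)) :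
    halfTraceLie I (𝓡 D) g.inner Φ ξ p = divPlusMean I (𝓡 D) g.inner Φ ξ p := by
  have hpp := mem_extChartAt_source (I := I) p
  have hqq := mem_extChartAt_source (I := 𝓡 D) (Φ p)
  have hmd : ∀ q, MDifferentiableAt I (𝓡 D) Φ q := fun q => (hΦ q).mdifferentiableAt (by simp)
  have hF0 : mapInChart I Φ p (Φ p) (extChartAt I p p) = extChartAt (𝓡 D) (Φ p) (Φ p) :=
    mapInChart_apply hpp
  have hu0r : extChartAt I p p ∈ range I := mem_range_self _
  have hev : ∀ᶠ q in 𝓝 p, q ∈ (extChartAt I p).source ∧ Φ q ∈ (extChartAt (𝓡 D) (Φ p)).source :=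
    Filter.Eventually.and (extChartAt_source_mem_nhds (I := I) p)
      (hΦ.continuous.continuousAt.eventually (extChartAt_source_mem_nhds (I := 𝓡 D) (Φ p)))
  have hevR : ∀ᶠ u in 𝓝[range I] (extChartAt I p p), u ∈ (extChartAt I p).target ∧
      Φ ((extChartAt I p).symm u) ∈ (extChartAt (𝓡 D) (Φ p)).source := by
    have h3 := (continuousAt_extChartAt_symm (I := I) p).tendsto
    rw [extChartAt_to_inv] at h3
    filter_upwards [extChartAt_target_mem_nhdsWithin (I := I) p,
      (h3.eventually hev).filter_mono nhdsWithin_le_nhds] with u h1 h2 using ⟨h1, h2.2⟩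
  have hGs : ContDiffAt ℝ ∞ (formInChart (𝓡 D) g.inner (Φ p))
      (mapInChart I Φ p (Φ p) (extChartAt I p p)) := by
    rw [hF0]
    exact (g.contDiffOn_formInChart (Φ p)).contDiffAt
      ((isOpen_extChartAt_target (I := 𝓡 D) (Φ p)).mem_nhds (mem_extChartAt_target _))
  have hfs : ContDiffAt ℝ 1 (fieldInChart (𝓡 D) ξ (Φ p))
      (mapInChart I Φ p (Φ p) (extChartAt I p p)) := by
    rw [hF0]
    have := contDiffWithinAt_fieldInChart (n := 1) hqq hξ
    rwa [ModelWithCorners.range_eq_univ, contDiffWithinAt_univ] at this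
  obtain ⟨b', X', A', c', T', hb', hX', hAv, hc', hT', key⟩ := first_variation_in_coordinates
    I.uniqueDiffOn hu0r (I.range_subset_closure_interior hu0r)
    (contDiffWithinAt_mapInChart hpp hqq (hΦ p)) hGs (formInChart_symm g (Φ p))
    (by rw [hF0]; exact g.isScalarProduct_formInChart (mem_extChartAt_target _)) hfs
    (c := formInChart I (pullback I (𝓡 D) Φ g.inner) p)
    (by
      filter_upwards [hevR] with u hu
      have := formInChart_pullback (p₀ := p) (q₀ := Φ p) g.inner
        ((extChartAt I p).map_target hu.1) hu.2 (hmd _)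
      rwa [(extChartAt I p).right_inv hu.1] at this)
    (by
      filter_upwards [hevR] with u hu using isScalarProduct_formInChart_pullback hnd hu.1)
  have hA0 : ∀ v : 𝔼 d, fderivWithin ℝ (mapInChart (D := D) I Φ p (Φ p)) (range I)
      (extChartAt I p p) v = mfderiv I (𝓡 D) Φ p v := fun v => by
    refine (fderivWithin_mapInChart hpp hqq (hmd p) v).trans ?_
    rw [fromChart_self]
    exact toChart_self _
  rw [hF0] at hb' hX'
  rw [hF0] at key
  simp only [hA0] at key
  rw [formInChart_self, formInChart_self, fieldInChart_self] at key
  refine Eq.trans ?_ (key.trans ?_)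
  · unfold halfTraceLie
    refine congrArg (1 / 2 * ·) (congrArg (metricTrace _) ?_)
    funext x y
    exact lieDerivative_eq hb'.hasFDerivWithinAt hX'.hasFDerivWithinAt _ _
  · unfold divPlusMean divergence
    refine congrArg₂ (· + ·) (Finset.sum_congr rfl fun i _ => ?_) ?_
    · refine congrArg (coord · i) (Eq.symm ?_)
      refine (covDeriv_eq (p := p) hc' hT' ?_ _).trans ?_
      · filter_upwards [hev] with q hq
        exact toChart_tangentPart hnd hq.1 hq.2 (hmd q)
      · rw [hF0, formInChart_self, formInChart_self, fieldInChart_self]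
        simp only [hA0]
        rfl
    · have h0 : ∀ P Q : 𝔼 d → 𝔼 d → 𝔼 D, P = Q →
          g.inner (Φ p) (ξ (Φ p)) (metricTrace (W := 𝔼 D) (pullback I (𝓡 D) Φ g.inner p) P) =
          g.inner (Φ p) (ξ (Φ p)) (metricTrace (W := 𝔼 D) (pullback I (𝓡 D) Φ g.inner p) Q) := by
        rintro _ _ rfl
        rfl
      refine h0 _ _ ?_
      funext x y
      have h1 : covDerivAlong I (𝓡 D) g.inner Φ
          (fun q => mfderiv I (𝓡 D) Φ q (coordExt I p y q)) p x =
          A' x y + christoffelForm (g.inner (Φ p)) b' (mfderiv I (𝓡 D) Φ p x)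
            (mfderiv I (𝓡 D) Φ p y) := by
        unfold covDerivAlong
        refine congrArg₂ (· + ·) ?_ ?_
        · refine dirDerivVec_eq_of_eventuallyEq (hAv y) ?_ x
          filter_upwards [hev] with q hq
          rw [trivializationAt_snd_eq_toChart hq.2, coordExt_eq_fromChart hq.1]
          exact (fderivWithin_mapInChart hq.1 hq.2 (hmd q) y).symm
        · refine (christoffel_eq hb'.hasFDerivWithinAt _ _).trans ?_
          have e : (coordExt I p y p : 𝔼 d) = y :=
            (coordExt_eq_fromChart hpp y).trans (fromChart_self y)
          exact congrArg (fun y' : 𝔼 d => christoffelForm (d := D) (g.inner (Φ p)) b'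
            (mfderiv I (𝓡 D) Φ p x) (mfderiv I (𝓡 D) Φ p y')) e
      unfold shapeTensor normalPart
      rw [h1]
      rfl

end FirstVariation

section Escape

variable {V E : Type*} [TopologicalSpace V] [NormedAddCommGroup E] [NormedSpace ℝ E]

/-- A curve that has bounded speed in a chart as long as it stays in a chart ball does not leave
that ball for a short time. -/
theorem mem_of_norm_deriv_le {O K : Set V} (hO : IsOpen O) (hK : IsClosed K) (hOK : O ⊆ K)
    {u : V → E} {z₀ : E} {r M t : ℝ} (hu : ∀ q ∈ K, ContinuousAt u q)
    (hr : ∀ q ∈ K, ‖u q - z₀‖ < r → q ∈ O) {γ : ℝ → V} (hγ : ∀ s ∈ Icc 0 t, ContinuousAt γ s)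
    (h0 : γ 0 ∈ O) (hd : ∀ s ∈ Icc 0 t, γ s ∈ O → ∃ v, HasDerivAt (u ∘ γ) v s ∧ ‖v‖ ≤ M)
    (hM : 0 ≤ M) (hrt : ‖u (γ 0) - z₀‖ + M * t < r) {s : ℝ} (hs : s ∈ Icc 0 t) : γ s ∈ O := by
  by_contra hsO
  have hcont : ContinuousOn γ (Icc 0 t) := fun s hs => (hγ s hs).continuousWithinAt
  have hcl : IsCompact (Icc 0 t ∩ γ ⁻¹' Oᶜ) :=
    isCompact_Icc.of_isClosed_subset
      (hcont.preimage_isClosed_of_isClosed isClosed_Icc hO.isClosed_compl) inter_subset_left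
  obtain ⟨σ, ⟨hσt, hσO⟩, hσmin⟩ := hcl.exists_isLeast ⟨s, hs, hsO⟩
  have hlt : ∀ a ∈ Ico 0 σ, γ a ∈ O := fun a ha => by
    by_contra h
    exact absurd (hσmin ⟨⟨ha.1, ha.2.le.trans hσt.2⟩, h⟩) (not_le.2 ha.2)
  have hσ0 : 0 < σ := lt_of_le_of_ne hσt.1 (by rintro rfl; exact hσO h0)
  have hσK : γ σ ∈ K := by
    refine hK.mem_of_tendsto (((hγ σ hσt).tendsto).mono_left nhdsWithin_le_nhds)
      (b := 𝓝[<] σ) ?_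
    filter_upwards [Ioo_mem_nhdsLT hσ0] with a ha using hOK (hlt a ⟨ha.1.le, ha.2⟩)
  have hbound : ∀ a ∈ Ico 0 σ, ‖u (γ a) - u (γ 0)‖ ≤ M * t := fun a ha => by
    have hsub : ∀ x ∈ Icc 0 a, x ∈ Icc 0 t ∧ γ x ∈ O := fun x hx =>
      ⟨⟨hx.1, hx.2.trans (ha.2.le.trans hσt.2)⟩, hlt x ⟨hx.1, hx.2.trans_lt ha.2⟩⟩
    choose! v hv hvM using fun x hx => hd x (hsub x hx).1 (hsub x hx).2
    have := norm_image_sub_le_of_norm_deriv_le_segment' (f := u ∘ γ) (f' := v) (C := M)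
      (fun x hx => (hv x hx).hasDerivWithinAt) (fun x hx => hvM x (Ico_subset_Icc_self hx)) a
      ⟨ha.1, le_rfl⟩
    refine this.trans (mul_le_mul_of_nonneg_left ?_ hM)
    linarith [ha.2, hσt.2]
  have hlim : ‖u (γ σ) - u (γ 0)‖ ≤ M * t := by
    have hc : ContinuousAt (fun a => ‖u (γ a) - u (γ 0)‖) σ :=
      (((hu _ hσK).comp (hγ σ hσt)).sub continuousAt_const).norm
    have ht : Filter.Tendsto (fun a => ‖u (γ a) - u (γ 0)‖) (𝓝[<] σ) (𝓝 ‖u (γ σ) - u (γ 0)‖) :=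
      hc.tendsto.mono_left nhdsWithin_le_nhds
    refine le_of_tendsto ht ?_
    filter_upwards [Ioo_mem_nhdsLT hσ0] with a ha using hbound a ⟨ha.1.le, ha.2⟩
  refine hσO (hr _ hσK ?_)
  calc ‖u (γ σ) - z₀‖ = ‖(u (γ σ) - u (γ 0)) + (u (γ 0) - z₀)‖ := by congr 1; abel
    _ ≤ M * t + ‖u (γ 0) - z₀‖ := (norm_add_le _ _).trans (by gcongr)
    _ < r := by linarith

end Escape

section FlowInChart

open Metric

variable {D : ℕ} {V : Type*} [TopologicalSpace V] [T2Space V] [ChartedSpace (𝔼 D) V]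
  [IsManifold (𝓡 D) ∞ V] {ξ : (x : V) → TangentSpace (𝓡 D) x} {U : Set V} {W : Set (ℝ × V)}
  {φ : ℝ → V → V} {q₀ : V}

/-- A local flow in a chart. -/
def flowInChart (φ : ℝ → V → V) (q₀ : V) (t : ℝ) (z : 𝔼 D) : 𝔼 D :=
  extChartAt (𝓡 D) q₀ (φ t ((extChartAt (𝓡 D) q₀).symm z))

theorem IsLocalFlow.hasMFDerivAt (h : IsLocalFlow (𝓡 D) ξ U W φ) {t : ℝ} {q : V}
    (htq : (t, q) ∈ W) :
    HasMFDerivAt 𝓘(ℝ, ℝ) (𝓡 D) (fun τ => φ τ q) t ((1 : ℝ →L[ℝ] ℝ).smulRight (ξ (φ t q))) := by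
  refine (h.integralCurve q t htq).hasMFDerivAt ?_
  exact (h.isOpen.preimage (by fun_prop : Continuous fun τ : ℝ => (τ, q))).mem_nhds htq

theorem IsLocalFlow.hasDerivAt (h : IsLocalFlow (𝓡 D) ξ U W φ) {t : ℝ} {q : V}
    (htq : (t, q) ∈ W) (hq : φ t q ∈ (extChartAt (𝓡 D) q₀).source) :
    HasDerivAt (fun τ => extChartAt (𝓡 D) q₀ (φ τ q))
      (fieldInChart (𝓡 D) ξ q₀ (extChartAt (𝓡 D) q₀ (φ t q))) t := by
  have h1 : HasMFDerivAt (𝓡 D) 𝓘(ℝ, 𝔼 D) (extChartAt (𝓡 D) q₀) (φ t q)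
      (toChart (𝓡 D) q₀ (φ t q)) := by
    rw [toChart_eq_mfderiv hq]
    exact (mdifferentiableAt_extChartAt (by rwa [extChartAt_source] at hq)).hasMFDerivAt
  have h2 : HasFDerivAt (fun τ => extChartAt (𝓡 D) q₀ (φ τ q))
      ((toChart (𝓡 D) q₀ (φ t q)).comp ((1 : ℝ →L[ℝ] ℝ).smulRight (ξ (φ t q) : 𝔼 D))) t :=
    (h1.comp t (h.hasMFDerivAt htq)).hasFDerivAt
  rw [fieldInChart_apply ξ hq]
  refine h2.hasDerivAt.congr_deriv ?_
  change toChart (𝓡 D) q₀ (φ t q) ((1 : ℝ) • ξ (φ t q)) = _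
  exact congrArg _ (one_smul ℝ (ξ (φ t q) : 𝔼 D))

theorem IsLocalFlow.exists_mem_chart_ball (h : IsLocalFlow (𝓡 D) ξ U W φ) (hU : IsOpen U)
    (hξ : ContMDiffOn (𝓡 D) (𝓡 D).tangent 1 (fun x => (⟨x, ξ x⟩ : TangentBundle (𝓡 D) V)) U)
    (hq₀ : q₀ ∈ U) {ε : ℝ} (hε : 0 < ε) :
    ∃ δ > 0, ∀ z ∈ ball (extChartAt (𝓡 D) q₀ q₀) δ, z ∈ (extChartAt (𝓡 D) q₀).target ∧
      ∀ t ∈ Ioo (-δ) δ, (t, (extChartAt (𝓡 D) q₀).symm z) ∈ W ∧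
        φ t ((extChartAt (𝓡 D) q₀).symm z) ∈ (extChartAt (𝓡 D) q₀).source ∧
        flowInChart φ q₀ t z ∈ ball (extChartAt (𝓡 D) q₀ q₀) ε := by
  set x := extChartAt (𝓡 D) q₀ with hx
  set z₀ := x q₀ with hz₀
  set f := fieldInChart (𝓡 D) ξ q₀ with hf
  have htz : x.target ∈ 𝓝 z₀ := (isOpen_extChartAt_target (I := 𝓡 D) q₀).mem_nhds
    (mem_extChartAt_target q₀)
  have hfc : ContinuousAt f z₀ := by
    have h1 := contDiffWithinAt_fieldInChart (n := 1) (mem_extChartAt_source (I := 𝓡 D) q₀)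
      (hξ.contMDiffAt (hU.mem_nhds hq₀))
    rw [ModelWithCorners.range_eq_univ, contDiffWithinAt_univ] at h1
    exact h1.continuousAt
  obtain ⟨ε₀, hε₀, hball⟩ : ∃ ε₀ > 0, ∀ z ∈ ball z₀ ε₀, z ∈ x.target ∧ ‖f z‖ ≤ ‖f z₀‖ + 1 := by
    have h2 : ∀ᶠ z in 𝓝 z₀, ‖f z‖ < ‖f z₀‖ + 1 :=
      hfc.norm.eventually_lt continuousAt_const (by simp)
    obtain ⟨ε₀, hε₀, hs⟩ := Metric.eventually_nhds_iff_ball.1 (Filter.Eventually.and htz h2)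
    exact ⟨ε₀, hε₀, fun z hz => ⟨(hs z hz).1, (hs z hz).2.le⟩⟩
  set M := ‖f z₀‖ + 1 with hM
  have hM0 : 0 < M := by positivity
  set r := min ε ε₀ / 2 with hr
  have hr0 : 0 < r := by positivity
  have hrε : r < ε := by have := min_le_left ε ε₀; rw [hr]; linarith [lt_min hε hε₀]
  have hrε₀ : r < ε₀ := by have := min_le_right ε ε₀; rw [hr]; linarith [lt_min hε hε₀]
  have hcb : closedBall z₀ r ⊆ x.target := fun z hz => (hball z (closedBall_subset_ball hrε₀ hz)).1
  obtain ⟨δ₁, hδ₁, hW⟩ : ∃ δ₁ > 0, ∀ z ∈ ball z₀ δ₁, ∀ t ∈ Ioo (-δ₁) δ₁, (t, x.symm z) ∈ W := by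
    have hc : ContinuousAt (fun a : ℝ × 𝔼 D => (a.1, x.symm a.2)) (0, z₀) :=
      continuousAt_fst.prodMk ((continuousAt_extChartAt_symm (I := 𝓡 D) q₀).comp
        (x := ((0 : ℝ), z₀)) continuousAt_snd)
    have hm : (fun a : ℝ × 𝔼 D => (a.1, x.symm a.2)) ⁻¹' W ∈ 𝓝 ((0 : ℝ), z₀) := by
      refine hc.preimage_mem_nhds (h.isOpen.mem_nhds ?_)
      rw [hz₀, hx, extChartAt_to_inv]
      exact h.zero_mem q₀ hq₀
    obtain ⟨δ₁, hδ₁, hs⟩ := Metric.mem_nhds_iff.1 hm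
    refine ⟨δ₁, hδ₁, fun z hz t ht => ?_⟩
    have hm2 : (t, z) ∈ ball ((0 : ℝ), z₀) δ₁ := by
      rw [← ball_prod_same]
      exact ⟨by rw [Real.ball_eq_Ioo]; simpa using ht, hz⟩
    exact hs hm2
  have hδ₂ : 0 < min δ₁ (min (r / 2) (r / 2 / M)) := by positivity
  set δ := min δ₁ (min (r / 2) (r / 2 / M)) with hδ
  have hδ₁' : δ ≤ δ₁ := min_le_left _ _
  have hδr : δ ≤ r / 2 := (min_le_right _ _).trans (min_le_left _ _)
  have hδM : M * δ ≤ r / 2 := by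
    have h1 : δ ≤ r / 2 / M := (min_le_right _ _).trans (min_le_right _ _)
    rw [le_div_iff₀ hM0] at h1
    linarith
  -- the chart balls in the manifold
  set O : Set V := x.source ∩ x ⁻¹' ball z₀ r with hO
  set K : Set V := x.symm '' closedBall z₀ r with hK
  have hOo : IsOpen O := isOpen_extChartAt_preimage' (I := 𝓡 D) q₀ isOpen_ball
  have hKc : IsClosed K := ((isCompact_closedBall z₀ r).image_of_continuousOn
    ((continuousOn_extChartAt_symm (I := 𝓡 D) q₀).mono hcb)).isClosed
  have hOK : O ⊆ K := fun q hq => ⟨x q, ball_subset_closedBall hq.2, x.left_inv hq.1⟩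
  have hKs : K ⊆ x.source := by
    rintro _ ⟨z, hz, rfl⟩
    exact x.map_target (hcb hz)
  have key : ∀ z ∈ ball z₀ δ, ∀ c : ℝ, |c| = 1 → ∀ t ∈ Ico 0 δ, φ (c * t) (x.symm z) ∈ O := by
    intro z hz c hc t ht
    have hzW : ∀ s ∈ Icc 0 t, (c * s, x.symm z) ∈ W := fun s hs => by
      refine hW z (ball_subset_ball hδ₁' hz) _ (abs_lt.1 ?_)
      rw [abs_mul, hc, one_mul, abs_of_nonneg hs.1]
      linarith [hs.2, ht.2]
    have hzt : z ∈ x.target := hcb (ball_subset_closedBall (ball_subset_ball (by linarith) hz))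
    have hz0 : φ (c * 0) (x.symm z) = x.symm z := by
      rw [mul_zero]
      exact h.init _ (h.subset _ _ (hzW 0 ⟨le_rfl, ht.1⟩))
    have hsc : ∀ s, HasDerivAt (fun s => c * s) c s := fun s => by
      simpa using (hasDerivAt_id s).const_mul c
    refine mem_of_norm_deriv_le (K := K) hOo hKc hOK (u := x) (z₀ := z₀) (r := r) (M := M) (t := t)
      (γ := fun s => φ (c * s) (x.symm z))
      (fun q hq => continuousAt_extChartAt' (hKs hq)) (fun q hq hqr => ⟨hKs hq, ?_⟩)
      (fun s hs => ?_) ?_ (fun s hs hsO => ?_) hM0.le ?_ ⟨ht.1, le_rfl⟩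
    · rwa [mem_preimage, mem_ball, dist_eq_norm]
    · exact (h.hasMFDerivAt (hzW s hs)).continuousAt.comp (hsc s).continuousAt
    · simp only [hz0]
      refine ⟨x.map_target hzt, ?_⟩
      rw [mem_preimage, x.right_inv hzt]
      exact ball_subset_ball (by linarith) hz
    · refine ⟨c • f (x (φ (c * s) (x.symm z))), ?_, ?_⟩
      · exact (h.hasDerivAt (q₀ := q₀) (hzW s hs) hsO.1).scomp s (hsc s)
      · rw [norm_smul, Real.norm_eq_abs, hc, one_mul]
        exact (hball _ (ball_subset_ball hrε₀.le hsO.2)).2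
    · simp only [hz0]
      rw [x.right_inv hzt, ← dist_eq_norm]
      have := mul_le_mul_of_nonneg_left ht.2.le hM0.le
      linarith [mem_ball.1 hz]
  refine ⟨δ, hδ₂, fun z hz =>
    ⟨hcb (ball_subset_closedBall (ball_subset_ball (by linarith) hz)), fun t ht => ?_⟩⟩
  have hO : φ t (x.symm z) ∈ O := by
    rcases le_total 0 t with h0 | h0
    · simpa using key z hz 1 (by simp) t ⟨h0, ht.2⟩
    · simpa using key z hz (-1) (by simp) (-t) ⟨by linarith, by linarith [ht.1]⟩
  exact ⟨hW z (ball_subset_ball hδ₁' hz) t ⟨by linarith [ht.1], by linarith [ht.2]⟩, hO.1,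
    ball_subset_ball hrε.le hO.2⟩

theorem IsLocalFlow.isFlowNear (h : IsLocalFlow (𝓡 D) ξ U W φ) (hU : IsOpen U)
    (hξ : ContMDiffOn (𝓡 D) (𝓡 D).tangent 1 (fun x => (⟨x, ξ x⟩ : TangentBundle (𝓡 D) V)) U)
    (hq₀ : q₀ ∈ U) :
    IsFlowNear (fieldInChart (𝓡 D) ξ q₀) (flowInChart φ q₀) (extChartAt (𝓡 D) q₀ q₀) := by
  intro ε hε
  obtain ⟨δ, hδ, hz⟩ := h.exists_mem_chart_ball hU hξ hq₀ hε
  refine ⟨δ, hδ, fun z hzb => ⟨?_, fun t ht => ⟨((hz z hzb).2 t ht).2.2, ?_⟩⟩⟩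
  · have h1 := ((hz z hzb).2 0 ⟨by linarith, hδ⟩).1
    rw [flowInChart, h.init _ (h.subset _ _ h1)]
    exact (extChartAt (𝓡 D) q₀).right_inv (hz z hzb).1
  · exact h.hasDerivAt ((hz z hzb).2 t ht).1 ((hz z hzb).2 t ht).2.1

end FlowInChart

section FlowDensity

open Metric

variable {d D : ℕ}

/-- The Lie derivative of `G` along `f` at `z`, pulled back by `B`. -/
def variationForm (G : 𝔼 D → 𝔼 D →L[ℝ] 𝔼 D →L[ℝ] ℝ) (f : 𝔼 D → 𝔼 D) (z : 𝔼 D)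
    (B : 𝔼 d →L[ℝ] 𝔼 D) (v w : 𝔼 d) : ℝ :=
  fderiv ℝ G z (f z) (B v) (B w) + G z (fderiv ℝ f z (B v)) (B w) + G z (B v) (fderiv ℝ f z (B w))

theorem hasDerivAt_pullbackDensity {b : ℝ → 𝔼 D →L[ℝ] 𝔼 D →L[ℝ] ℝ} {b' : 𝔼 D →L[ℝ] 𝔼 D →L[ℝ] ℝ}
    {A : ℝ → 𝔼 d →L[ℝ] 𝔼 D} {A' : 𝔼 d →L[ℝ] 𝔼 D} (hb : HasDerivAt b b' 0)
    (hA : HasDerivAt A A' 0) (hsymm : ∀ v w, b 0 v w = b 0 w v)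
    (h0 : (gram (pullbackForm (b 0) (A 0))).det ≠ 0) :
    HasDerivAt (fun t => pullbackDensity (b t) (A t))
      (1 / 2 * metricTrace (pullbackForm (b 0) (A 0)) (fun x y =>
        b' (A 0 x) (A 0 y) + b 0 (A' x) (A 0 y) + b 0 (A 0 x) (A' y)) *
          pullbackDensity (b 0) (A 0)) 0 := by
  refine hasDerivAt_sqrt_abs_det_gram (fun v w => ?_) (fun v w => hsymm _ _) h0
  have h := (hb.clm_apply (hA.clm_apply (hasDerivAt_const (0 : ℝ) v))).clm_apply
    (hA.clm_apply (hasDerivAt_const (0 : ℝ) w))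
  refine h.congr_deriv ?_
  simp

theorem hasDerivAt_flowDensity {G : 𝔼 D → 𝔼 D →L[ℝ] 𝔼 D →L[ℝ] ℝ} {f : 𝔼 D → 𝔼 D}
    {θ : ℝ → 𝔼 D → 𝔼 D} {z : 𝔼 D} (B : 𝔼 d →L[ℝ] 𝔼 D) (hG : DifferentiableAt ℝ G z)
    (hsymm : ∀ v w, G z v w = G z w v) (h0 : θ 0 z = z) (h0' : fderiv ℝ (θ 0) z = 1)
    (hθ : HasDerivAt (fun t => θ t z) (f z) 0)
    (hθ' : HasDerivAt (fun t => fderiv ℝ (θ t) z) (fderiv ℝ f z) 0)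
    (hdet : (gram (pullbackForm (G z) B)).det ≠ 0) :
    HasDerivAt (fun t => pullbackDensity (G (θ t z)) ((fderiv ℝ (θ t) z).comp B))
      (1 / 2 * metricTrace (pullbackForm (G z) B) (variationForm G f z B) *
        pullbackDensity (G z) B) 0 := by
  have hb : HasDerivAt (fun t => G (θ t z)) (fderiv ℝ G z (f z)) 0 := by
    have hG' := hG.hasFDerivAt
    rw [← h0] at hG'
    have := HasFDerivAt.comp_hasDerivAt (E := 𝔼 D →L[ℝ] 𝔼 D →L[ℝ] ℝ) (l := G)
      (l' := fderiv ℝ G (θ 0 z)) (f := fun t => θ t z) (f' := f z) (0 : ℝ) hG' hθ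
    rw [h0] at this
    exact this
  have hA : HasDerivAt (fun t => (fderiv ℝ (θ t) z).comp B) ((fderiv ℝ f z).comp B) 0 := by
    have := hθ'.clm_comp (hasDerivAt_const (0 : ℝ) B)
    simpa using this
  have e0 : (fderiv ℝ (θ 0) z).comp B = B := by rw [h0']; rfl
  have h := hasDerivAt_pullbackDensity hb hA (by simpa [h0] using hsymm) (by rw [h0, e0]; exact hdet)
  rw [h0, e0] at h
  exact h

section Continuity

variable {R : Set (𝔼 d)} {u₀ : 𝔼 d} {F : 𝔼 d → 𝔼 D} {A : 𝔼 d → 𝔼 d →L[ℝ] 𝔼 D}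
  {b : 𝔼 d → 𝔼 D →L[ℝ] 𝔼 D →L[ℝ] ℝ}

theorem continuousWithinAt_pullbackForm_apply (hb : ContinuousWithinAt b R u₀)
    (hA : ContinuousWithinAt A R u₀) (v w : 𝔼 d) :
    ContinuousWithinAt (fun u => pullbackForm (b u) (A u) v w) R u₀ :=
  (hb.clm_apply (hA.clm_apply continuousWithinAt_const)).clm_apply
    (hA.clm_apply continuousWithinAt_const)

theorem continuousWithinAt_det_gram_pullbackForm (hb : ContinuousWithinAt b R u₀)
    (hA : ContinuousWithinAt A R u₀) :
    ContinuousWithinAt (fun u => (gram (pullbackForm (b u) (A u))).det) R u₀ := by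
  simp only [Matrix.det_apply']
  exact tendsto_finsetSum _ fun σ _ => continuousWithinAt_const.mul
    (tendsto_finsetProd _ fun k _ => continuousWithinAt_pullbackForm_apply hb hA _ _)

theorem continuousWithinAt_metricTrace_pullbackForm (hb : ContinuousWithinAt b R u₀)
    (hA : ContinuousWithinAt A R u₀) (hdet : (gram (pullbackForm (b u₀) (A u₀))).det ≠ 0)
    {P : 𝔼 d → 𝔼 d → 𝔼 d → ℝ} (hP : ∀ v w, ContinuousWithinAt (fun u => P u v w) R u₀) :
    ContinuousWithinAt (fun u => metricTrace (pullbackForm (b u) (A u)) (P u)) R u₀ := by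
  simp only [metricTrace, smul_eq_mul]
  refine tendsto_finsetSum _ fun i _ => tendsto_finsetSum _ fun j _ => ?_
  refine Filter.Tendsto.mul ?_ (hP _ _)
  simp only [Matrix.inv_def, Ring.inverse_eq_inv', Matrix.smul_apply, smul_eq_mul,
    Matrix.adjugate_apply]
  refine ((continuousWithinAt_det_gram_pullbackForm hb hA).inv₀ hdet).mul ?_
  simp only [Matrix.det_apply']
  refine tendsto_finsetSum _ fun σ _ => continuousWithinAt_const.mul
    (tendsto_finsetProd _ fun k _ => ?_)
  by_cases hk : σ k = j
  · subst hk
    simpa using tendsto_const_nhds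
  · simpa [Matrix.updateRow_ne hk, gram] using
      (continuousWithinAt_pullbackForm_apply hb hA (stdVec (σ k)) (stdVec k)).tendsto

set_option maxSynthPendingDepth 3 in
theorem continuousWithinAt_metricTrace_variationForm (hF : ContinuousWithinAt F R u₀)
    (hA : ContinuousWithinAt A R u₀)
    {G : 𝔼 D → 𝔼 D →L[ℝ] 𝔼 D →L[ℝ] ℝ} (hG : ContDiffAt ℝ 1 G (F u₀))
    (hdet : (gram (pullbackForm (G (F u₀)) (A u₀))).det ≠ 0)
    {f : 𝔼 D → 𝔼 D} (hf : ContDiffAt ℝ 1 f (F u₀)) :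
    ContinuousWithinAt (fun u => 1 / 2 * metricTrace (pullbackForm (G (F u)) (A u))
      (variationForm G f (F u) (A u))) R u₀ := by
  have hGF : ContinuousWithinAt (fun u => G (F u)) R u₀ :=
    hG.continuousAt.comp_continuousWithinAt hF
  have hAv : ∀ v, ContinuousWithinAt (fun u => A u v) R u₀ := fun v =>
    hA.clm_apply continuousWithinAt_const
  have hDf : ContinuousWithinAt (fun u => fderiv ℝ f (F u)) R u₀ :=
    (hf.continuousAt_fderiv (by simp)).comp_continuousWithinAt hF
  have hDG : ContinuousWithinAt (fun u => fderiv ℝ G (F u)) R u₀ :=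
    have h : ContinuousAt (fderiv ℝ G) (F u₀) := hG.continuousAt_fderiv (by simp)
    h.comp_continuousWithinAt hF
  have hfF : ContinuousWithinAt (fun u => f (F u)) R u₀ :=
    hf.continuousAt.comp_continuousWithinAt hF
  refine continuousWithinAt_const.mul (continuousWithinAt_metricTrace_pullbackForm hGF hA hdet
    fun v w => ContinuousWithinAt.add (ContinuousWithinAt.add ?_ ?_) ?_)
  · exact ((hDG.clm_apply hfF).clm_apply (hAv _)).clm_apply (hAv _)
  · exact (hGF.clm_apply (hDf.clm_apply (hAv _))).clm_apply (hAv _)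
  · exact (hGF.clm_apply (hAv _)).clm_apply (hDf.clm_apply (hAv _))

end Continuity

theorem IsFlowNear.exists_density_bounds {R : Set (𝔼 d)} {u₀ : 𝔼 d} {F : 𝔼 d → 𝔼 D}
    {A : 𝔼 d → 𝔼 d →L[ℝ] 𝔼 D} (hF : ContinuousWithinAt F R u₀) (hA : ContinuousWithinAt A R u₀)
    (hu₀ : u₀ ∈ R)
    {G : 𝔼 D → 𝔼 D →L[ℝ] 𝔼 D →L[ℝ] ℝ} (hG : ContDiffAt ℝ 1 G (F u₀))
    (hsymm : ∀ z v w, G z v w = G z w v) (hdet : (gram (pullbackForm (G (F u₀)) (A u₀))).det ≠ 0)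
    {f : 𝔼 D → 𝔼 D} (hf : ContDiffAt ℝ 1 f (F u₀)) {θ : ℝ → 𝔼 D → 𝔼 D}
    (hθ : IsFlowNear f θ (F u₀)) :
    ∃ δ > 0, ∃ C ≥ 0, ∀ᶠ u in 𝓝[R] u₀, F u ∈ ball (F u₀) δ ∧
      HasDerivAt (fun t => pullbackDensity (G (θ t (F u))) ((fderiv ℝ (θ t) (F u)).comp (A u)))
        (1 / 2 * metricTrace (pullbackForm (G (F u)) (A u)) (variationForm G f (F u) (A u)) *
          pullbackDensity (G (F u)) (A u)) 0 ∧
      ∀ t, |t| < δ →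
        |pullbackDensity (G (θ t (F u))) ((fderiv ℝ (θ t) (F u)).comp (A u)) -
          pullbackDensity (G (F u)) (A u)| ≤ C * |t| ∧
        (∀ z ∈ ball (F u₀) δ, DifferentiableAt ℝ (θ t) z ∧ ContinuousAt G (θ t z)) := by
  have hGF : ContinuousWithinAt (fun u => G (F u)) R u₀ :=
    hG.continuousAt.comp_continuousWithinAt hF
  have hdetc := continuousWithinAt_det_gram_pullbackForm hGF hA
  obtain ⟨K, s, hs, hK⟩ := exists_lipschitzOnWith_pullbackDensity hdet
  obtain ⟨ε, hε, hsε⟩ := (Metric.mem_nhds_iff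
    (α := (𝔼 D →L[ℝ] 𝔼 D →L[ℝ] ℝ) × (𝔼 d →L[ℝ] 𝔼 D))).1 hs
  obtain ⟨L, s', hs', hL⟩ := hG.exists_lipschitzOnWith
  have hGd : ∀ᶠ z in 𝓝 (F u₀), ContDiffAt ℝ 1 G z := hG.eventually (by simp)
  obtain ⟨ρ, hρ, hρs⟩ := Metric.mem_nhds_iff.1 (Filter.inter_mem hs' hGd)
  obtain ⟨δ₁, hδ₁, C, hC, hfl⟩ := hθ.exists_bounds hf
  obtain ⟨δ₂, hδ₂, hin⟩ := hθ ρ hρ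
  have hAn : ∀ᶠ u in 𝓝[R] u₀, ‖A u‖ < ‖A u₀‖ + 1 :=
    hA.norm.eventually_lt continuousWithinAt_const (by simp)
  set a := ‖A u₀‖ + 1 with ha
  have ha0 : 0 < a := by positivity
  set C₁ : ℝ := max (L * C) (C * a) with hC₁
  have hC₁0 : 0 ≤ C₁ := le_max_of_le_left (by positivity)
  set δ := min (min δ₁ δ₂) (min ρ (ε / 2 / (C₁ + 1))) with hδ
  have hδ0 : 0 < δ := by positivity
  have hδδ₁ : δ ≤ δ₁ := (min_le_left _ _).trans (min_le_left _ _)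
  have hδδ₂ : δ ≤ δ₂ := (min_le_left _ _).trans (min_le_right _ _)
  have hδρ : δ ≤ ρ := (min_le_right _ _).trans (min_le_left _ _)
  have hδε : C₁ * δ ≤ ε / 2 := by
    have h1 : δ ≤ ε / 2 / (C₁ + 1) := (min_le_right _ _).trans (min_le_right _ _)
    rw [le_div_iff₀ (by positivity)] at h1
    nlinarith
  have hclose : ∀ᶠ u in 𝓝[R] u₀, (G (F u), A u) ∈ ball (G (F u₀), A u₀) (ε / 2) := by
    have h1 : ∀ᶠ u in 𝓝[R] u₀, G (F u) ∈ ball (G (F u₀)) (ε / 2) :=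
      hGF.eventually_mem (ball_mem_nhds (α := 𝔼 D →L[ℝ] 𝔼 D →L[ℝ] ℝ) _ (half_pos hε))
    have h2 : ∀ᶠ u in 𝓝[R] u₀, A u ∈ ball (A u₀) (ε / 2) :=
      hA.eventually_mem (ball_mem_nhds (α := 𝔼 d →L[ℝ] 𝔼 D) _ (half_pos hε))
    filter_upwards [h1, h2] with u hu1 hu2
    rw [← ball_prod_same]
    exact ⟨hu1, hu2⟩
  have hdetn : ∀ᶠ u in 𝓝[R] u₀, (gram (pullbackForm (G (F u)) (A u))).det ≠ 0 :=
    hdetc.eventually_ne hdet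
  refine ⟨δ, hδ0, K * C₁, by positivity, ?_⟩
  filter_upwards [hAn, hclose, hdetn, hF.eventually_mem (ball_mem_nhds _ hδ0)] with u hu1 hu2 hu3 hu4
  obtain ⟨hθ0, hθd, hθd', hθb⟩ := hfl (F u) (ball_subset_ball hδδ₁ hu4)
  have h0' : fderiv ℝ (θ 0) (F u) = 1 := by
    have := (hθb 0 (by simpa using hδ₁)).2.1
    simpa [sub_eq_zero] using this
  have hGu : ContDiffAt ℝ 1 G (F u) := (hρs (ball_subset_ball hδρ hu4)).2
  refine ⟨hu4, hasDerivAt_flowDensity (A u) (hGu.differentiableAt (by simp)) (hsymm _) hθ0 h0' hθd hθd' hu3, fun t ht => ⟨?_, fun z hz => ⟨?_, ?_⟩⟩⟩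
  · obtain ⟨hb1, hb2, -⟩ := hθb t (ht.trans_le hδδ₁)
    have hθρ : θ t (F u) ∈ ball (F u₀) ρ :=
      ((hin _ (ball_subset_ball hδδ₂ hu4)).2 t (abs_lt.1 (ht.trans_le hδδ₂))).1
    have hd1 : dist (G (θ t (F u))) (G (F u)) ≤ C₁ * |t| := by
      refine (hL.dist_le_mul _ (hρs hθρ).1 _ (hρs (ball_subset_ball hδρ hu4)).1).trans ?_
      rw [dist_eq_norm]
      calc (L : ℝ) * ‖θ t (F u) - F u‖ ≤ L * (C * |t|) := by gcongr
        _ = (L * C) * |t| := by ring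
        _ ≤ C₁ * |t| := by gcongr; exact le_max_left _ _
    have hd2 : dist ((fderiv ℝ (θ t) (F u)).comp (A u)) (A u) ≤ C₁ * |t| := by
      have e : (fderiv ℝ (θ t) (F u)).comp (A u) - A u = (fderiv ℝ (θ t) (F u) - 1).comp (A u) := by
        rw [ContinuousLinearMap.sub_comp]; rfl
      rw [dist_eq_norm, e]
      calc ‖(fderiv ℝ (θ t) (F u) - 1).comp (A u)‖ ≤ ‖fderiv ℝ (θ t) (F u) - 1‖ * ‖A u‖ :=
            ContinuousLinearMap.opNorm_comp_le _ _
        _ ≤ (C * |t|) * a := by gcongr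
        _ = (C * a) * |t| := by ring
        _ ≤ C₁ * |t| := by gcongr; exact le_max_right _ _
    have hd : dist (G (θ t (F u)), (fderiv ℝ (θ t) (F u)).comp (A u)) (G (F u), A u) ≤ C₁ * |t| := by
      rw [Prod.dist_eq]
      exact max_le hd1 hd2
    have hsmall : C₁ * |t| ≤ ε / 2 :=
      (mul_le_mul_of_nonneg_left ht.le hC₁0).trans hδε
    have hm1 : (G (θ t (F u)), (fderiv ℝ (θ t) (F u)).comp (A u)) ∈ s := by
      refine hsε ?_
      rw [mem_ball]
      calc dist _ _ ≤ _ + _ := dist_triangle _ (G (F u), A u) _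
        _ < ε / 2 + ε / 2 := add_lt_add_of_le_of_lt (hd.trans hsmall) hu2
        _ = ε := by ring
    have hm2 : (G (F u), A u) ∈ s := hsε (ball_subset_ball (by linarith) hu2)
    have := hK.dist_le_mul _ hm1 _ hm2
    rw [Real.dist_eq] at this
    refine this.trans ?_
    rw [mul_assoc]
    gcongr
  · exact ((hfl z (ball_subset_ball hδδ₁ hz)).2.2.2 t (ht.trans_le hδδ₁)).2.2
  · have hGz : ContDiffAt ℝ 1 G (θ t z) :=
      (hρs ((hin _ (ball_subset_ball hδδ₂ hz)).2 t (abs_lt.1 (ht.trans_le hδδ₂))).1).2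
    exact hGz.continuousAt

end FlowDensity

section ChartDensity

variable {d : ℕ} {H : Type*} [TopologicalSpace H] {I : ModelWithCorners ℝ (𝔼 d) H}
  {S : Type*} [TopologicalSpace S] [ChartedSpace H S] [IsManifold I ∞ S] {p₀ p : S}

theorem det_apply_apply (β : 𝔼 d →L[ℝ] 𝔼 d →L[ℝ] ℝ) (w : Fin d → 𝔼 d) :
    (Matrix.of fun i j => β (w i) (w j)).det =
      (Matrix.of fun i j => w i j).det ^ 2 * (gram β).det := by
  have h : (Matrix.of fun i j => β (w i) (w j)) =
      (Matrix.of fun i j => w i j) * gram β * (Matrix.of fun i j => w i j).transpose := by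
    ext i j
    rw [Matrix.of_apply, apply_eq_sum_gram, Matrix.mul_apply, Finset.sum_comm]
    refine Finset.sum_congr rfl fun k _ => ?_
    rw [Matrix.mul_apply, Finset.sum_mul]
    rfl
  rw [h, Matrix.det_mul, Matrix.det_mul, Matrix.det_transpose]
  ring

variable (I) in
/-- The density of a field of bilinear forms in the preferred chart at `p₀`. -/
def chartDensity (B : BilinField I S) (p₀ p : S) : ℝ :=
  √|(gram (formInChart I B p₀ (extChartAt I p₀ p))).det|

variable (I) in
/-- The determinant of the components of tangent vectors in the preferred chart at `p₀`. -/
def chartDet (p₀ p : S) (v : Fin d → 𝔼 d) : ℝ :=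
  (Matrix.of fun i j => toChart I p₀ p (v i) j).det

theorem volumeElement_eq (B : BilinField I S) (hp : p ∈ (extChartAt I p₀).source)
    (v : Fin d → 𝔼 d) :
    volumeElement I B p v = |chartDet I p₀ p v| * chartDensity I B p₀ p := by
  have h : (Matrix.of fun i j => B p (v i) (v j)) = Matrix.of fun i j =>
      formInChart I B p₀ (extChartAt I p₀ p) (toChart I p₀ p (v i)) (toChart I p₀ p (v j)) := by
    ext i j
    exact (formInChart_apply_toChart B hp (v i) (v j)).symm
  unfold volumeElement chartDensity chartDet
  refine (congrArg (fun M : Matrix (Fin d) (Fin d) ℝ => √|M.det|) h).trans ?_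
  simp only [det_apply_apply (formInChart I B p₀ (extChartAt I p₀ p))
    (fun i => toChart I p₀ p (v i)), abs_mul, abs_pow,
    Real.sqrt_mul (pow_nonneg (abs_nonneg _) 2), Real.sqrt_sq (abs_nonneg _)]

theorem chartDet_fromChart (hp : p ∈ (extChartAt I p₀).source) :
    chartDet I p₀ p (fun i => fromChart I p₀ p (stdVec i)) = 1 := by
  unfold chartDet
  rw [← Matrix.det_one (n := Fin d)]
  congr 1
  ext i j
  rw [Matrix.of_apply, toChart_fromChart hp, coord_stdVec, Matrix.one_apply]
  simp [eq_comm]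

theorem chartDensity_eq_volumeElement (B : BilinField I S) (hp : p ∈ (extChartAt I p₀).source) :
    chartDensity I B p₀ p = volumeElement I B p (fun i => fromChart I p₀ p (stdVec i)) := by
  rw [volumeElement_eq B hp, chartDet_fromChart hp, abs_one, one_mul]

end ChartDensity

section PushedMap

open Metric

variable {d D : ℕ} {H : Type*} [TopologicalSpace H] {I : ModelWithCorners ℝ (𝔼 d) H}
  {S : Type*} [TopologicalSpace S] [ChartedSpace H S] [IsManifold I ∞ S]
  {V : Type*} [TopologicalSpace V] [ChartedSpace (𝔼 D) V] [IsManifold (𝓡 D) ∞ V]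
  {Φ : S → V} {p₀ p : S} {q₀ : V} {ψ : V → V}

theorem mdifferentiableAt_of_chart {q : V} {θ : 𝔼 D → 𝔼 D} (hq : q ∈ (extChartAt (𝓡 D) q₀).source)
    (hθ : DifferentiableAt ℝ θ (extChartAt (𝓡 D) q₀ q))
    (hψ : ∀ᶠ q' in 𝓝 q, ψ q' ∈ (extChartAt (𝓡 D) q₀).source ∧
      extChartAt (𝓡 D) q₀ (ψ q') = θ (extChartAt (𝓡 D) q₀ q')) :
    MDifferentiableAt (𝓡 D) (𝓡 D) ψ q := by
  have h1 : MDifferentiableAt (𝓡 D) 𝓘(ℝ, 𝔼 D) (extChartAt (𝓡 D) q₀) q :=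
    mdifferentiableAt_extChartAt (by rwa [extChartAt_source] at hq)
  have h2 : MDifferentiableAt 𝓘(ℝ, 𝔼 D) 𝓘(ℝ, 𝔼 D) θ (extChartAt (𝓡 D) q₀ q) :=
    hθ.mdifferentiableAt
  have ht : θ (extChartAt (𝓡 D) q₀ q) ∈ (extChartAt (𝓡 D) q₀).target := by
    rw [← hψ.self_of_nhds.2]
    exact (extChartAt (𝓡 D) q₀).map_source hψ.self_of_nhds.1
  have h3 : MDifferentiableAt 𝓘(ℝ, 𝔼 D) (𝓡 D) (extChartAt (𝓡 D) q₀).symm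
      (θ (extChartAt (𝓡 D) q₀ q)) :=
    ((contMDiffOn_extChartAt_symm (I := 𝓡 D) (n := ∞) q₀).contMDiffAt
      ((isOpen_extChartAt_target (I := 𝓡 D) q₀).mem_nhds ht)).mdifferentiableAt (by simp)
  refine (MDifferentiableAt.comp q h3 (MDifferentiableAt.comp q h2 h1)).congr_of_eventuallyEq ?_
  filter_upwards [hψ] with q' hq'
  simp only [Function.comp_apply]
  rw [← hq'.2, (extChartAt (𝓡 D) q₀).left_inv hq'.1]

theorem formInChart_pullback_comp (B : BilinField (𝓡 D) V) {θ : 𝔼 D → 𝔼 D}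
    (hp : p ∈ (extChartAt I p₀).source) (hq : Φ p ∈ (extChartAt (𝓡 D) q₀).source)
    (hΦ : MDifferentiableAt I (𝓡 D) Φ p)
    (hθ : DifferentiableAt ℝ θ (extChartAt (𝓡 D) q₀ (Φ p)))
    (hψ : ∀ᶠ q' in 𝓝 (Φ p), ψ q' ∈ (extChartAt (𝓡 D) q₀).source ∧
      extChartAt (𝓡 D) q₀ (ψ q') = θ (extChartAt (𝓡 D) q₀ q')) :
    formInChart I (pullback I (𝓡 D) (ψ ∘ Φ) B) p₀ (extChartAt I p₀ p) =
      pullbackForm (formInChart (𝓡 D) B q₀ (θ (mapInChart I Φ p₀ q₀ (extChartAt I p₀ p))))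
        ((fderiv ℝ θ (mapInChart I Φ p₀ q₀ (extChartAt I p₀ p))).comp
          (fderivWithin ℝ (mapInChart I Φ p₀ q₀) (range I) (extChartAt I p₀ p))) := by
  have hψd := mdifferentiableAt_of_chart hq hθ hψ
  have hmem : extChartAt I p₀ p ∈ range I :=
    extChartAt_target_subset_range p₀ ((extChartAt I p₀).map_source hp)
  have hud : UniqueDiffWithinAt ℝ (range I) (extChartAt I p₀ p) :=
    I.uniqueDiffOn.uniqueDiffWithinAt hmem
  rw [formInChart_pullback B hp hψ.self_of_nhds.1 (hψd.comp p hΦ)]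
  have hc : Filter.Tendsto (extChartAt I p₀).symm (𝓝[range I] (extChartAt I p₀ p)) (𝓝 p) := by
    have := (continuousAt_extChartAt_symm' (I := I) hp).tendsto
    rw [(extChartAt I p₀).left_inv hp] at this
    exact this.mono_left nhdsWithin_le_nhds
  have hev : mapInChart I (ψ ∘ Φ) p₀ q₀ =ᶠ[𝓝[range I] (extChartAt I p₀ p)]
      θ ∘ mapInChart I Φ p₀ q₀ := by
    filter_upwards [hc.eventually (hΦ.continuousAt.eventually hψ)] with u hu using hu.2
  have h1 := (hasFDerivWithinAt_mapInChart (Ψ := Φ) hp hq hΦ)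
  have hF0 : mapInChart I Φ p₀ q₀ (extChartAt I p₀ p) = extChartAt (𝓡 D) q₀ (Φ p) :=
    mapInChart_apply hp
  rw [← hF0] at hθ
  have h2 := (hθ.hasFDerivAt.comp_hasFDerivWithinAt _ h1).congr_of_eventuallyEq hev
    (hev.self_of_nhdsWithin hmem)
  rw [h2.fderivWithin hud, h1.fderivWithin hud, hev.self_of_nhdsWithin hmem]
  rfl

end PushedMap

section Density

open Metric

variable {d D : ℕ} {H : Type*} [TopologicalSpace H] {I : ModelWithCorners ℝ (𝔼 d) H}
  {S : Type*} [TopologicalSpace S] [ChartedSpace H S] [IsManifold I ∞ S]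
  {V : Type*} [TopologicalSpace V] [ChartedSpace (𝔼 D) V] [IsManifold (𝓡 D) ∞ V]
  {g : SemiRiemannianMetric (𝓡 D) V} {Φ : S → V}

theorem measurable_pullbackDensity {α : Type*} [MeasurableSpace α]
    {b : α → 𝔼 D →L[ℝ] 𝔼 D →L[ℝ] ℝ} {L : α → 𝔼 D →L[ℝ] 𝔼 D} {A : α → 𝔼 d →L[ℝ] 𝔼 D}
    (hb : Measurable b) (hL : Measurable L) (hA : Measurable A) :
    Measurable fun a => pullbackDensity (b a) ((L a).comp (A a)) := by
  have hAv : ∀ v k, Measurable fun a => (A a v) k := fun v k =>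
    (by fun_prop : Continuous fun l : 𝔼 d →L[ℝ] 𝔼 D => l v k).measurable.comp hA
  have hLv : ∀ v k, Measurable fun a => (L a v) k := fun v k =>
    (by fun_prop : Continuous fun l : 𝔼 D →L[ℝ] 𝔼 D => l v k).measurable.comp hL
  have hbv : ∀ k l, Measurable fun a => gram (b a) k l := fun k l =>
    (by simp only [gram, Matrix.of_apply]; fun_prop :
      Continuous fun b : 𝔼 D →L[ℝ] 𝔼 D →L[ℝ] ℝ => gram b k l).measurable.comp hb
  have hLA : ∀ v k, Measurable fun a => (L a (A a v)) k := fun v k => by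
    have h : (fun a => (L a (A a v)) k) = fun a => ∑ l, (A a v) l * (L a (stdVec l)) k := by
      funext a
      conv_lhs => rw [← sum_coord_smul_stdVec (A a v)]
      simp [map_sum, Finset.sum_apply]
    rw [h]
    exact Finset.measurable_fun_sum _ fun l _ => (hAv v l).mul (hLv _ k)
  have hent : ∀ v w, Measurable fun a => pullbackForm (b a) ((L a).comp (A a)) v w := fun v w => by
    have h : (fun a => pullbackForm (b a) ((L a).comp (A a)) v w) = fun a =>
        ∑ k, ∑ l, (L a (A a v)) k * gram (b a) k l * (L a (A a w)) l :=
      funext fun a => apply_eq_sum_gram (b a) (L a (A a v)) (L a (A a w))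
    rw [h]
    exact Finset.measurable_fun_sum _ fun k _ => Finset.measurable_fun_sum _ fun l _ =>
      ((hLA v k).mul (hbv k l)).mul (hLA w l)
  unfold pullbackDensity
  simp only [Matrix.det_apply']
  exact (measurable_norm.comp (Finset.measurable_fun_sum _ fun σ _ => measurable_const.mul
    (Finset.measurable_fun_prod _ fun i _ => hent _ _))).sqrt

theorem tendsto_extChartAt_nhdsWithin_range {p₀ p : S} (hp : p ∈ (extChartAt I p₀).source) :
    Filter.Tendsto (extChartAt I p₀) (𝓝 p) (𝓝[range I] (extChartAt I p₀ p)) :=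
  tendsto_nhdsWithin_iff.2 ⟨continuousAt_extChartAt' hp, by
    filter_upwards [extChartAt_source_mem_nhds' (I := I) hp] with q hq
    exact extChartAt_target_subset_range p₀ ((extChartAt I p₀).map_source hq)⟩

theorem chartDensity_pos (hnd : IsNondegenerate I (𝓡 D) g.inner Φ) {p₀ p : S}
    (hp : p ∈ (extChartAt I p₀).source) :
    0 < chartDensity I (pullback I (𝓡 D) Φ g.inner) p₀ p :=
  Real.sqrt_pos.2 (abs_pos.2 (isScalarProduct_formInChart_pullback hnd
    ((extChartAt I p₀).map_source hp)).det_ne_zero)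

theorem continuousWithinAt_mapInChart {p₀ p : S} {q₀ : V} (hΦ : ContMDiff I (𝓡 D) ∞ Φ)
    (hp : p ∈ (extChartAt I p₀).source) (hq : Φ p ∈ (extChartAt (𝓡 D) q₀).source) :
    ContinuousWithinAt (mapInChart (D := D) I Φ p₀ q₀) (range I) (extChartAt I p₀ p) :=
  (contDiffWithinAt_mapInChart hp hq (hΦ p)).continuousWithinAt

theorem continuousWithinAt_fderivWithin_mapInChart {p₀ p : S} {q₀ : V}
    (hΦ : ContMDiff I (𝓡 D) ∞ Φ) (hp : p ∈ (extChartAt I p₀).source)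
    (hq : Φ p ∈ (extChartAt (𝓡 D) q₀).source) :
    ContinuousWithinAt (fderivWithin ℝ (mapInChart (D := D) I Φ p₀ q₀) (range I)) (range I)
      (extChartAt I p₀ p) :=
  (contDiffWithinAt_fderivWithin_mapInChart hp hq (hΦ p)).continuousWithinAt

theorem SemiRiemannianMetric.contDiffAt_formInChart (g : SemiRiemannianMetric (𝓡 D) V) {q₀ : V}
    {z : 𝔼 D} (hz : z ∈ (extChartAt (𝓡 D) q₀).target) :
    ContDiffAt ℝ ∞ (formInChart (𝓡 D) g.inner q₀) z :=
  (g.contDiffOn_formInChart q₀).contDiffAt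
    ((isOpen_extChartAt_target (I := 𝓡 D) q₀).mem_nhds hz)

theorem continuousOn_chartDensity (hΦ : ContMDiff I (𝓡 D) ∞ Φ) (p₀ : S) :
    ContinuousOn (chartDensity I (pullback I (𝓡 D) Φ g.inner) p₀) (extChartAt I p₀).source := by
  intro p hp
  refine ContinuousAt.continuousWithinAt ?_
  have hq := mem_extChartAt_source (I := 𝓡 D) (Φ p)
  have hF0 : mapInChart I Φ p₀ (Φ p) (extChartAt I p₀ p) = extChartAt (𝓡 D) (Φ p) (Φ p) :=
    mapInChart_apply hp
  have hG : ContinuousAt (formInChart (𝓡 D) g.inner (Φ p))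
      (mapInChart (D := D) I Φ p₀ (Φ p) (extChartAt I p₀ p)) := by
    rw [hF0]
    exact (g.contDiffAt_formInChart (mem_extChartAt_target (Φ p))).continuousAt
  have h1 := continuousWithinAt_det_gram_pullbackForm
    (hG.comp_continuousWithinAt (continuousWithinAt_mapInChart hΦ hp hq))
    (continuousWithinAt_fderivWithin_mapInChart hΦ hp hq)
  have h2 := (h1.tendsto.comp (tendsto_extChartAt_nhdsWithin_range hp)).abs.sqrt
  have hev : chartDensity I (pullback I (𝓡 D) Φ g.inner) p₀ =ᶠ[𝓝 p] fun q =>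
      √|(gram (pullbackForm (formInChart (𝓡 D) g.inner (Φ p) (mapInChart (D := D) I Φ p₀ (Φ p)
        (extChartAt I p₀ q))) (fderivWithin ℝ (mapInChart (D := D) I Φ p₀ (Φ p)) (range I)
          (extChartAt I p₀ q)))).det| := by
    filter_upwards [extChartAt_source_mem_nhds' (I := I) hp,
      hΦ.continuous.continuousAt.eventually (extChartAt_source_mem_nhds (I := 𝓡 D) (Φ p))]
      with q hq1 hq2
    unfold chartDensity
    rw [formInChart_pullback g.inner hq1 hq2 ((hΦ q).mdifferentiableAt (by simp))]
  refine ContinuousAt.congr ?_ hev.symm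
  exact h2

variable [T2Space V] {ξ : (x : V) → TangentSpace (𝓡 D) x} {U : Set V} {W : Set (ℝ × V)}
  {φ : ℝ → V → V}

theorem IsLocalFlow.exists_chartDensity_bounds [MeasurableSpace S] [BorelSpace S]
    (hφ : IsLocalFlow (𝓡 D) ξ U W φ)
    (hΦ : ContMDiff I (𝓡 D) ∞ Φ) (hnd : IsNondegenerate I (𝓡 D) g.inner Φ)
    (hU : IsOpen U) (hΦU : range Φ ⊆ U)
    (hξ : ContMDiffOn (𝓡 D) (𝓡 D).tangent 1 (fun x => (⟨x, ξ x⟩ : TangentBundle (𝓡 D) V)) U)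
    (p₀ : S) :
    ∃ κ : S → ℝ, ContinuousAt κ p₀ ∧ κ p₀ = halfTraceLie I (𝓡 D) g.inner Φ ξ p₀ ∧
      ∃ δ > 0, ∃ C ≥ 0, ∃ N : Set S, IsOpen N ∧ p₀ ∈ N ∧ N ⊆ (extChartAt I p₀).source ∧
        (∀ p ∈ N, HasDerivAt (fun t => chartDensity I (pullback I (𝓡 D) (φ t ∘ Φ) g.inner) p₀ p)
          (κ p * chartDensity I (pullback I (𝓡 D) Φ g.inner) p₀ p) 0) ∧
        ∀ t, |t| < δ →
          (∀ p ∈ N, |chartDensity I (pullback I (𝓡 D) (φ t ∘ Φ) g.inner) p₀ p -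
            chartDensity I (pullback I (𝓡 D) Φ g.inner) p₀ p| ≤ C * |t|) ∧
          Measurable fun p : N => chartDensity I (pullback I (𝓡 D) (φ t ∘ Φ) g.inner) p₀ p := by
  have hpp := mem_extChartAt_source (I := I) p₀
  have hqq := mem_extChartAt_source (I := 𝓡 D) (Φ p₀)
  have hmd : ∀ q, MDifferentiableAt I (𝓡 D) Φ q := fun q => (hΦ q).mdifferentiableAt (by simp)
  set F : 𝔼 d → 𝔼 D := mapInChart I Φ p₀ (Φ p₀) with hF
  set A := fderivWithin ℝ F (range I) with hA
  set G := formInChart (𝓡 D) g.inner (Φ p₀) with hG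
  set f := fieldInChart (𝓡 D) ξ (Φ p₀) with hf
  set θ : ℝ → 𝔼 D → 𝔼 D := flowInChart φ (Φ p₀) with hθ
  set y := extChartAt I p₀ with hy
  set x := extChartAt (𝓡 D) (Φ p₀) with hx
  have hF0 : F (y p₀) = x (Φ p₀) := mapInChart_apply hpp
  have hΦ₀ : Φ p₀ ∈ U := hΦU (mem_range_self _)
  have hGs : ContDiffAt ℝ 1 G (F (y p₀)) := by
    rw [hF0]
    exact (g.contDiffAt_formInChart (mem_extChartAt_target _)).of_le (by simp)
  have hfs : ContDiffAt ℝ 1 f (F (y p₀)) := by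
    rw [hF0]
    have := contDiffWithinAt_fieldInChart (n := 1) hqq (hξ.contMDiffAt (hU.mem_nhds hΦ₀))
    rwa [ModelWithCorners.range_eq_univ, contDiffWithinAt_univ] at this
  have hFc := continuousWithinAt_mapInChart (I := I) (D := D) hΦ hpp hqq
  have hAc := continuousWithinAt_fderivWithin_mapInChart hΦ hpp hqq
  have hdet : (gram (pullbackForm (G (F (y p₀))) (A (y p₀)))).det ≠ 0 := by
    have := (isScalarProduct_formInChart_pullback (g := g) hnd
      (mem_extChartAt_target (I := I) p₀)).det_ne_zero
    rwa [formInChart_pullback g.inner hpp hqq (hmd p₀)] at this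
  have hflow : IsFlowNear f θ (F (y p₀)) := by
    rw [hF0]; exact hφ.isFlowNear hU hξ hΦ₀
  obtain ⟨δ₁, hδ₁, C, hC, hev⟩ := hflow.exists_density_bounds hFc hAc (mem_range_self _) hGs
    (formInChart_symm g _) hdet hfs
  obtain ⟨δ₂, hδ₂, hchart⟩ := hφ.exists_mem_chart_ball hU hξ hΦ₀ one_pos
  set δ := min δ₁ δ₂ with hδ
  have hδ0 : 0 < δ := lt_min hδ₁ hδ₂
  have hy0 := tendsto_extChartAt_nhdsWithin_range hpp
  have hκc := continuousWithinAt_metricTrace_variationForm hFc hAc hGs hdet hfs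
  have hΦc : ∀ᶠ p in 𝓝 p₀, Φ p ∈ x.source ∧ x (Φ p) ∈ ball (x (Φ p₀)) δ := by
    have h5 : ∀ᶠ q in 𝓝 (Φ p₀), q ∈ x.source ∧ x q ∈ ball (x (Φ p₀)) δ :=
      Filter.Eventually.and (extChartAt_source_mem_nhds (I := 𝓡 D) (Φ p₀))
        ((continuousAt_extChartAt (I := 𝓡 D) (Φ p₀)).eventually (ball_mem_nhds _ hδ0))
    exact (hΦ.continuous.continuousAt (x := p₀)).eventually h5
  obtain ⟨N, hN, hNo, hpN⟩ := _root_.eventually_nhds_iff.1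
    (Filter.Eventually.and (extChartAt_source_mem_nhds (I := I) p₀) (hΦc.and (hy0.eventually hev)))
  -- the density of the moved submanifold in the charts
  have hform : ∀ p ∈ N, ∀ t, |t| < δ →
      chartDensity I (pullback I (𝓡 D) (φ t ∘ Φ) g.inner) p₀ p =
        pullbackDensity (G (θ t (F (y p)))) ((fderiv ℝ (θ t) (F (y p))).comp (A (y p))) := by
    intro p hp t ht
    obtain ⟨h1, ⟨h2, h3⟩, h4⟩ := hN p hp
    have h3' : x (Φ p) ∈ ball (F (y p₀)) δ₁ := by
      rw [hF0]
      exact ball_subset_ball (min_le_left _ _) h3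
    have := formInChart_pullback_comp (p₀ := p₀) (q₀ := Φ p₀) (ψ := φ t) (θ := θ t) g.inner h1 h2
      (hmd p) ((h4.2.2 t (ht.trans_le (min_le_left _ _))).2 _ h3').1
      (by
        have h5 : ∀ᶠ q' in 𝓝 (Φ p), q' ∈ x.source ∧ x q' ∈ ball (x (Φ p₀)) δ :=
          Filter.Eventually.and (extChartAt_source_mem_nhds' (I := 𝓡 D) h2)
            ((continuousAt_extChartAt' (I := 𝓡 D) h2).eventually (isOpen_ball.mem_nhds h3))
        filter_upwards [h5] with q' hq'
        have h6 := (hchart (x q') (ball_subset_ball (min_le_right _ _) hq'.2)).2 t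
          (abs_lt.1 (ht.trans_le (min_le_right _ _)))
        rw [x.left_inv hq'.1] at h6
        refine ⟨h6.2.1, ?_⟩
        simp only [hθ, flowInChart]
        rw [← hx, x.left_inv hq'.1])
    exact congrArg (fun β => √|(gram β).det|) this
  have hform0 : ∀ p ∈ N, chartDensity I (pullback I (𝓡 D) Φ g.inner) p₀ p =
      pullbackDensity (G (F (y p))) (A (y p)) := fun p hp => by
    obtain ⟨h1, ⟨h2, h3⟩, h4⟩ := hN p hp
    exact congrArg (fun β => √|(gram β).det|) (formInChart_pullback g.inner h1 h2 (hmd p))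
  refine ⟨fun p => 1 / 2 * metricTrace (pullbackForm (G (F (y p))) (A (y p)))
        (variationForm G f (F (y p)) (A (y p))), hκc.tendsto.comp hy0, ?_, δ, hδ0, C, hC, N, hNo,
        hpN, fun p hp => (hN p hp).1, fun p hp => ?_, fun t ht => ⟨fun p hp => ?_, ?_⟩⟩
  · have hA0 : ∀ v : 𝔼 d, A (y p₀) v = mfderiv I (𝓡 D) Φ p₀ v := fun v => by
      refine (fderivWithin_mapInChart hpp hqq (hmd p₀) v).trans ?_
      rw [fromChart_self]
      exact toChart_self _
    have e1 : pullbackForm (G (F (y p₀))) (A (y p₀)) = pullback I (𝓡 D) Φ g.inner p₀ := by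
      rw [← formInChart_self (pullback I (𝓡 D) Φ g.inner) p₀,
        formInChart_pullback g.inner hpp hqq (hmd p₀)]
    unfold halfTraceLie
    refine congrArg (1 / 2 * ·) ?_
    simp only [e1]
    refine congrArg (metricTrace _) ?_
    funext v w
    have hb' : HasFDerivWithinAt G (fderiv ℝ G (F (y p₀))) (range (𝓡 D)) (x (Φ p₀)) := by
      rw [← hF0]
      exact (hGs.differentiableAt (by simp)).hasFDerivAt.hasFDerivWithinAt
    have hf' : HasFDerivWithinAt f (fderiv ℝ f (F (y p₀))) (range (𝓡 D)) (x (Φ p₀)) := by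
      rw [← hF0]
      exact (hfs.differentiableAt (by simp)).hasFDerivAt.hasFDerivWithinAt
    refine Eq.trans ?_ (lieDerivative_eq hb' hf' (mfderiv I (𝓡 D) Φ p₀ v)
      (mfderiv I (𝓡 D) Φ p₀ w)).symm
    unfold variationForm
    rw [hA0, hA0, hF0]
    have e2 : G (x (Φ p₀)) = g.inner (Φ p₀) := formInChart_self _ _
    have e3 : f (x (Φ p₀)) = ξ (Φ p₀) := fieldInChart_self _
    rw [e2, e3]
    rfl
  · rw [hform0 p hp]
    refine ((hN p hp).2.2.2.1).congr_of_eventuallyEq ?_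
    filter_upwards [Metric.ball_mem_nhds (0 : ℝ) hδ0] with t ht
    exact hform p hp t (by simpa using ht)
  · rw [hform p hp t ht, hform0 p hp]
    exact ((hN p hp).2.2.2.2 t (ht.trans_le (min_le_left _ _))).1
  · have e : (fun p : N => chartDensity I (pullback I (𝓡 D) (φ t ∘ Φ) g.inner) p₀ p) =
        fun p : N => pullbackDensity (G (θ t (F (y p))))
          ((fderiv ℝ (θ t) (F (y p))).comp (A (y p))) := funext fun p => hform p p.2 t ht
    rw [e]
    have hyc : ∀ p : N, Filter.Tendsto (fun p : N => y p) (𝓝 p) (𝓝[range I] (y p)) := fun p =>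
      (tendsto_extChartAt_nhdsWithin_range (hN p p.2).1).comp continuousAt_subtype_val
    have hFN : Continuous fun p : N => F (y p) := continuous_iff_continuousAt.2 fun p =>
      (continuousWithinAt_mapInChart hΦ (hN p p.2).1 (hN p p.2).2.1.1).tendsto.comp (hyc p)
    have hAN : Continuous fun p : N => A (y p) := continuous_iff_continuousAt.2 fun p =>
      (continuousWithinAt_fderivWithin_mapInChart hΦ (hN p p.2).1 (hN p p.2).2.1.1).tendsto.comp
        (hyc p)
    have hGN : Continuous fun p : N => G (θ t (F (y p))) := continuous_iff_continuousAt.2 fun p => by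
      have h1 := (hN p p.2).2.2.2.2 t (ht.trans_le (min_le_left _ _))
      have h2 := h1.2 (F (y p)) (hN p p.2).2.2.1
      have h3 : ContinuousAt (fun z => G (θ t z)) (F (y p)) :=
        ContinuousAt.comp (g := G) h2.2 h2.1.continuousAt
      exact h3.comp (f := fun p : N => F (y p)) hFN.continuousAt
    have hDm : Measurable fun p : N => fderiv ℝ (θ t) (F (y p)) :=
      (measurable_fderiv ℝ (θ t)).comp hFN.measurable
    exact measurable_pullbackDensity hGN.measurable hDm hAN.measurable

end Density

section Integral

variable {α : Type*} [MeasurableSpace α] {μ : Measure α} [IsFiniteMeasure μ] {h : ℝ → α → ℝ}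
  {h' : α → ℝ} {δ C B : ℝ}

theorem integrable_of_bounds (hmeas : ∀ t, |t| < δ → AEStronglyMeasurable (h t) μ)
    (h0 : ∀ᵐ a ∂μ, |h 0 a| ≤ B)
    (hb : ∀ᵐ a ∂μ, ∀ t, |t| < δ → |h t a - h 0 a| ≤ C * |t|) {t : ℝ} (ht : |t| < δ) :
    Integrable (h t) μ := by
  refine Integrable.of_bound (hmeas t ht) (C * |t| + B) ?_
  filter_upwards [h0, hb] with a ha hba
  calc ‖h t a‖ = |(h t a - h 0 a) + h 0 a| := by rw [Real.norm_eq_abs]; congr 1; ring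
    _ ≤ _ := (abs_add_le _ _).trans (add_le_add (hba t ht) ha)

theorem hasDerivAt_integral_of_bounds (hδ : 0 < δ)
    (hmeas : ∀ t, |t| < δ → AEStronglyMeasurable (h t) μ)
    (h0 : ∀ᵐ a ∂μ, |h 0 a| ≤ B)
    (hb : ∀ᵐ a ∂μ, ∀ t, |t| < δ → |h t a - h 0 a| ≤ C * |t|)
    (hm' : AEStronglyMeasurable h' μ) (hd : ∀ᵐ a ∂μ, HasDerivAt (fun t => h t a) (h' a) 0) :
    HasDerivAt (fun t => ∫ a, h t a ∂μ) (∫ a, h' a ∂μ) 0 := by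
  have h1 := (hasFDerivAt_integral_of_dominated_loc_of_lip' (𝕜 := ℝ) (F := h) (x₀ := (0 : ℝ))
    (bound := fun _ => C) (s := Metric.ball 0 δ) (F' := fun a => h' a • (1 : ℝ →L[ℝ] ℝ))
    (Metric.ball_mem_nhds _ hδ) (fun t ht => hmeas t (by simpa using ht))
    (integrable_of_bounds hmeas h0 hb (by simpa using hδ)) (hm'.smul_const _)
    (by
      filter_upwards [hb] with a ha t ht
      simpa using ha t (by simpa using ht))
    (integrable_const C)
    (by
      filter_upwards [hd] with a ha
      refine ha.hasFDerivAt.congr_fderiv ?_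
      ext
      simp)).2
  rw [integral_smul_const] at h1
  refine h1.hasDerivAt.congr_deriv ?_
  simp

end Integral

section Variation

variable {d D : ℕ} {H : Type*} [TopologicalSpace H] {I : ModelWithCorners ℝ (𝔼 d) H}
  {S : Type*} [TopologicalSpace S] [ChartedSpace H S] [IsManifold I ∞ S]
  {V : Type*} [TopologicalSpace V] [ChartedSpace (𝔼 D) V] [IsManifold (𝓡 D) ∞ V]
  {g : SemiRiemannianMetric (𝓡 D) V} {Φ : S → V}
  [T2Space V] {ξ : (x : V) → TangentSpace (𝓡 D) x} {U : Set V} {W : Set (ℝ × V)}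
  {φ : ℝ → V → V} [MeasurableSpace S] [BorelSpace S]

theorem IsLocalFlow.hasDerivAt_volumeElement (hφ : IsLocalFlow (𝓡 D) ξ U W φ)
    (hΦ : ContMDiff I (𝓡 D) ∞ Φ) (hnd : IsNondegenerate I (𝓡 D) g.inner Φ)
    (hU : IsOpen U) (hΦU : range Φ ⊆ U)
    (hξ : ContMDiffOn (𝓡 D) (𝓡 D).tangent 1 (fun x => (⟨x, ξ x⟩ : TangentBundle (𝓡 D) V)) U)
    (p : S) (v : Fin d → TangentSpace I p) :
    HasDerivAt (fun τ => volumeElement I (pullback I (𝓡 D) (φ τ ∘ Φ) g.inner) p v)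
      (halfTraceLie I (𝓡 D) g.inner Φ ξ p *
        volumeElement I (pullback I (𝓡 D) Φ g.inner) p v) 0 := by
  obtain ⟨κ, -, hκ, -, -, -, -, N, -, hpN, -, hd, -⟩ :=
    hφ.exists_chartDensity_bounds hΦ hnd hU hΦU hξ p
  have h1 := (hd p hpN).const_mul |chartDet I p p v|
  have hp := mem_extChartAt_source (I := I) p
  have e : ∀ B : BilinField I S, volumeElement I B p v = |chartDet I p p v| *
    chartDensity I B p p := fun B => volumeElement_eq B hp v
  simp only [e]
  refine h1.congr_deriv ?_
  rw [hκ]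
  ring

theorem IsLocalFlow.continuous_halfTraceLie (hφ : IsLocalFlow (𝓡 D) ξ U W φ)
    (hΦ : ContMDiff I (𝓡 D) ∞ Φ) (hnd : IsNondegenerate I (𝓡 D) g.inner Φ)
    (hU : IsOpen U) (hΦU : range Φ ⊆ U)
    (hξ : ContMDiffOn (𝓡 D) (𝓡 D).tangent 1 (fun x => (⟨x, ξ x⟩ : TangentBundle (𝓡 D) V)) U) :
    Continuous (halfTraceLie I (𝓡 D) g.inner Φ ξ) := by
  refine continuous_iff_continuousAt.2 fun p₀ => ?_
  obtain ⟨κ, hκc, -, -, -, -, -, N, hNo, hpN, hNs, hd, -⟩ :=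
    hφ.exists_chartDensity_bounds hΦ hnd hU hΦU hξ p₀
  refine hκc.congr ?_
  filter_upwards [hNo.mem_nhds hpN] with p hp
  have h1 := hφ.hasDerivAt_volumeElement hΦ hnd hU hΦU hξ p
    (fun i => fromChart I p₀ p (stdVec i))
  have e : ∀ B : BilinField I S, volumeElement I B p (fun i => fromChart I p₀ p (stdVec i)) =
    chartDensity I B p₀ p := fun B => (chartDensity_eq_volumeElement B (hNs hp)).symm
  simp only [e] at h1
  exact mul_right_cancel₀ (chartDensity_pos hnd (hNs hp)).ne' ((hd p hp).unique h1)

theorem continuousOn_chartDet (p₀ c : S) : ContinuousOn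
    (fun p => chartDet I p₀ p fun i => coordExt I c (stdVec i) p)
    ((extChartAt I p₀).source ∩ (extChartAt I c).source) := by
  have h1 : ∀ v : 𝔼 d, ContinuousOn (fun p => toChart I p₀ p (coordExt I c v p))
      ((extChartAt I p₀).source ∩ (extChartAt I c).source) := fun v p hp => by
    have h2 := (contMDiffOn_coordExt (I := I) c v).contMDiffAt
      ((isOpen_extChartAt_source (I := I) c).mem_nhds hp.2)
    have h3 := ((trivializationAt (𝔼 d) (TangentSpace I : S → Type _) p₀).contMDiffAt_section_iff
      (IB := I) (n := ∞) (s := fun q => coordExt I c v q) (mem_baseSet_of_mem_source hp.1)).1 h2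
    refine (h3.continuousAt.congr ?_).continuousWithinAt
    filter_upwards [extChartAt_source_mem_nhds' (I := I) hp.1] with q hq
    exact trivializationAt_snd_eq_toChart hq _
  unfold chartDet
  simp only [Matrix.det_apply']
  refine continuousOn_finsetSum _ fun σ _ => continuousOn_const.mul
    (continuousOn_finsetProd _ fun i _ => ?_)
  exact (EuclideanSpace.proj (𝕜 := ℝ) i).continuous.comp_continuousOn (h1 _)

theorem IsLocalFlow.exists_volumeElement_bounds (hφ : IsLocalFlow (𝓡 D) ξ U W φ)
    (hΦ : ContMDiff I (𝓡 D) ∞ Φ) (hnd : IsNondegenerate I (𝓡 D) g.inner Φ)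
    (hU : IsOpen U) (hΦU : range Φ ⊆ U)
    (hξ : ContMDiffOn (𝓡 D) (𝓡 D).tangent 1 (fun x => (⟨x, ξ x⟩ : TangentBundle (𝓡 D) V)) U)
    (c : S) (μ : Measure S) {L : Set S} (hL : IsCompact L) (hLc : L ⊆ (extChartAt I c).source) :
    ∃ δ > 0, ∃ C ≥ 0, ∃ B, ∀ t, |t| < δ →
      (∀ p ∈ L, |volumeElement I (pullback I (𝓡 D) Φ g.inner) p
        fun i => coordExt I c (stdVec i) p| ≤ B) ∧
      (∀ p ∈ L, |(volumeElement I (pullback I (𝓡 D) (φ t ∘ Φ) g.inner) p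
          fun i => coordExt I c (stdVec i) p) - volumeElement I (pullback I (𝓡 D) Φ g.inner) p
          fun i => coordExt I c (stdVec i) p| ≤ C * |t|) ∧
      AEMeasurable (fun p => volumeElement I (pullback I (𝓡 D) (φ t ∘ Φ) g.inner) p
        fun i => coordExt I c (stdVec i) p) (μ.restrict L) := by
  refine hL.induction_on ?_ ?_ ?_ ?_
  · exact ⟨1, one_pos, 0, le_rfl, 0, fun t _ => ⟨by simp, by simp, by simp⟩⟩
  · rintro s t hst ⟨δ, hδ, C, hC, B, h⟩
    exact ⟨δ, hδ, C, hC, B, fun τ hτ => ⟨fun p hp => (h τ hτ).1 p (hst hp),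
      fun p hp => (h τ hτ).2.1 p (hst hp),
      (h τ hτ).2.2.mono_measure (Measure.restrict_mono hst le_rfl)⟩⟩
  · rintro s t ⟨δ, hδ, C, hC, B, h⟩ ⟨δ', hδ', C', hC', B', h'⟩
    refine ⟨min δ δ', lt_min hδ hδ', max C C', le_max_of_le_left hC, max B B', fun τ hτ => ?_⟩
    have h1 := h τ (hτ.trans_le (min_le_left _ _))
    have h2 := h' τ (hτ.trans_le (min_le_right _ _))
    refine ⟨?_, ?_, aemeasurable_union_iff.2 ⟨h1.2.2, h2.2.2⟩⟩
    · rintro p (hp | hp)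
      · exact (h1.1 p hp).trans (le_max_left _ _)
      · exact (h2.1 p hp).trans (le_max_right _ _)
    · rintro p (hp | hp)
      · exact (h1.2.1 p hp).trans (by gcongr; exact le_max_left _ _)
      · exact (h2.2.1 p hp).trans (by gcongr; exact le_max_right _ _)
  · intro p₀ hp₀
    obtain ⟨-, -, -, δ, hδ, C, hC, N, hNo, hpN, hNs, -, hb⟩ :=
      hφ.exists_chartDensity_bounds hΦ hnd hU hΦU hξ p₀
    have hpc := hLc hp₀
    have hpp := mem_extChartAt_source (I := I) p₀
    have hopen : IsOpen ((extChartAt I p₀).source ∩ (extChartAt I c).source) :=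
      (isOpen_extChartAt_source (I := I) p₀).inter (isOpen_extChartAt_source (I := I) c)
    have hcd := continuousOn_chartDet (I := I) p₀ c
    have hden := continuousOn_chartDensity (g := g) hΦ p₀
    set w := fun p => chartDet I p₀ p fun i => coordExt I c (stdVec i) p with hw
    set k := chartDensity I (pullback I (𝓡 D) Φ g.inner) p₀ with hk
    have hcdA : ContinuousAt w p₀ := hcd.continuousAt (hopen.mem_nhds ⟨hpp, hpc⟩)
    have hdenA : ContinuousAt k p₀ :=
      hden.continuousAt ((isOpen_extChartAt_source (I := I) p₀).mem_nhds hpp)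
    have hev : ∀ᶠ p in 𝓝 p₀, p ∈ N ∧ p ∈ (extChartAt I c).source ∧ |w p| < |w p₀| + 1 ∧
        |k p| < |k p₀| + 1 := by
      filter_upwards [hNo.mem_nhds hpN, extChartAt_source_mem_nhds' (I := I) hpc,
        hcdA.abs.eventually_lt continuousAt_const (lt_add_one _),
        hdenA.abs.eventually_lt continuousAt_const (lt_add_one _)] with p h1 h2 h3 h4
        using ⟨h1, h2, h3, h4⟩
    obtain ⟨N', hN', hN'o, hpN'⟩ := _root_.eventually_nhds_iff.1 hev
    have hN'N : N' ⊆ N := fun p hp => (hN' p hp).1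
    have e : ∀ B : BilinField I S, ∀ p ∈ N', (volumeElement I B p
        fun i => coordExt I c (stdVec i) p) = |w p| * chartDensity I B p₀ p := fun B p hp =>
      volumeElement_eq B (hNs (hN'N hp)) _
    refine ⟨N', mem_nhdsWithin_of_mem_nhds (hN'o.mem_nhds hpN'), δ, hδ, (|w p₀| + 1) * C,
      by positivity, (|w p₀| + 1) * (|k p₀| + 1), fun t ht => ⟨fun p hp => ?_, fun p hp => ?_, ?_⟩⟩
    · rw [e _ p hp, abs_mul, abs_abs]
      exact mul_le_mul (hN' p hp).2.2.1.le (hN' p hp).2.2.2.le (abs_nonneg _) (by positivity)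
    · rw [e _ p hp, e _ p hp, ← mul_sub, abs_mul, abs_abs, mul_assoc]
      exact mul_le_mul (hN' p hp).2.2.1.le ((hb t ht).1 p (hN'N hp)) (abs_nonneg _) (by positivity)
    · refine aemeasurable_restrict_of_measurable_subtype hN'o.measurableSet ?_
      have e2 : (fun p : N' => volumeElement I (pullback I (𝓡 D) (φ t ∘ Φ) g.inner) p
          fun i => coordExt I c (stdVec i) p) = fun p : N' => |w p| *
          chartDensity I (pullback I (𝓡 D) (φ t ∘ Φ) g.inner) p₀ p := funext fun p => e _ p p.2
      rw [e2]
      refine Measurable.mul ?_ ?_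
      · have h1 : Continuous fun p : N' => |w p| := by
          refine continuousOn_iff_continuous_domRestrict.1 (hcd.abs.mono fun p hp => ?_)
          exact ⟨hNs (hN'N hp), (hN' p hp).2.1⟩
        exact h1.measurable
      · have h2 : Measurable ((fun p : N =>
            chartDensity I (pullback I (𝓡 D) (φ t ∘ Φ) g.inner) p₀ p) ∘ inclusion hN'N) :=
          (hb t ht).2.comp (measurable_inclusion hN'N)
        exact h2

end Variation

section VolumeMeasure

variable {d : ℕ} {H : Type*} [TopologicalSpace H] {I : ModelWithCorners ℝ (𝔼 d) H}
  {S : Type*} [TopologicalSpace S] [ChartedSpace H S] [IsManifold I ∞ S]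
  [T2Space S] [SigmaCompactSpace S] [MeasurableSpace S] [BorelSpace S]

theorem measurableSet_extChartAt_target (c : S) : MeasurableSet (extChartAt I c).target := by
  rw [extChartAt_target]
  exact ((chartAt H c).open_target.preimage I.continuous_symm).measurableSet.inter
    I.isClosed_range.measurableSet

variable (I) in
/-- Lebesgue measure in the preferred chart at `c`. -/
def chartMeasure (c : S) : Measure S :=
  ((volume : Measure (𝔼 d)).restrict (extChartAt I c).target).map (extChartAt I c).symm

theorem aemeasurable_extChartAt_symm (c : S) : AEMeasurable (extChartAt I c).symm
    ((volume : Measure (𝔼 d)).restrict (extChartAt I c).target) :=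
  (continuousOn_extChartAt_symm (I := I) c).aemeasurable (measurableSet_extChartAt_target c)

theorem chartMeasure_lt_top {c : S} {L : Set S} (hL : IsCompact L)
    (hLc : L ⊆ (extChartAt I c).source) : chartMeasure I c L < ⊤ := by
  rw [chartMeasure, Measure.map_apply_of_aemeasurable (aemeasurable_extChartAt_symm c)
    hL.measurableSet, Measure.restrict_apply' (measurableSet_extChartAt_target c)]
  refine lt_of_le_of_lt (measure_mono ?_)
    (hL.image_of_continuousOn ((continuousOn_extChartAt (I := I) c).mono hLc)).measure_lt_top
  rintro u ⟨hu1, hu2⟩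
  exact ⟨_, hu1, (extChartAt I c).right_inv hu2⟩

theorem volumeMeasure_eq_sum (B : BilinField I S) : volumeMeasure I B =
    Measure.sum fun c : S => (chartMeasure I c).withDensity fun p => ENNReal.ofReal
      (chartPartition I S c p * volumeElement I B p fun i => coordExt I c (stdVec i) p) := rfl

theorem tsupport_chartPartition_subset (c : S) :
    tsupport (chartPartition I S c) ⊆ (extChartAt I c).source := by
  rw [extChartAt_source]
  exact (SmoothPartitionOfUnity.exists_isSubordinate_chartAt_source I S).choose_spec c

theorem exists_finset_chartPartition {K : Set S} (hK : IsCompact K) :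
    ∃ T : Finset S, ∀ c ∉ T, ∀ p ∈ K, chartPartition I S c p = 0 := by
  have h := (chartPartition I S).locallyFinite.finite_nonempty_inter_compact hK
  refine ⟨h.toFinset, fun c hc p hp => ?_⟩
  by_contra h0
  exact hc (h.mem_toFinset.2 ⟨p, h0, hp⟩)

variable (I) in
/-- The weight of the volume measure of `B` with respect to the chart measure at `c`. -/
def volumeWeight (B : BilinField I S) (c p : S) : ℝ :=
  chartPartition I S c p * volumeElement I B p fun i => coordExt I c (stdVec i) p

theorem volumeWeight_nonneg (B : BilinField I S) (c p : S) : 0 ≤ volumeWeight I B c p :=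
  mul_nonneg ((chartPartition I S).nonneg c p) (Real.sqrt_nonneg _)

theorem volumeMeasure_apply_eq_sum (B : BilinField I S) {K : Set S} (hK : IsCompact K)
    {T : Finset S} (hT : ∀ c ∉ T, ∀ p ∈ K, chartPartition I S c p = 0)
    (hint : ∀ c ∈ T, IntegrableOn (volumeWeight I B c) K (chartMeasure I c)) :
    volumeMeasure I B K =
      ∑ c ∈ T, ENNReal.ofReal (∫ p in K, volumeWeight I B c p ∂chartMeasure I c) := by
  rw [volumeMeasure_eq_sum, Measure.sum_apply _ hK.measurableSet, tsum_eq_sum (s := T)]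
  · refine Finset.sum_congr rfl fun c hc => ?_
    rw [withDensity_apply _ hK.measurableSet, ofReal_integral_eq_lintegral_ofReal (hint c hc)
      (Filter.Eventually.of_forall (volumeWeight_nonneg B c))]
    rfl
  · intro c hc
    rw [withDensity_apply _ hK.measurableSet]
    refine (setLIntegral_congr_fun hK.measurableSet fun p hp => ?_).trans lintegral_zero
    simp [hT c hc p hp]

theorem volumeMeasure_real_eq_sum (B : BilinField I S) {K : Set S} (hK : IsCompact K)
    {T : Finset S} (hT : ∀ c ∉ T, ∀ p ∈ K, chartPartition I S c p = 0)
    (hint : ∀ c ∈ T, IntegrableOn (volumeWeight I B c) K (chartMeasure I c)) :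
    (volumeMeasure I B).real K = ∑ c ∈ T, ∫ p in K, volumeWeight I B c p ∂chartMeasure I c := by
  rw [measureReal_def, volumeMeasure_apply_eq_sum B hK hT hint,
    ENNReal.toReal_sum fun _ _ => ENNReal.ofReal_ne_top]
  refine Finset.sum_congr rfl fun c _ => ENNReal.toReal_ofReal ?_
  exact integral_nonneg fun p => volumeWeight_nonneg B c p

theorem setIntegral_volumeMeasure_eq_sum (B : BilinField I S) {K : Set S} (hK : IsCompact K)
    {T : Finset S} (hT : ∀ c ∉ T, ∀ p ∈ K, chartPartition I S c p = 0)
    (hint : ∀ c ∈ T, IntegrableOn (volumeWeight I B c) K (chartMeasure I c)) {f : S → ℝ}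
    (hf : IntegrableOn f K (volumeMeasure I B)) :
    ∫ p in K, f p ∂volumeMeasure I B =
      ∑ c ∈ T, ∫ p in K, volumeWeight I B c p * f p ∂chartMeasure I c := by
  have h1 : (volumeMeasure I B).restrict K = Measure.sum fun c : S =>
      ((chartMeasure I c).withDensity fun p => ENNReal.ofReal (volumeWeight I B c p)).restrict K :=
    Measure.restrict_sum _ hK.measurableSet
  rw [IntegrableOn, h1] at hf
  rw [h1, ← (hasSum_integral_measure hf).tsum_eq, tsum_eq_sum (s := T)]
  · refine Finset.sum_congr rfl fun c hc => ?_
    refine (setIntegral_withDensity_eq_setIntegral_smul₀ (f := fun p =>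
      Real.toNNReal (volumeWeight I B c p)) (hint c hc).aemeasurable.real_toNNReal f
      hK.measurableSet).trans ?_
    refine setIntegral_congr_fun hK.measurableSet fun p _ => ?_
    simp only [NNReal.smul_def, Real.coe_toNNReal _ (volumeWeight_nonneg B c p), smul_eq_mul]
  · intro c hc
    have h2 : ((chartMeasure I c).withDensity fun p =>
        ENNReal.ofReal (volumeWeight I B c p)).restrict K = 0 := by
      rw [Measure.restrict_eq_zero, withDensity_apply _ hK.measurableSet]
      refine (setLIntegral_congr_fun hK.measurableSet fun p hp => ?_).trans lintegral_zero
      simp [volumeWeight, hT c hc p hp]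
    rw [h2, integral_zero_measure]

end VolumeMeasure

section Variation

variable {d D : ℕ} {H : Type*} [TopologicalSpace H] {I : ModelWithCorners ℝ (𝔼 d) H}
  {S : Type*} [TopologicalSpace S] [ChartedSpace H S] [IsManifold I ∞ S]
  {V : Type*} [TopologicalSpace V] [ChartedSpace (𝔼 D) V] [IsManifold (𝓡 D) ∞ V]
  {g : SemiRiemannianMetric (𝓡 D) V} {Φ : S → V}
  [T2Space V] {ξ : (x : V) → TangentSpace (𝓡 D) x} {U : Set V} {W : Set (ℝ × V)}
  {φ : ℝ → V → V} [MeasurableSpace S] [BorelSpace S] [T2Space S] [SigmaCompactSpace S]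

theorem IsLocalFlow.zero_comp (hφ : IsLocalFlow (𝓡 D) ξ U W φ) (hΦU : range Φ ⊆ U) :
    φ 0 ∘ Φ = Φ := funext fun p => hφ.init _ (hΦU (mem_range_self p))

theorem IsLocalFlow.hasDerivAt_setIntegral_volumeWeight (hφ : IsLocalFlow (𝓡 D) ξ U W φ)
    (hΦ : ContMDiff I (𝓡 D) ∞ Φ) (hnd : IsNondegenerate I (𝓡 D) g.inner Φ)
    (hU : IsOpen U) (hΦU : range Φ ⊆ U)
    (hξ : ContMDiffOn (𝓡 D) (𝓡 D).tangent 1 (fun x => (⟨x, ξ x⟩ : TangentBundle (𝓡 D) V)) U)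
    (c : S) {K : Set S} (hK : IsCompact K) :
    ∃ δ > 0, (∀ t, |t| < δ → IntegrableOn
      (volumeWeight I (pullback I (𝓡 D) (φ t ∘ Φ) g.inner) c) K (chartMeasure I c)) ∧
      HasDerivAt (fun t => ∫ p in K, volumeWeight I (pullback I (𝓡 D) (φ t ∘ Φ) g.inner) c p
          ∂chartMeasure I c)
        (∫ p in K, volumeWeight I (pullback I (𝓡 D) Φ g.inner) c p *
          halfTraceLie I (𝓡 D) g.inner Φ ξ p ∂chartMeasure I c) 0 := by
  set ρ : S → ℝ := ⇑(chartPartition I S c) with hρ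
  have hρc : Continuous ρ := (chartPartition I S c).contMDiff.continuous
  set L := K ∩ tsupport ρ with hL
  have hLk : IsCompact L := hK.inter_right (isClosed_tsupport _)
  have hLc : L ⊆ (extChartAt I c).source :=
    inter_subset_right.trans (tsupport_chartPartition_subset c)
  have hzero : ∀ p ∈ K \ L, ρ p = 0 := fun p hp => by
    by_contra h
    exact hp.2 ⟨hp.1, subset_tsupport _ h⟩
  obtain ⟨δ, hδ, C, hC, B, hb⟩ :=
    hφ.exists_volumeElement_bounds hΦ hnd hU hΦU hξ c (chartMeasure I c) hLk hLc
  have : IsFiniteMeasure ((chartMeasure I c).restrict L) :=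
    ⟨by rw [Measure.restrict_apply_univ]; exact chartMeasure_lt_top hLk hLc⟩
  have hρ1 : ∀ p, |ρ p| ≤ 1 := fun p => by
    rw [abs_of_nonneg ((chartPartition I S).nonneg c p)]
    exact (chartPartition I S).le_one c p
  have h00 : |(0 : ℝ)| < δ := by simpa using hδ
  have e0 : pullback I (𝓡 D) (φ 0 ∘ Φ) g.inner = pullback I (𝓡 D) Φ g.inner := by
    rw [hφ.zero_comp hΦU]
  have hmeas : ∀ t, |t| < δ → AEStronglyMeasurable
      (volumeWeight I (pullback I (𝓡 D) (φ t ∘ Φ) g.inner) c) ((chartMeasure I c).restrict L) :=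
    fun t ht => (hρc.measurable.aemeasurable.mul (hb t ht).2.2).aestronglyMeasurable
  have hbd0 : ∀ᵐ p ∂(chartMeasure I c).restrict L,
      |volumeWeight I (pullback I (𝓡 D) (φ 0 ∘ Φ) g.inner) c p| ≤ B := by
    filter_upwards [ae_restrict_mem hLk.measurableSet] with p hp
    rw [e0, volumeWeight, abs_mul]
    calc _ ≤ 1 * B := mul_le_mul (hρ1 p) ((hb 0 h00).1 p hp) (abs_nonneg _) zero_le_one
      _ = B := one_mul B
  have hbd : ∀ᵐ p ∂(chartMeasure I c).restrict L, ∀ t, |t| < δ →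
      |volumeWeight I (pullback I (𝓡 D) (φ t ∘ Φ) g.inner) c p -
        volumeWeight I (pullback I (𝓡 D) (φ 0 ∘ Φ) g.inner) c p| ≤ C * |t| := by
    filter_upwards [ae_restrict_mem hLk.measurableSet] with p hp t ht
    rw [e0, volumeWeight, volumeWeight, ← mul_sub, abs_mul]
    calc _ ≤ 1 * (C * |t|) :=
          mul_le_mul (hρ1 p) ((hb t ht).2.1 p hp) (abs_nonneg _) zero_le_one
      _ = C * |t| := one_mul _
  have hLm := hLk.measurableSet
  have hKm := hK.measurableSet
  have hvz : ∀ t, ∀ p ∈ K \ L, volumeWeight I (pullback I (𝓡 D) (φ t ∘ Φ) g.inner) c p = 0 :=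
    fun t p hp => by rw [volumeWeight]; exact mul_eq_zero_of_left (hzero p hp) _
  refine ⟨δ, hδ, fun t ht => ?_, ?_⟩
  · exact IntegrableOn.of_forall_sdiff_eq_zero (integrable_of_bounds hmeas hbd0 hbd ht) hKm (hvz t)
  · have h1 := hasDerivAt_integral_of_bounds (h' := fun p =>
        volumeWeight I (pullback I (𝓡 D) Φ g.inner) c p * halfTraceLie I (𝓡 D) g.inner Φ ξ p)
      hδ hmeas hbd0 hbd ?_ ?_
    · have e1 : ∀ t, ∫ p in K, volumeWeight I (pullback I (𝓡 D) (φ t ∘ Φ) g.inner) c p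
          ∂chartMeasure I c = ∫ p in L, volumeWeight I (pullback I (𝓡 D) (φ t ∘ Φ) g.inner) c p
          ∂chartMeasure I c := fun t =>
        setIntegral_eq_of_subset_of_forall_sdiff_eq_zero hKm inter_subset_left (hvz t)
      have e2 : ∫ p in K, volumeWeight I (pullback I (𝓡 D) Φ g.inner) c p *
            halfTraceLie I (𝓡 D) g.inner Φ ξ p ∂chartMeasure I c =
          ∫ p in L, volumeWeight I (pullback I (𝓡 D) Φ g.inner) c p *
            halfTraceLie I (𝓡 D) g.inner Φ ξ p ∂chartMeasure I c :=
        setIntegral_eq_of_subset_of_forall_sdiff_eq_zero hKm inter_subset_left fun p hp => by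
          have := hvz 0 p hp
          rw [e0] at this
          rw [this, zero_mul]
      simp only [e1, e2]
      exact h1
    · have h2 := hmeas 0 h00
      rw [e0] at h2
      exact h2.mul (hφ.continuous_halfTraceLie hΦ hnd hU hΦU hξ).aestronglyMeasurable
    · refine Filter.Eventually.of_forall fun p => ?_
      refine ((hφ.hasDerivAt_volumeElement hΦ hnd hU hΦU hξ p
        fun i => coordExt I c (stdVec i) p).const_mul (ρ p)).congr_deriv ?_
      simp only [volumeWeight]
      ring

theorem IsLocalFlow.hasDerivAt_volumeOver (hφ : IsLocalFlow (𝓡 D) ξ U W φ)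
    (hΦ : ContMDiff I (𝓡 D) ∞ Φ) (hnd : IsNondegenerate I (𝓡 D) g.inner Φ)
    (hU : IsOpen U) (hΦU : range Φ ⊆ U)
    (hξ : ContMDiffOn (𝓡 D) (𝓡 D).tangent 1 (fun x => (⟨x, ξ x⟩ : TangentBundle (𝓡 D) V)) U)
    {K : Set S} (hK : IsCompact K) :
    IntegrableOn (halfTraceLie I (𝓡 D) g.inner Φ ξ) K
        (volumeMeasure I (pullback I (𝓡 D) Φ g.inner)) ∧
      HasDerivAt (fun τ => volumeOver I (𝓡 D) g.inner K (φ τ ∘ Φ))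
        (∫ p in K, halfTraceLie I (𝓡 D) g.inner Φ ξ p
          ∂volumeMeasure I (pullback I (𝓡 D) Φ g.inner)) 0 := by
  obtain ⟨T, hT⟩ := exists_finset_chartPartition (I := I) hK
  choose δ hδ hint hd using fun c : S =>
    hφ.hasDerivAt_setIntegral_volumeWeight hΦ hnd hU hΦU hξ c hK
  have e0 : pullback I (𝓡 D) (φ 0 ∘ Φ) g.inner = pullback I (𝓡 D) Φ g.inner := by
    rw [hφ.zero_comp hΦU]
  have hint0 : ∀ c ∈ T, IntegrableOn (volumeWeight I (pullback I (𝓡 D) Φ g.inner) c) K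
      (chartMeasure I c) := fun c _ => by
    have := hint c 0 (by simpa using hδ c)
    rwa [e0] at this
  have hcont := hφ.continuous_halfTraceLie hΦ hnd hU hΦU hξ
  have hI : IntegrableOn (halfTraceLie I (𝓡 D) g.inner Φ ξ) K
      (volumeMeasure I (pullback I (𝓡 D) Φ g.inner)) := by
    obtain ⟨M, hM⟩ := hK.exists_bound_of_continuousOn hcont.continuousOn
    refine Measure.integrableOn_of_bounded (M := M) ?_ hcont.aestronglyMeasurable ?_
    · rw [volumeMeasure_apply_eq_sum _ hK hT hint0]
      exact (ENNReal.sum_lt_top.2 fun _ _ => ENNReal.ofReal_lt_top).ne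
    · filter_upwards [ae_restrict_mem hK.measurableSet] with p hp using hM p hp
  refine ⟨hI, ?_⟩
  rw [setIntegral_volumeMeasure_eq_sum _ hK hT hint0 hI]
  refine (HasDerivAt.fun_sum fun c (_ : c ∈ T) => hd c).congr_of_eventuallyEq ?_
  have hev : ∀ᶠ t : ℝ in 𝓝 0, ∀ c ∈ T, |t| < δ c := by
    refine (Filter.eventually_all_finset T).2 fun c _ => ?_
    filter_upwards [Metric.ball_mem_nhds (0 : ℝ) (hδ c)] with t ht using by simpa using ht
  filter_upwards [hev] with t ht
  exact volumeMeasure_real_eq_sum _ hK hT fun c hc => hint c t (ht c hc)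

end Variation

theorem exists_integralCurve_of_hasCompactSupport {E : Type*} [NormedAddCommGroup E]
    [NormedSpace ℝ E] [CompleteSpace E] {f : E → E} (hf : ContDiff ℝ 1 f)
    (hc : HasCompactSupport f) (z : E) :
    ∃ α : ℝ → E, α 0 = z ∧ (∀ t ∈ Ioo (-1 : ℝ) 1, HasDerivAt α (f (α t)) t) ∧
      ∀ t ∈ Ioo (-1 : ℝ) 1, f (α t) = 0 → α t = z := by
  obtain ⟨K, hK⟩ := hf.lipschitzWith_of_hasCompactSupport hc one_ne_zero
  obtain ⟨C, hC⟩ := hc.exists_bound_of_continuous hf.continuous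
  have hC0 : 0 ≤ C := (norm_nonneg _).trans (hC 0)
  have hpl : IsPicardLindelof (fun _ => f) (tmin := (-1 : ℝ)) (tmax := 1)
      ⟨0, by norm_num, by norm_num⟩ z ⟨C, hC0⟩ 0 ⟨C, hC0⟩ K :=
    IsPicardLindelof.of_time_independent (fun x _ => hC x) hK.lipschitzOnWith (by simp)
  obtain ⟨α, h0, hα⟩ := hpl.exists_eq_forall_mem_Icc_hasDerivWithinAt₀
  have h0 : α 0 = z := h0
  have hd : ∀ t ∈ Ioo (-1 : ℝ) 1, HasDerivAt α (f (α t)) t := fun t ht =>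
    (hα t (Ioo_subset_Icc_self ht)).hasDerivAt (Icc_mem_nhds ht.1 ht.2)
  refine ⟨α, h0, hd, fun t ht hft => ?_⟩
  have := ODE_solution_unique_of_mem_Ioo (v := fun _ => f) (s := fun _ => univ) (K := K)
    (f := α) (g := fun _ => α t) (fun _ _ => hK.lipschitzOnWith) ht
    (fun s hs => ⟨hd s hs, mem_univ _⟩)
    (fun s _ => ⟨by simpa only [hft] using hasDerivAt_const s (α t), mem_univ _⟩) rfl
  rw [← h0]
  exact (this (x := 0) (by norm_num)).symm

section ChartField

variable {D : ℕ} {V : Type*} [TopologicalSpace V] [T2Space V] [ChartedSpace (𝔼 D) V]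
  [IsManifold (𝓡 D) ∞ V] {q₀ q : V} {f : 𝔼 D → 𝔼 D}

open Classical in
/-- The vector field that is given by `f` in the chart at `q₀` and vanishes outside the chart. -/
def chartField (q₀ : V) (f : 𝔼 D → 𝔼 D) (q : V) : TangentSpace (𝓡 D) q :=
  if q ∈ (extChartAt (𝓡 D) q₀).source then fromChart (𝓡 D) q₀ q (f (extChartAt (𝓡 D) q₀ q)) else 0

theorem chartField_of_mem (hq : q ∈ (extChartAt (𝓡 D) q₀).source) :
    chartField q₀ f q = fromChart (𝓡 D) q₀ q (f (extChartAt (𝓡 D) q₀ q)) := if_pos hq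

theorem chartField_of_notMem (hq : q ∉ (extChartAt (𝓡 D) q₀).source) :
    chartField q₀ f q = 0 := if_neg hq

theorem contMDiff_chartField (hf : ContDiff ℝ 1 f) (hc : HasCompactSupport f)
    (hs : tsupport f ⊆ (extChartAt (𝓡 D) q₀).target) :
    ContMDiff (𝓡 D) (𝓡 D).tangent 1
      (fun q => (⟨q, chartField q₀ f q⟩ : TangentBundle (𝓡 D) V)) := by
  intro q
  by_cases hq : q ∈ (extChartAt (𝓡 D) q₀).source
  · refine ((trivializationAt (𝔼 D) (TangentSpace (𝓡 D) : V → Type _) q₀).contMDiffAt_section_iff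
      (IB := 𝓡 D) (n := 1) (s := chartField q₀ f) (mem_baseSet_of_mem_source hq)).2 ?_
    have h1 : ContMDiffAt (𝓡 D) 𝓘(ℝ, 𝔼 D) 1 (extChartAt (𝓡 D) q₀) q :=
      contMDiffAt_extChartAt' (by rwa [extChartAt_source] at hq)
    refine (hf.contMDiff.contMDiffAt.comp q h1).congr_of_eventuallyEq ?_
    filter_upwards [(isOpen_extChartAt_source (I := 𝓡 D) q₀).mem_nhds hq] with a ha
    rw [trivializationAt_snd_eq_toChart ha, chartField_of_mem ha, toChart_fromChart ha]
    rfl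
  · have hK : IsClosed ((extChartAt (𝓡 D) q₀).symm '' tsupport f) :=
      (hc.isCompact.image_of_continuousOn ((continuousOn_extChartAt_symm q₀).mono hs)).isClosed
    have hqK : q ∉ (extChartAt (𝓡 D) q₀).symm '' tsupport f := by
      rintro ⟨z, hz, rfl⟩
      exact hq ((extChartAt (𝓡 D) q₀).map_target (hs hz))
    refine (Bundle.contMDiffAt_zeroSection ℝ (TangentSpace (𝓡 D) : V → Type _)
      (IB := 𝓡 D) (F := 𝔼 D) (n := 1)).congr_of_eventuallyEq ?_
    filter_upwards [hK.isOpen_compl.mem_nhds hqK] with a ha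
    have h0 : chartField q₀ f a = 0 := by
      by_cases has : a ∈ (extChartAt (𝓡 D) q₀).source
      · have : f (extChartAt (𝓡 D) q₀ a) = 0 := image_eq_zero_of_notMem_tsupport fun h =>
          ha ⟨_, h, (extChartAt (𝓡 D) q₀).left_inv has⟩
        rw [chartField_of_mem has, this]
        exact map_zero _
      · exact chartField_of_notMem has
    rw [h0]
    rfl

theorem exists_isLocalFlow_chartField (hf : ContDiff ℝ 1 f) (hc : HasCompactSupport f)
    (hs : tsupport f ⊆ (extChartAt (𝓡 D) q₀).target) :
    ∃ (W : Set (ℝ × V)) (φ : ℝ → V → V), IsLocalFlow (𝓡 D) (chartField q₀ f) univ W φ := by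
  classical
  choose α h0 hα hz using exists_integralCurve_of_hasCompactSupport hf hc
  set x := extChartAt (𝓡 D) q₀ with hx
  have htgt : ∀ z ∈ x.target, ∀ t ∈ Ioo (-1 : ℝ) 1, α z t ∈ x.target := fun z hzt t ht => by
    by_contra h
    have h1 := hz z t ht (image_eq_zero_of_notMem_tsupport fun h' => h (hs h'))
    rw [h1] at h
    exact h hzt
  refine ⟨Ioo (-1) 1 ×ˢ univ, fun t q => if q ∈ x.source then x.symm (α (x q) t) else q,
    isOpen_Ioo.prod isOpen_univ, fun _ _ _ => mem_univ _, fun q _ => ⟨by norm_num, mem_univ _⟩,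
    fun q => ?_, fun _ _ _ => mem_univ _, fun q _ => ?_, fun q t ht => ?_⟩
  · simp only [mem_prod, mem_univ, and_true]
    exact ordConnected_Ioo
  · by_cases hq : q ∈ x.source
    · exact (if_pos hq).trans (by rw [h0, x.left_inv hq])
    · exact if_neg hq
  · replace ht : t ∈ Ioo (-1 : ℝ) 1 := ht.1
    refine HasMFDerivAt.hasMFDerivWithinAt ?_
    by_cases hq : q ∈ x.source
    · suffices ∀ γ : ℝ → V, γ = (fun τ => x.symm (α (x q) τ)) → HasMFDerivAt 𝓘(ℝ, ℝ) (𝓡 D) γ t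
          ((1 : ℝ →L[ℝ] ℝ).smulRight (chartField q₀ f (γ t))) from
        this _ (funext fun τ => if_pos hq)
      rintro γ rfl
      have hzt := htgt _ (x.map_source hq) t ht
      have h1 : HasMFDerivAt 𝓘(ℝ, 𝔼 D) (𝓡 D) x.symm (α (x q) t)
          (fromChart (𝓡 D) q₀ (x.symm (α (x q) t))) := by
        have h2 := (mdifferentiableWithinAt_extChartAt_symm (I := 𝓡 D) hzt).hasMFDerivWithinAt
        have h3 := fromChart_eq_mfderivWithin (I := 𝓡 D) (x.map_target hzt)
        rw [x.right_inv hzt] at h3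
        rw [← hx] at h2
        rw [h3]
        rw [ModelWithCorners.range_eq_univ] at h2 ⊢
        exact hasMFDerivWithinAt_univ.1 h2
      have h4 : HasMFDerivAt 𝓘(ℝ, ℝ) 𝓘(ℝ, 𝔼 D) (α (x q)) t
          ((1 : ℝ →L[ℝ] ℝ).smulRight (f (α (x q) t))) := (hα (x q) t ht).hasFDerivAt.hasMFDerivAt
      refine (h1.comp t h4).congr_mfderiv ?_
      rw [chartField_of_mem (x.map_target hzt), ← hx, x.right_inv hzt]
      refine ContinuousLinearMap.ext fun r => ?_
      exact (fromChart (𝓡 D) q₀ (x.symm (α (x q) t))).map_smul r (f (α (x q) t))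
    · suffices ∀ γ : ℝ → V, γ = (fun _ => q) → HasMFDerivAt 𝓘(ℝ, ℝ) (𝓡 D) γ t
          ((1 : ℝ →L[ℝ] ℝ).smulRight (chartField q₀ f (γ t))) from
        this _ (funext fun τ => if_neg hq)
      rintro γ rfl
      refine (hasMFDerivAt_const q t).congr_mfderiv ?_
      rw [chartField_of_notMem hq]
      refine ContinuousLinearMap.ext fun r => ?_
      exact (smul_zero (M := ℝ) (A := 𝔼 D) r).symm

end ChartField

theorem IsScalarProduct.of_pullbackForm_comp {d D : ℕ} {b : 𝔼 D →L[ℝ] 𝔼 D →L[ℝ] ℝ}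
    {a : 𝔼 d →L[ℝ] 𝔼 D} {B : 𝔼 d →L[ℝ] 𝔼 d} (hb : ∀ v w, b v w = b w v)
    (h : IsScalarProduct (pullbackForm b (a.comp B))) :
    Function.Surjective B ∧ IsScalarProduct (pullbackForm b a) := by
  have hinj : Function.Injective B.toLinearMap := by
    refine (injective_iff_map_eq_zero _).2 fun u hu => h.nondegenerate u fun w => ?_
    have h1 : a (B u) = 0 := (congrArg a hu).trans (map_zero a)
    change b (a (B u)) (a (B w)) = 0
    rw [h1, map_zero, FunLike.coe_zero, Pi.zero_apply]
  have hsurj : Function.Surjective B := LinearMap.injective_iff_surjective.1 hinj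
  refine ⟨hsurj, fun v w => hb (a v) (a w), fun v hv => ?_⟩
  obtain ⟨u, rfl⟩ := hsurj v
  rw [h.nondegenerate u fun w => hv (B w), map_zero]

section NormalField

variable {d D : ℕ} {H : Type*} [TopologicalSpace H] {I : ModelWithCorners ℝ (𝔼 d) H}
  {S : Type*} [TopologicalSpace S] [ChartedSpace H S] [IsManifold I ∞ S]
  {V : Type*} [TopologicalSpace V] [ChartedSpace (𝔼 D) V] [IsManifold (𝓡 D) ∞ V]
  {g : SemiRiemannianMetric (𝓡 D) V} {Φ : S → V} {p₀ : S}

/-- Near a point of an immersed submanifold, the tangent spaces of the submanifold are spanned by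
the values of smooth vector fields on the ambient manifold. -/
theorem exists_tangentFrame (h : Manifold.IsImmersionAt I (𝓡 D) ∞ Φ p₀) :
    ∃ a : 𝔼 D → 𝔼 d →L[ℝ] 𝔼 D, ContDiffAt ℝ ∞ a (extChartAt (𝓡 D) (Φ p₀) (Φ p₀)) ∧
      ∀ᶠ p in 𝓝 p₀, ∃ B : 𝔼 d →L[ℝ] 𝔼 d,
        fderivWithin ℝ (mapInChart (D := D) I Φ p₀ (Φ p₀)) (range I) (extChartAt I p₀ p) =
          (a (extChartAt (𝓡 D) (Φ p₀) (Φ p))).comp B := by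
  set x := extChartAt (𝓡 D) (Φ p₀) with hx
  set y := extChartAt I p₀ with hy
  set L : 𝔼 d →L[ℝ] 𝔼 D := (h.equiv : (𝔼 d × h.complement) →L[ℝ] 𝔼 D).comp
    (ContinuousLinearMap.inl ℝ (𝔼 d) h.complement) with hL
  set c : 𝔼 D → 𝔼 D := h.codChart ∘ x.symm with hc
  set c' : 𝔼 D → 𝔼 D := x ∘ h.codChart.symm with hc'
  have hkey : ∀ p ∈ h.domChart.source, h.codChart (Φ p) = L (I (h.domChart p)) := fun p hp => by
    have h1 := h.writtenInCharts ((h.domChart.extend I).map_source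
      (by rwa [OpenPartialHomeomorph.extend_source]))
    simp only [Function.comp_apply] at h1
    rw [OpenPartialHomeomorph.extend_left_inv _ hp] at h1
    exact h1
  have hc's : ∀ q ∈ x.source ∩ h.codChart.source, ContDiffAt ℝ ∞ c' (h.codChart q) := by
    rintro q ⟨hqx, hqc⟩
    have h1 : ContMDiffAt (𝓡 D) 𝓘(ℝ, 𝔼 D) ∞ x q :=
      contMDiffAt_extChartAt' (by rwa [hx, extChartAt_source] at hqx)
    have h2 : ContMDiffAt (𝓡 D) (𝓡 D) ∞ h.codChart.symm (h.codChart q) :=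
      (contMDiffOn_symm_of_mem_maximalAtlas h.codChart_mem_maximalAtlas).contMDiffAt
        (h.codChart.open_target.mem_nhds (h.codChart.map_source hqc))
    exact contMDiffAt_iff_contDiffAt.1
      (ContMDiffAt.comp_of_eq h1 h2 (h.codChart.left_inv hqc))
  have hq₀ : Φ p₀ ∈ x.source := mem_extChartAt_source (I := 𝓡 D) (Φ p₀)
  have hcs : ContDiffAt ℝ ∞ c (x (Φ p₀)) := by
    have h1 : ContMDiffAt (𝓡 D) (𝓡 D) ∞ h.codChart (Φ p₀) :=
      contMDiffAt_of_mem_maximalAtlas h.codChart_mem_maximalAtlas h.mem_codChart_source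
    have h2 := contMDiffWithinAt_extChartAt_symm_range (I := 𝓡 D) (n := ∞) (Φ p₀)
      (x.map_source hq₀)
    rw [ModelWithCorners.range_eq_univ, contMDiffWithinAt_univ] at h2
    exact contMDiffAt_iff_contDiffAt.1 (ContMDiffAt.comp_of_eq h1 h2 (x.left_inv hq₀))
  refine ⟨fun z => (fderiv ℝ c' (c z)).comp L, ?_, ?_⟩
  · have hcq : c (x (Φ p₀)) = h.codChart (Φ p₀) := congrArg h.codChart (x.left_inv hq₀)
    have h1 : ContDiffAt ℝ ∞ (fderiv ℝ c') (c (x (Φ p₀))) := by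
      rw [hcq]
      exact (hc's _ ⟨hq₀, h.mem_codChart_source⟩).fderiv_right (m := ∞) (by simp)
    exact (h1.comp (x (Φ p₀)) hcs).clm_comp contDiffAt_const
  · filter_upwards [extChartAt_source_mem_nhds (I := I) p₀,
      h.domChart.open_source.mem_nhds h.mem_domChart_source,
      h.continuousAt.preimage_mem_nhds (extChartAt_source_mem_nhds (I := 𝓡 D) (Φ p₀))]
      with p hpy hpd hpx
    set κ : 𝔼 d → 𝔼 d := fun u => I (h.domChart (y.symm u)) with hκ
    have hut := y.map_source hpy
    have hu : y p ∈ range I := extChartAt_target_subset_range p₀ hut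
    have hκd : DifferentiableWithinAt ℝ κ (range I) (y p) := by
      have h1 : ContMDiffAt I I ∞ h.domChart p :=
        contMDiffAt_of_mem_maximalAtlas h.domChart_mem_maximalAtlas hpd
      have h2 := contMDiffWithinAt_extChartAt_symm_range (I := I) (n := ∞) p₀ hut
      have h3 := ContMDiffAt.comp_contMDiffWithinAt_of_eq h1 h2 (y.left_inv hpy)
      have h4 := (I.contMDiff (n := ∞)).contMDiffAt.comp_contMDiffWithinAt (y p) h3
      exact (contMDiffWithinAt_iff_contDiffWithinAt.1 h4).differentiableWithinAt (by simp)
    refine ⟨fderivWithin ℝ κ (range I) (y p), ?_⟩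
    have hcp : c (x (Φ p)) = h.codChart (Φ p) := congrArg h.codChart (x.left_inv hpx)
    have hLκ : ∀ u, y.symm u ∈ h.domChart.source → L (κ u) = h.codChart (Φ (y.symm u)) :=
      fun u hu => (hkey _ hu).symm
    have hyp := y.left_inv hpy
    have h1 : HasFDerivAt c' (fderiv ℝ c' (c (x (Φ p)))) (L (κ (y p))) := by
      rw [hLκ _ (by rwa [hyp]), hyp, hcp]
      exact ((hc's _ ⟨hpx, h.source_subset_preimage_source hpd⟩).differentiableAt
        (by simp)).hasFDerivAt
    have h2 : HasFDerivWithinAt (c' ∘ L ∘ κ) (((fderiv ℝ c' (c (x (Φ p)))).comp L).comp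
        (fderivWithin ℝ κ (range I) (y p))) (range I) (y p) :=
      h1.comp_hasFDerivWithinAt (y p) (L.hasFDerivAt.comp_hasFDerivWithinAt (y p)
        hκd.hasFDerivWithinAt)
    have h3 := (continuousAt_extChartAt_symm' hpy).tendsto
    rw [← hy, hyp] at h3
    have h4 : ∀ᶠ u in 𝓝[range I] (y p), mapInChart I Φ p₀ (Φ p₀) u = (c' ∘ L ∘ κ) u := by
      filter_upwards [(h3.eventually (h.domChart.open_source.mem_nhds hpd)).filter_mono
        nhdsWithin_le_nhds] with u hu
      simp only [Function.comp_apply, mapInChart, hc']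
      rw [hLκ u hu, h.codChart.left_inv (h.source_subset_preimage_source hu)]
    exact (h2.congr_of_eventuallyEq h4 (h4.self_of_nhdsWithin hu)).fderivWithin
      (I.uniqueDiffOn.uniqueDiffWithinAt hu)

/-- A given vector at a point of an immersed submanifold can be changed by a tangent vector such
that the result extends to a smooth vector field on the ambient manifold that is normal along the
submanifold. -/
theorem exists_normalField (h : Manifold.IsImmersionAt I (𝓡 D) ∞ Φ p₀)
    (hΦ : ContMDiff I (𝓡 D) ∞ Φ) (hnd : IsNondegenerate I (𝓡 D) g.inner Φ) (w : 𝔼 D) :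
    ∃ N : 𝔼 D → 𝔼 D, ContDiffAt ℝ ∞ N (extChartAt (𝓡 D) (Φ p₀) (Φ p₀)) ∧
      (∀ᶠ p in 𝓝 p₀, ∀ v : TangentSpace I p, g.inner (Φ p)
        (fromChart (𝓡 D) (Φ p₀) (Φ p) (N (extChartAt (𝓡 D) (Φ p₀) (Φ p))))
        (mfderiv I (𝓡 D) Φ p v) = 0) ∧
      ∀ k : TangentSpace (𝓡 D) (Φ p₀), (∀ v, g.inner (Φ p₀) k (mfderiv I (𝓡 D) Φ p₀ v) = 0) →
        g.inner (Φ p₀) (N (extChartAt (𝓡 D) (Φ p₀) (Φ p₀))) k = g.inner (Φ p₀) w k := by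
  obtain ⟨a, ha, haB⟩ := exists_tangentFrame h
  set x := extChartAt (𝓡 D) (Φ p₀) with hx
  set G := formInChart (𝓡 D) g.inner (Φ p₀) with hG
  set Γ : 𝔼 D → 𝔼 d →L[ℝ] 𝔼 d →L[ℝ] ℝ := fun z => pullbackForm (G z) (a z) with hΓ
  have hmd : ∀ q, MDifferentiableAt I (𝓡 D) Φ q := fun q => (hΦ q).mdifferentiableAt (by simp)
  have hnear : ∀ᶠ p in 𝓝 p₀, p ∈ (extChartAt I p₀).source ∧ Φ p ∈ x.source ∧
      IsScalarProduct (Γ (x (Φ p))) ∧ ∃ B : 𝔼 d →L[ℝ] 𝔼 d, Function.Surjective B ∧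
        fderivWithin ℝ (mapInChart (D := D) I Φ p₀ (Φ p₀)) (range I) (extChartAt I p₀ p) =
          (a (x (Φ p))).comp B := by
    filter_upwards [haB, extChartAt_source_mem_nhds (I := I) p₀,
      h.continuousAt.preimage_mem_nhds (extChartAt_source_mem_nhds (I := 𝓡 D) (Φ p₀))]
      with p ⟨B, hB⟩ hp hq
    have hsp := isScalarProduct_formInChart_pullback hnd ((extChartAt I p₀).map_source hp)
    rw [formInChart_pullback g.inner hp hq (hmd p), mapInChart_apply hp, hB] at hsp
    obtain ⟨hsurj, hsp⟩ := IsScalarProduct.of_pullbackForm_comp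
      (formInChart_symm g (Φ p₀) (x (Φ p))) hsp
    exact ⟨hp, hq, hsp, B, hsurj, hB⟩
  set s : 𝔼 D → 𝔼 d := fun z => sharp (Γ z) fun v => G z w (a z v) with hs
  have hsharp : ∀ z, IsScalarProduct (Γ z) → ∀ v,
      G z (w - a z (s z)) (a z v) = 0 := fun z hz v => by
    have h1 : G z (a z (s z)) (a z v) = G z w (a z v) :=
      hz.apply_sharp ((G z w).comp (a z)).toLinearMap v
    rw [map_sub, FunLike.coe_sub, Pi.sub_apply, h1, sub_self]
  have hq₀ : Φ p₀ ∈ x.source := mem_extChartAt_source (I := 𝓡 D) (Φ p₀)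
  have hGs : ContDiffAt ℝ ∞ G (x (Φ p₀)) := g.contDiffAt_formInChart (x.map_source hq₀)
  refine ⟨fun z => w - a z (s z), ?_, ?_, fun k hk => ?_⟩
  · have hΓs : ContDiffAt ℝ ∞ Γ (x (Φ p₀)) := by
      rw [← contDiffWithinAt_univ] at hGs ha ⊢
      exact contDiffWithinAt_pullbackForm hGs ha
    have hss : ContDiffAt ℝ ∞ s (x (Φ p₀)) := by
      rw [← contDiffWithinAt_univ] at hΓs ⊢
      refine contDiffWithinAt_sharp hΓs (fun v => ?_)
        hnear.self_of_nhds.2.2.1.det_ne_zero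
      exact ((hGs.clm_apply contDiffAt_const).clm_apply
        (ha.clm_apply contDiffAt_const)).contDiffWithinAt
    exact contDiffAt_const.sub (ha.clm_apply hss)
  · filter_upwards [hnear] with p hp v
    obtain ⟨hp, hq, hsp, B, -, hB⟩ := hp
    have h1 := (fderivWithin_mapInChart hp hq (hmd p) (toChart I p₀ p v)).trans
      (congrArg (fun u : 𝔼 d => toChart (𝓡 D) (Φ p₀) (Φ p) (mfderiv I (𝓡 D) Φ p u))
        (fromChart_toChart hp v))
    have h2 := hsharp _ hsp (B (toChart I p₀ p v))
    rw [hB] at h1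
    have h3 := formInChart_apply_toChart g.inner hq
      (fromChart (𝓡 D) (Φ p₀) (Φ p) (w - a (x (Φ p)) (s (x (Φ p))))) (mfderiv I (𝓡 D) Φ p v)
    rw [toChart_fromChart hq] at h3
    refine h3.symm.trans (Eq.trans ?_ h2)
    exact congrArg (G (x (Φ p)) _) h1.symm
  · obtain ⟨hp, hq, -, B, hB', hB⟩ := hnear.self_of_nhds
    obtain ⟨u, hu⟩ := hB' (s (x (Φ p₀)))
    have h1 := ((fderivWithin_mapInChart hp hq (hmd p₀) u).trans (toChart_self _)).trans
      (congrArg (fun u : 𝔼 d => mfderiv I (𝓡 D) Φ p₀ u) (fromChart_self u))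
    rw [hB] at h1
    have h2 : a (x (Φ p₀)) (s (x (Φ p₀))) = mfderiv I (𝓡 D) Φ p₀ u := by
      rw [← hu]
      exact h1
    have h3 : g.inner (Φ p₀) (a (x (Φ p₀)) (s (x (Φ p₀)))) k = 0 := by
      rw [h2, g.symm]
      exact hk u
    have h4 := DFunLike.congr_fun (map_sub (g.inner (Φ p₀) : 𝔼 D →L[ℝ] 𝔼 D →L[ℝ] ℝ) w
      (a (x (Φ p₀)) (s (x (Φ p₀))))) k
    refine h4.trans ?_
    change g.inner (Φ p₀) w k - g.inner (Φ p₀) (a (x (Φ p₀)) (s (x (Φ p₀)))) k = _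
    rw [h3, sub_zero]

end NormalField

section Positivity

variable {d : ℕ} {H : Type*} [TopologicalSpace H] {I : ModelWithCorners ℝ (𝔼 d) H}
  {S : Type*} [TopologicalSpace S] [ChartedSpace H S] [IsManifold I ∞ S]

theorem exists_isOpen_subset_extChartAt_target {O : Set S} (hO : IsOpen O) {c p : S} (hp : p ∈ O)
    (hpc : p ∈ (extChartAt I c).source) : ∃ T : Set (𝔼 d), IsOpen T ∧ T.Nonempty ∧
      T ⊆ (extChartAt I c).target ∧ T ⊆ (extChartAt I c).symm ⁻¹' O := by
  have h1 := (continuousAt_extChartAt_symm' hpc).tendsto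
  rw [(extChartAt I c).left_inv hpc] at h1
  have h2 : (extChartAt I c).target ∩ (extChartAt I c).symm ⁻¹' O ∈
      𝓝[range I] (extChartAt I c p) :=
    Filter.inter_mem (extChartAt_target_mem_nhdsWithin_of_mem ((extChartAt I c).map_source hpc))
      (nhdsWithin_le_nhds (h1 (hO.mem_nhds hp)))
  obtain ⟨T, hT, hpT, hTs⟩ := mem_nhdsWithin.1 h2
  have hcl : extChartAt I c p ∈ closure (interior (range I)) :=
    I.range_subset_closure_interior
      (extChartAt_target_subset_range c ((extChartAt I c).map_source hpc))
  have hsub : T ∩ interior (range I) ⊆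
      (extChartAt I c).target ∩ (extChartAt I c).symm ⁻¹' O :=
    (inter_subset_inter_right _ interior_subset).trans hTs
  exact ⟨T ∩ interior (range I), hT.inter isOpen_interior, mem_closure_iff.1 hcl T hT hpT,
    fun u hu => (hsub hu).1, fun u hu => (hsub hu).2⟩

variable (I) in
theorem dense_interior : Dense (I.interior S) := by
  refine dense_iff_inter_open.2 fun O hO ⟨p, hp⟩ => ?_
  obtain ⟨T, hT, ⟨u, hu⟩, hTt, hTO⟩ :=
    exists_isOpen_subset_extChartAt_target (I := I) hO hp (mem_extChartAt_source p)
  refine ⟨(extChartAt I p).symm u, hTO hu, ?_⟩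
  refine (I.isInteriorPoint_iff_of_mem_atlas (n := ∞) (by simp) (chart_mem_atlas H p) ?_).2 ?_
  · simpa only [extChartAt_source] using (extChartAt I p).map_target (hTt hu)
  · change extChartAt I p ((extChartAt I p).symm u) ∈ interior (extChartAt I p).target
    rw [(extChartAt I p).right_inv (hTt hu)]
    exact mem_interior.2 ⟨T, hTt, hT, hu⟩

variable [T2Space S] [SigmaCompactSpace S] [MeasurableSpace S] [BorelSpace S]

theorem chartMeasure_pos {O : Set S} (hO : IsOpen O) {c p : S} (hp : p ∈ O)
    (hpc : p ∈ (extChartAt I c).source) : 0 < chartMeasure I c O := by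
  obtain ⟨T, hT, hne, hTt, hTO⟩ := exists_isOpen_subset_extChartAt_target hO hp hpc
  rw [chartMeasure, Measure.map_apply_of_aemeasurable (aemeasurable_extChartAt_symm c)
    hO.measurableSet, Measure.restrict_apply' (measurableSet_extChartAt_target c)]
  exact (hT.measure_pos volume hne).trans_le (measure_mono fun u hu => ⟨hTO hu, hTt hu⟩)

variable {D : ℕ} {V : Type*} [TopologicalSpace V] [ChartedSpace (𝔼 D) V] [IsManifold (𝓡 D) ∞ V]
  {g : SemiRiemannianMetric (𝓡 D) V} {Φ : S → V}

theorem volumeMeasure_pos (hΦ : ContMDiff I (𝓡 D) ∞ Φ)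
    (hnd : IsNondegenerate I (𝓡 D) g.inner Φ) {O : Set S} (hO : IsOpen O) (hne : O.Nonempty) :
    0 < volumeMeasure I (pullback I (𝓡 D) Φ g.inner) O := by
  obtain ⟨p, hp⟩ := hne
  obtain ⟨c, hc⟩ := (chartPartition I S).exists_pos_of_mem (mem_univ p)
  set ρ : S → ℝ := ⇑(chartPartition I S c) with hρ
  have hρc : Continuous ρ := (chartPartition I S c).contMDiff.continuous
  set O' : Set S := O ∩ {q | 0 < ρ q} with hO'
  have hO'o : IsOpen O' := hO.inter (isOpen_lt continuous_const hρc)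
  have hsrc : O' ⊆ (extChartAt I c).source := fun q hq =>
    tsupport_chartPartition_subset c (subset_tsupport _ (ne_of_gt hq.2))
  set w := volumeWeight I (pullback I (𝓡 D) Φ g.inner) c with hw
  have hweq : EqOn w (fun q => ρ q * chartDensity I (pullback I (𝓡 D) Φ g.inner) c q) O' :=
    fun q hq => by
      have h1 : (fun i => coordExt I c (stdVec i) q) = fun i => fromChart I c q (stdVec i) :=
        funext fun i => coordExt_eq_fromChart (hsrc hq) _
      simp only [hw, volumeWeight, chartDensity_eq_volumeElement _ (hsrc hq)]
      exact congrArg (fun v => ρ q * volumeElement I (pullback I (𝓡 D) Φ g.inner) q v) h1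
  have hwc : ContinuousOn w O' :=
    (hρc.continuousOn.mul ((continuousOn_chartDensity hΦ c).mono hsrc)).congr hweq
  have hwm : AEMeasurable (fun q => ENNReal.ofReal (w q)) ((chartMeasure I c).restrict O') :=
    (hwc.aemeasurable hO'o.measurableSet).ennreal_ofReal
  refine pos_iff_ne_zero.2 fun h0 => (chartMeasure_pos hO'o ⟨hp, hc⟩ (hsrc ⟨hp, hc⟩)).ne' ?_
  have h1 : ∫⁻ q in O', ENNReal.ofReal (w q) ∂chartMeasure I c = 0 := by
    rw [← withDensity_apply _ hO'o.measurableSet]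
    refine le_antisymm (le_trans ?_ ((measure_mono (inter_subset_left : O' ⊆ O)).trans h0.le)) zero_le
    rw [volumeMeasure_eq_sum]
    exact Measure.le_sum (fun c : S => (chartMeasure I c).withDensity fun p => ENNReal.ofReal
      (volumeWeight I (pullback I (𝓡 D) Φ g.inner) c p)) c O'
  have h2 := (lintegral_eq_zero_iff' hwm).1 h1
  have h3 : ∀ᵐ q ∂(chartMeasure I c).restrict O', False := by
    filter_upwards [h2, ae_restrict_mem hO'o.measurableSet] with q hq hqO
    have h4 : 0 < w q := by
      rw [hweq hqO]
      exact mul_pos hqO.2 (chartDensity_pos hnd (hsrc hqO))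
    exact (ENNReal.ofReal_pos.2 h4).ne' hq
  have h5 : ((chartMeasure I c).restrict O') univ = 0 := by
    simpa only [ae_iff, not_false_eq_true, ofPred_true] using h3
  rwa [Measure.restrict_apply_univ] at h5

end Positivity

section NormalVariation

variable {d D : ℕ} {H : Type*} [TopologicalSpace H] {I : ModelWithCorners ℝ (𝔼 d) H}
  {S : Type*} [TopologicalSpace S] [ChartedSpace H S] [IsManifold I ∞ S]
  {V : Type*} [TopologicalSpace V] [ChartedSpace (𝔼 D) V] [IsManifold (𝓡 D) ∞ V]
  {g : SemiRiemannianMetric (𝓡 D) V} {Φ : S → V}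

theorem sharp_zero (b : 𝔼 d →L[ℝ] 𝔼 d →L[ℝ] ℝ) : sharp b (fun _ => 0) = 0 := by
  simp [sharp]

theorem dirDeriv_eq_zero {h : S → ℝ} {p : S} (hh : ∀ q ∈ (extChartAt I p).source, h q = 0)
    (v : 𝔼 d) : dirDeriv I h p v = 0 := by
  refine dirDeriv_eq_of_eventuallyEq (k := fun _ => 0) (k' := 0)
    (hasFDerivWithinAt_const _ _ _) ?_ v
  filter_upwards [extChartAt_source_mem_nhds (I := I) p] with q hq using hh q hq

theorem christoffel_zero_right (γ : BilinField I S) (p : S) (v : TangentSpace I p) :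
    christoffel I γ p v (0 : 𝔼 d) = 0 := by
  have h0 : ∀ q ∈ (extChartAt I p).source, coordExt I p 0 q = 0 := fun q hq =>
    (coordExt_eq_fromChart hq 0).trans (map_zero _)
  have h1 : ∀ (z v : 𝔼 d),
      dirDeriv I (fun q => γ q (coordExt I p 0 q) (coordExt I p z q)) p v = 0 := fun z =>
    dirDeriv_eq_zero fun q hq => by
      rw [h0 q hq]
      exact DFunLike.congr_fun (map_zero (γ q)) _
  have h2 : ∀ (z v : 𝔼 d),
      dirDeriv I (fun q => γ q (coordExt I p z q) (coordExt I p 0 q)) p v = 0 := fun z =>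
    dirDeriv_eq_zero fun q hq => by
      rw [h0 q hq]
      exact map_zero (γ q _)
  have h3 : ∀ f : S → ℝ, dirDeriv I f p (0 : 𝔼 d) = 0 := fun f => map_zero (mfderiv I 𝓘(ℝ, ℝ) f p)
  unfold christoffel
  refine Eq.trans (congrArg (sharp (γ p)) (funext fun z => ?_)) (sharp_zero _)
  refine div_eq_zero_iff.2 (Or.inl ?_)
  exact (congrArg₂ (· - ·) (congrArg₂ (· + ·) (h1 z v) (h3 _)) (h2 v z)).trans (by norm_num)

theorem divergence_zero (γ : BilinField I S) (p : S) :
    divergence I γ (fun _ => (0 : 𝔼 d)) p = 0 := by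
  unfold divergence
  refine Finset.sum_eq_zero fun i _ => ?_
  have h1 : covDeriv I γ (fun _ => (0 : 𝔼 d)) p (stdVec i) = (0 : 𝔼 d) := by
    unfold covDeriv
    have h2 := christoffel_zero_right γ p (stdVec i)
    refine Eq.trans (congrArg₂ (· + ·) ?_ h2) (add_zero (0 : 𝔼 d))
    refine dirDerivVec_eq_of_eventuallyEq (k := fun _ => 0) (k' := 0)
      (hasFDerivWithinAt_const _ _ _) ?_ _
    filter_upwards [extChartAt_source_mem_nhds (I := I) p] with q hq
    exact (trivializationAt_snd_eq_toChart hq _).trans (map_zero _)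
  rw [h1]
  rfl

/-- For a normal variation, the first variation of the volume is the component of the variation
along the mean curvature vector. -/
theorem divPlusMean_of_normal {ξ : (x : V) → TangentSpace (𝓡 D) x}
    (hξ : ∀ p v, g.inner (Φ p) (ξ (Φ p)) (mfderiv I (𝓡 D) Φ p v) = 0) (p : S) :
    divPlusMean I (𝓡 D) g.inner Φ ξ p =
      g.inner (Φ p) (ξ (Φ p)) (meanCurvature I (𝓡 D) g.inner Φ p) := by
  have h : (fun q => tangentPart I (𝓡 D) g.inner Φ q (ξ (Φ q))) = fun _ => (0 : 𝔼 d) :=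
    funext fun q => by
      unfold tangentPart
      exact (congrArg (sharp _) (funext (hξ q))).trans (sharp_zero _)
  unfold divPlusMean
  rw [h]
  exact (congrArg (· + _) (divergence_zero _ p)).trans (zero_add _)

theorem inner_normalPart (hnd : IsNondegenerate I (𝓡 D) g.inner Φ) (p : S)
    (v : TangentSpace (𝓡 D) (Φ p)) (w : TangentSpace I p) :
    g.inner (Φ p) (normalPart I (𝓡 D) g.inner Φ p v) (mfderiv I (𝓡 D) Φ p w) = 0 := by
  unfold normalPart
  have h1 := apply_tangentPart hnd p v w
  have h2 := DFunLike.congr_fun (map_sub (g.inner (Φ p)) v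
    (mfderiv I (𝓡 D) Φ p (tangentPart I (𝓡 D) g.inner Φ p v))) (mfderiv I (𝓡 D) Φ p w)
  exact h2.trans (sub_eq_zero.2 h1.symm)

theorem inner_meanCurvature (hnd : IsNondegenerate I (𝓡 D) g.inner Φ) (p : S)
    (w : TangentSpace I p) :
    g.inner (Φ p) (meanCurvature I (𝓡 D) g.inner Φ p) (mfderiv I (𝓡 D) Φ p w) = 0 := by
  let G : 𝔼 D →L[ℝ] 𝔼 D →L[ℝ] ℝ := g.inner (Φ p)
  let a : 𝔼 D := mfderiv I (𝓡 D) Φ p w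
  let l : 𝔼 D →ₗ[ℝ] ℝ := (G.flip a).toLinearMap
  have h1 : ∀ x y, l (shapeTensor I (𝓡 D) g.inner Φ p x y) = 0 := fun x y => by
    have h2 := inner_normalPart hnd p (covDerivAlong I (𝓡 D) g.inner Φ
      (fun q => mfderiv I (𝓡 D) Φ q (coordExt I p y q)) p x) w
    exact (map_neg l _).trans (neg_eq_zero.2 h2)
  change l (metricTrace _ _) = 0
  unfold metricTrace
  rw [map_sum]
  refine Finset.sum_eq_zero fun i _ => ?_
  rw [map_sum]
  refine Finset.sum_eq_zero fun j _ => ?_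
  exact (map_smul l _ _).trans ((congrArg _ (h1 _ _)).trans (smul_zero _))

end NormalVariation

section Extremal

variable {d D : ℕ} {H : Type*} [TopologicalSpace H] {I : ModelWithCorners ℝ (𝔼 d) H}
  {S : Type*} [TopologicalSpace S] [ChartedSpace H S] [IsManifold I ∞ S]
  {V : Type*} [TopologicalSpace V] [ChartedSpace (𝔼 D) V] [IsManifold (𝓡 D) ∞ V]
  {g : SemiRiemannianMetric (𝓡 D) V} {Φ : S → V} {q₀ : V} {f N : 𝔼 D → 𝔼 D} {χ : 𝔼 D → ℝ}

theorem contDiff_smul_of_tsupport {E F : Type*} [NormedAddCommGroup E] [NormedSpace ℝ E]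
    [NormedAddCommGroup F] [NormedSpace ℝ F] {n : ℕ∞ω} {χ : E → ℝ} {N : E → F}
    (hχ : ContDiff ℝ n χ) (hN : ∀ z ∈ tsupport χ, ContDiffAt ℝ n N z) :
    ContDiff ℝ n (fun z => χ z • N z) := by
  refine contDiff_iff_contDiffAt.2 fun z => ?_
  by_cases hz : z ∈ tsupport χ
  · exact hχ.contDiffAt.smul (hN z hz)
  · refine (contDiffAt_const (c := (0 : F))).congr_of_eventuallyEq ?_
    filter_upwards [(isClosed_tsupport χ).isOpen_compl.mem_nhds hz] with a ha
    rw [image_eq_zero_of_notMem_tsupport ha, zero_smul]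

section ChartField

variable [T2Space V]

theorem chartField_smul (χ : 𝔼 D → ℝ) (f : 𝔼 D → 𝔼 D) (q : V) :
    chartField q₀ (fun z => χ z • f z) q =
      χ (extChartAt (𝓡 D) q₀ q) • chartField q₀ f q := by
  by_cases hq : q ∈ (extChartAt (𝓡 D) q₀).source
  · rw [chartField_of_mem hq, chartField_of_mem hq]
    exact map_smul (fromChart (𝓡 D) q₀ q) _ _
  · rw [chartField_of_notMem hq, chartField_of_notMem hq, smul_zero]

variable (I g Φ q₀) in
/-- The component along the mean curvature vector of the vector field given by `f` in a chart. -/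
def meanComponent (f : 𝔼 D → 𝔼 D) (p : S) : ℝ :=
  g.inner (Φ p) (chartField q₀ f (Φ p)) (meanCurvature I (𝓡 D) g.inner Φ p)

theorem meanComponent_smul (χ : 𝔼 D → ℝ) (f : 𝔼 D → 𝔼 D) (p : S) :
    meanComponent I g Φ q₀ (fun z => χ z • f z) p =
      χ (extChartAt (𝓡 D) q₀ (Φ p)) * meanComponent I g Φ q₀ f p := by
  unfold meanComponent
  rw [chartField_smul]
  exact DFunLike.congr_fun (map_smul (g.inner (Φ p)) _ _) _

theorem meanComponent_eq_zero {p : S} (h : chartField q₀ f (Φ p) = 0) :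
    meanComponent I g Φ q₀ f p = 0 := by
  unfold meanComponent
  rw [h]
  exact DFunLike.congr_fun (map_zero (g.inner (Φ p))) _

variable (I g Φ q₀) in
/-- The vector field given by `f` in the chart at `q₀` is normal along `Φ`. -/
def IsNormalField (f : 𝔼 D → 𝔼 D) : Prop :=
  ∀ (p : S) (v : TangentSpace I p),
    g.inner (Φ p) (chartField q₀ f (Φ p)) (mfderiv I (𝓡 D) Φ p v) = 0

theorem isNormalField_smul (h : ∀ p, Φ p ∈ (extChartAt (𝓡 D) q₀).source →
      extChartAt (𝓡 D) q₀ (Φ p) ∈ tsupport χ → ∀ v : TangentSpace I p, g.inner (Φ p)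
        (fromChart (𝓡 D) q₀ (Φ p) (N (extChartAt (𝓡 D) q₀ (Φ p)))) (mfderiv I (𝓡 D) Φ p v) = 0) :
    IsNormalField I g Φ q₀ (fun z => χ z • N z) := fun p v => by
  by_cases hq : Φ p ∈ (extChartAt (𝓡 D) q₀).source
  · rw [chartField_smul]
    refine (DFunLike.congr_fun (map_smul (g.inner (Φ p)) _ _) _).trans ?_
    by_cases hz : extChartAt (𝓡 D) q₀ (Φ p) ∈ tsupport χ
    · rw [chartField_of_mem hq]
      exact (congrArg _ (h p hq hz v)).trans (mul_zero _)
    · rw [image_eq_zero_of_notMem_tsupport hz, zero_smul]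
      rfl
  · rw [chartField_of_notMem hq]
    exact DFunLike.congr_fun (map_zero (g.inner (Φ p))) _

variable [MeasurableSpace S] [BorelSpace S] [T2Space S] [SigmaCompactSpace S]

theorem IsNormalField.halfTraceLie_eq (hΦ : ContMDiff I (𝓡 D) ∞ Φ)
    (hnd : IsNondegenerate I (𝓡 D) g.inner Φ) (hf : ContDiff ℝ 1 f) (hc : HasCompactSupport f)
    (hs : tsupport f ⊆ (extChartAt (𝓡 D) q₀).target) (hn : IsNormalField I g Φ q₀ f) :
    halfTraceLie I (𝓡 D) g.inner Φ (chartField q₀ f) = meanComponent I g Φ q₀ f :=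
  funext fun p => (halfTraceLie_eq_divPlusMean hΦ hnd (contMDiff_chartField hf hc hs _)).trans
    (divPlusMean_of_normal hn p)

theorem IsNormalField.continuous_meanComponent (hΦ : ContMDiff I (𝓡 D) ∞ Φ)
    (hnd : IsNondegenerate I (𝓡 D) g.inner Φ) (hf : ContDiff ℝ 1 f) (hc : HasCompactSupport f)
    (hs : tsupport f ⊆ (extChartAt (𝓡 D) q₀).target) (hn : IsNormalField I g Φ q₀ f) :
    Continuous (meanComponent I g Φ q₀ f) := by
  obtain ⟨W, φ, hφ⟩ := exists_isLocalFlow_chartField hf hc hs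
  rw [← hn.halfTraceLie_eq hΦ hnd hf hc hs]
  exact hφ.continuous_halfTraceLie hΦ hnd isOpen_univ (subset_univ _)
    (contMDiff_chartField hf hc hs).contMDiffOn

theorem IsNormalField.exists_setIntegral_eq_zero (hΦ : ContMDiff I (𝓡 D) ∞ Φ)
    (hnd : IsNondegenerate I (𝓡 D) g.inner Φ) (hf : ContDiff ℝ 1 f) (hc : HasCompactSupport f)
    (hs : tsupport f ⊆ (extChartAt (𝓡 D) q₀).target) (hn : IsNormalField I g Φ q₀ f)
    (hext : HasExtremalVolume I (𝓡 D) g.inner Φ)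
    (hbd : ∀ p ∈ I.boundary S, chartField q₀ f (Φ p) = 0)
    (hcpt : IsCompact (closure {p | chartField q₀ f (Φ p) ≠ 0})) :
    ∃ K : Set S, closure {p | chartField q₀ f (Φ p) ≠ 0} ⊆ K ∧
      IntegrableOn (meanComponent I g Φ q₀ f) K (volumeMeasure I (pullback I (𝓡 D) Φ g.inner)) ∧
      ∫ p in K, meanComponent I g Φ q₀ f p ∂volumeMeasure I (pullback I (𝓡 D) Φ g.inner) = 0 := by
  obtain ⟨W, φ, hφ⟩ := exists_isLocalFlow_chartField hf hc hs
  have hξ := (contMDiff_chartField hf hc hs).contMDiffOn (s := univ)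
  obtain ⟨K, hK, hsub, h⟩ := hext univ _ W φ isOpen_univ (subset_univ _) hξ hφ hbd hcpt
  obtain ⟨hint, hd⟩ := hφ.hasDerivAt_volumeOver hΦ hnd isOpen_univ (subset_univ _) hξ hK
  rw [hn.halfTraceLie_eq hΦ hnd hf hc hs] at hint hd
  refine ⟨K, hsub, hint, ?_⟩
  rcases h with h | h
  · exact hd.unique h
  · exact h.hasDerivAt_eq_zero hd

theorem IsNormalField.meanComponent_eq_zero_of_pos (hΦ : ContMDiff I (𝓡 D) ∞ Φ)
    (hnd : IsNondegenerate I (𝓡 D) g.inner Φ) (hf : ContDiff ℝ 1 f) (hc : HasCompactSupport f)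
    (hs : tsupport f ⊆ (extChartAt (𝓡 D) q₀).target) (hn : IsNormalField I g Φ q₀ f)
    (hext : HasExtremalVolume I (𝓡 D) g.inner Φ) {K : Set S} (hK : IsCompact K)
    (hKi : K ⊆ I.interior S) (hsupp : ∀ p ∉ K, chartField q₀ f (Φ p) = 0) {r : ℝ}
    (hpos : ∀ p, 0 ≤ meanComponent I g Φ q₀ f p * r) (p : S) :
    meanComponent I g Φ q₀ f p * r = 0 := by
  have hsub : {p | chartField q₀ f (Φ p) ≠ 0} ⊆ K := fun p hp => by
    by_contra h
    exact hp (hsupp p h)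
  obtain ⟨L, hL, hint, h0⟩ := hn.exists_setIntegral_eq_zero hΦ hnd hf hc hs hext
    (fun p hp => hsupp p fun h => by
      rw [← I.compl_interior] at hp
      exact hp (hKi h))
    (hK.of_isClosed_subset isClosed_closure (closure_minimal hsub hK.isClosed))
  have hcont : Continuous fun p => meanComponent I g Φ q₀ f p * r :=
    (hn.continuous_meanComponent hΦ hnd hf hc hs).mul continuous_const
  by_contra hp
  have hsupL : Function.support (fun p => meanComponent I g Φ q₀ f p * r) ⊆ L := fun p hp =>
    hL (subset_closure fun h => hp (by
      change meanComponent I g Φ q₀ f p * r = 0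
      rw [meanComponent_eq_zero h, zero_mul]))
  have h1 := (setIntegral_pos_iff_support_of_nonneg_ae
    (μ := volumeMeasure I (pullback I (𝓡 D) Φ g.inner)) (s := L)
    (f := fun p => meanComponent I g Φ q₀ f p * r) (Filter.Eventually.of_forall hpos)
    (hint.mul_const r)).2 (by
      rw [inter_eq_left.2 hsupL]
      exact volumeMeasure_pos hΦ hnd hcont.isOpen_support ⟨p, hp⟩)
  rw [integral_mul_const, h0, zero_mul] at h1
  exact lt_irrefl _ h1

/-- A submanifold of extremal volume has vanishing mean curvature. -/
theorem HasExtremalVolume.meanCurvature_eq_zero (hext : HasExtremalVolume I (𝓡 D) g.inner Φ)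
    (hemb : Manifold.IsSmoothEmbedding I (𝓡 D) ∞ Φ) (hnd : IsNondegenerate I (𝓡 D) g.inner Φ)
    (p₀ : S) : meanCurvature I (𝓡 D) g.inner Φ p₀ = 0 := by
  have hΦ : ContMDiff I (𝓡 D) ∞ Φ := hemb.contMDiff
  have hnhds : ∀ p : S, ∀ A ∈ 𝓝 p, ∃ B ∈ 𝓝 (Φ p), Φ ⁻¹' B ⊆ A := fun p A hA => by
    rwa [hemb.isEmbedding.isInducing.nhds_eq_comap] at hA
  have hchart : ∀ (q₀ q : V), q ∈ (extChartAt (𝓡 D) q₀).source → ∀ B ∈ 𝓝 q,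
      (extChartAt (𝓡 D) q₀).target ∩ (extChartAt (𝓡 D) q₀).symm ⁻¹' B ∈
        𝓝 (extChartAt (𝓡 D) q₀ q) := fun q₀ q hq B hB => by
    refine Filter.inter_mem ((isOpen_extChartAt_target q₀).mem_nhds
      ((extChartAt (𝓡 D) q₀).map_source hq)) ?_
    refine (continuousAt_extChartAt_symm' hq).preimage_mem_nhds ?_
    rwa [(extChartAt (𝓡 D) q₀).left_inv hq]
  by_contra hH
  obtain ⟨w, hw⟩ : ∃ w : 𝔼 D, g.inner (Φ p₀) w (meanCurvature I (𝓡 D) g.inner Φ p₀) ≠ 0 := by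
    by_contra! h
    exact hH (g.nondegenerate _ _ fun w => (g.symm _ _ _).trans (h w))
  obtain ⟨N, hN, hNn, hNk⟩ :=
    exists_normalField (g := g) (hemb.isImmersion.isImmersionAt p₀) hΦ hnd w
  set x := extChartAt (𝓡 D) (Φ p₀) with hx
  have hq₀ : Φ p₀ ∈ x.source := mem_extChartAt_source (I := 𝓡 D) (Φ p₀)
  obtain ⟨B, hB, hBn⟩ := hnhds p₀ _ hNn
  have hN1 : ∀ᶠ z in 𝓝 (x (Φ p₀)), ContDiffAt ℝ 1 N z :=
    (hN.of_le (by simp)).eventually (by simp)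
  obtain ⟨χ₁, hχs, hχc, hχd, -, hχ1⟩ := exists_contDiff_tsupport_subset (n := 1)
    (Filter.inter_mem (hchart _ _ hq₀ B hB) hN1)
  have hnormal : ∀ χ : 𝔼 D → ℝ, tsupport χ ⊆ tsupport χ₁ →
      IsNormalField I g Φ (Φ p₀) (fun z => χ z • N z) := fun χ hχ =>
    isNormalField_smul fun p hq hz v => by
      refine hBn (?_ : Φ p ∈ B) v
      have := (hχs (hχ hz)).1.2
      rwa [mem_preimage, x.left_inv hq] at this
  set f₁ : 𝔼 D → 𝔼 D := fun z => χ₁ z • N z with hf₁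
  have hf₁d : ContDiff ℝ 1 f₁ := contDiff_smul_of_tsupport hχd fun z hz => (hχs hz).2
  have hf₁c : HasCompactSupport f₁ := hχc.smul_right
  have hf₁s : tsupport f₁ ⊆ x.target :=
    (tsupport_smul_subset_left χ₁ N).trans fun z hz => (hχs hz).1.1
  have hcont : Continuous (meanComponent I g Φ (Φ p₀) f₁) :=
    (hnormal χ₁ subset_rfl).continuous_meanComponent hΦ hnd hf₁d hf₁c hf₁s
  have hne : meanComponent I g Φ (Φ p₀) f₁ p₀ ≠ 0 := by
    have h1 : chartField (Φ p₀) f₁ (Φ p₀) = N (x (Φ p₀)) := by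
      refine (chartField_of_mem hq₀).trans ((fromChart_self _).trans ?_)
      change χ₁ (x (Φ p₀)) • N (x (Φ p₀)) = _
      rw [hχ1, one_smul]
    have h2 : meanComponent I g Φ (Φ p₀) f₁ p₀ =
        g.inner (Φ p₀) w (meanCurvature I (𝓡 D) g.inner Φ p₀) := by
      unfold meanComponent
      rw [h1]
      exact hNk _ (inner_meanCurvature hnd p₀)
    rwa [h2]
  obtain ⟨p₁, hp₁, hp₁i⟩ := (dense_interior I (S := S)).inter_open_nonempty _
    hcont.isOpen_support ⟨p₀, hne⟩
  set r := meanComponent I g Φ (Φ p₀) f₁ p₁ with hr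
  have hr0 : r ≠ 0 := hp₁
  have hq₁ : Φ p₁ ∈ x.source := by
    by_contra h
    exact hr0 (meanComponent_eq_zero (chartField_of_notMem h))
  have : LocallyCompactSpace S := Manifold.locallyCompact_of_finiteDimensional I
  obtain ⟨K, hK, hp₁K, hKs⟩ := exists_compact_subset
    ((I.isOpen_interior (n := ∞) (M := S) (by simp)).inter
      (isOpen_lt continuous_const (hcont.mul (continuous_const (y := r)))))
    (show p₁ ∈ I.interior S ∩ {p | 0 < meanComponent I g Φ (Φ p₀) f₁ p * r} from
      ⟨hp₁i, mul_self_pos.2 hr0⟩)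
  obtain ⟨B', hB', hBK⟩ := hnhds p₁ K (mem_interior_iff_mem_nhds.1 hp₁K)
  obtain ⟨χ₂, hχ₂s, -, hχ₂d, hχ₂r, hχ₂1⟩ := exists_contDiff_tsupport_subset (n := 1)
    (hchart _ _ hq₁ B' hB')
  have hmul : (fun z => (χ₂ z * χ₁ z) • N z) = fun z => χ₂ z • f₁ z :=
    funext fun z => mul_smul _ _ _
  have hn₂ := hnormal (fun z => χ₂ z * χ₁ z) (tsupport_mul_subset_right (f := χ₂) (g := χ₁))
  rw [hmul] at hn₂
  have hsupp : ∀ p ∉ K, chartField (Φ p₀) (fun z => χ₂ z • f₁ z) (Φ p) = 0 := fun p hp => by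
    by_cases hq : Φ p ∈ x.source
    · have h1 : χ₂ (x (Φ p)) = 0 := image_eq_zero_of_notMem_tsupport fun hz => hp (hBK (by
        have := (hχ₂s hz).2
        rwa [mem_preimage, x.left_inv hq] at this))
      rw [chartField_smul, ← hx, h1, zero_smul]
    · exact chartField_of_notMem hq
  have hd₂ : ContDiff ℝ 1 fun z => χ₂ z • f₁ z := hχ₂d.smul hf₁d
  have hval : ∀ p, meanComponent I g Φ (Φ p₀) (fun z => χ₂ z • f₁ z) p =
      χ₂ (x (Φ p)) * meanComponent I g Φ (Φ p₀) f₁ p := fun p => meanComponent_smul χ₂ f₁ p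
  have hpos : ∀ p, 0 ≤ meanComponent I g Φ (Φ p₀) (fun z => χ₂ z • f₁ z) p * r := fun p => by
    by_cases hp : p ∈ K
    · rw [hval, mul_assoc]
      exact mul_nonneg (hχ₂r (mem_range_self _)).1 (hKs hp).2.le
    · rw [meanComponent_eq_zero (hsupp p hp), zero_mul]
  have hts : tsupport (fun z => χ₂ z • f₁ z) ⊆ tsupport f₁ :=
    closure_mono fun z hz h => hz (by change χ₂ z • f₁ z = 0; rw [h, smul_zero])
  have hc₂ : HasCompactSupport fun z => χ₂ z • f₁ z :=
    hf₁c.isCompact.of_isClosed_subset (isClosed_tsupport _) hts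
  have hs₂ : tsupport (fun z => χ₂ z • f₁ z) ⊆ x.target := hts.trans hf₁s
  have h0 := hn₂.meanComponent_eq_zero_of_pos hΦ hnd hd₂ hc₂ hs₂ hext hK
    (fun p hp => (hKs hp).1) hsupp hpos p₁
  rw [hval, hχ₂1, one_mul] at h0
  exact hr0 (mul_self_eq_zero.1 h0)

end ChartField

end Extremal

end SemiRiem

end

open SemiRiem in
theorem mainTheorem2 {d D : ℕ}
    -- the ambient semi-Riemannian manifold `(V, g)`
    {V : Type*} [TopologicalSpace V] [T2Space V] [ChartedSpace (EuclideanSpace ℝ (Fin D)) V]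
    [IsManifold (𝓡 D) ∞ V] (g : SemiRiemannianMetric (𝓡 D) V)
    -- the manifold `S`, possibly with boundary
    {H : Type*} [TopologicalSpace H] (I : ModelWithCorners ℝ (EuclideanSpace ℝ (Fin d)) H)
    {S : Type*} [TopologicalSpace S] [T2Space S] [SigmaCompactSpace S] [ChartedSpace H S]
    [IsManifold I ∞ S] [MeasurableSpace S] [BorelSpace S]
    -- the embedding
    (Φ : S → V) (hΦ : Manifold.IsSmoothEmbedding I (𝓡 D) ∞ Φ)
    (hnd : IsNondegenerate I (𝓡 D) g.inner Φ) :
    (∀ (U : Set V) (ξ : (x : V) → TangentSpace (𝓡 D) x), IsOpen U → range Φ ⊆ U →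
      ContMDiffOn (𝓡 D) (𝓡 D).tangent 1 (fun x => (⟨x, ξ x⟩ : TangentBundle (𝓡 D) V)) U →
      (∀ p, halfTraceLie I (𝓡 D) g.inner Φ ξ p = divPlusMean I (𝓡 D) g.inner Φ ξ p) ∧
      ∀ (W : Set (ℝ × V)) (φ : ℝ → V → V), IsLocalFlow (𝓡 D) ξ U W φ →
        (∀ (p : S) (v : Fin d → TangentSpace I p),
          HasDerivAt (fun τ => volumeElement I (pullback I (𝓡 D) (φ τ ∘ Φ) g.inner) p v)
            (halfTraceLie I (𝓡 D) g.inner Φ ξ p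
              * volumeElement I (pullback I (𝓡 D) Φ g.inner) p v) 0) ∧
        ∀ K : Set S, IsCompact K →
          IntegrableOn (divPlusMean I (𝓡 D) g.inner Φ ξ) K
            (volumeMeasure I (pullback I (𝓡 D) Φ g.inner)) ∧
          HasDerivAt (fun τ => volumeOver I (𝓡 D) g.inner K (φ τ ∘ Φ))
            (∫ p in K, divPlusMean I (𝓡 D) g.inner Φ ξ p
              ∂volumeMeasure I (pullback I (𝓡 D) Φ g.inner)) 0) ∧
    (HasExtremalVolume I (𝓡 D) g.inner Φ → ∀ p, meanCurvature I (𝓡 D) g.inner Φ p = 0) := by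
  have hs : ContMDiff I (𝓡 D) ∞ Φ := hΦ.contMDiff
  refine ⟨fun U ξ hU hΦU hξ => ?_, fun hext p => hext.meanCurvature_eq_zero hΦ hnd p⟩
  have h1 : halfTraceLie I (𝓡 D) g.inner Φ ξ = divPlusMean I (𝓡 D) g.inner Φ ξ :=
    funext fun p => halfTraceLie_eq_divPlusMean hs hnd
      (hξ.contMDiffAt (hU.mem_nhds (hΦU (Set.mem_range_self p))))
  refine ⟨fun p => congrFun h1 p, fun W φ hφ =>
    ⟨fun p v => hφ.hasDerivAt_volumeElement hs hnd hU hΦU hξ p v, fun K hK => ?_⟩⟩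
  have h2 := hφ.hasDerivAt_volumeOver hs hnd hU hΦU hξ hK
  rwa [h1] at h2
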